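/- Let $A=V/\Lambda$ be a complex abelian surface, i.e. $V$ is a $2$-dimensional complex vector space, $\Lambda\subset V$ is a lattice, and there is a positive definite Hermitian form on $V$ whose imaginary part is integer-valued on $\Lambda$. For $n\ge 3$ let $$K_{n-1}(A)=\{(a_1,\dots,a_n)\in A^n : a_1+\dots+a_n=0\},$$ with the action of the alternating group $\mathfrak A_n$ by permutation of the entries, and let $\mathfrak A_n$ act on the integral singular cohomology $H^q(K_{n-1}(A),\mathbb Z)$ by $g\mapsto (g^{-1})^*$. Then the group cohomology groups $H^p(\mathfrak A_n,H^{3-p}(K_{n-1}(A),\mathbb Z))$ for $p=1,2,3$ are, up to isomorphism of abelian groups, given by $$\begin{array}{c|cccccc} p\backslash n & 3 & 4 & 5 & 6 & 7 & \ge 8\\ \hline 1 & 0 & (\mathbb Z/4\mathbb Z)^4\oplus(\mathbb Z/2\mathbb Z)^6 & (\mathbb Z/2\mathbb Z)^4 & (\mathbb Z/2\mathbb Z)^4 & (\mathbb Z/2\mathbb Z)^4 & (\mathbb Z/2\mathbb Z)^4\\ 2 & 0 & (\mathbb Z/2\mathbb Z)^4 & (\mathbb Z/3\mathbb Z)^4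 & (\mathbb Z/3\mathbb Z)^4 & 0 & 0\\ 3 & 0 & \mathbb Z/2\mathbb Z & \mathbb Z/2\mathbb Z & \mathbb Z/6\mathbb Z & \mathbb Z/6\mathbb Z & \mathbb Z/2\mathbb Z \end{array}$$ In particular, these groups are annihilated by $2$ for $n\ge 8$ and by $12$ for $3\le n<8$. -/

import Mathlib

noncomputable section

namespace KummerCohomology

open CategoryTheory

/-! ### Singular cohomology with integral coefficients -/

/-- The integral singular chain complex `C_*(X, ℤ)` of a topological space, as a functor. -/
abbrev singularChains : TopCat.{0} ⥤ ChainComplex (ModuleCat.{0} ℤ) ℕ :=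
  (AlgebraicTopology.singularChainComplexFunctor (ModuleCat.{0} ℤ)).obj (ModuleCat.of ℤ ℤ)

/-- The integral singular cochain complex `Hom(C_*(X, ℤ), ℤ)`, as a contravariant functor. -/
def singularCochains : TopCat.{0}ᵒᵖ ⥤ CochainComplex (ModuleCat.{0} ℤ) ℕ :=
  (singularChains ⋙ (((linearYoneda ℤ (ModuleCat.{0} ℤ)).obj
    (ModuleCat.of ℤ ℤ)).rightOp.mapHomologicalComplex (ComplexShape.down ℕ))).op ⋙
    HomologicalComplex.unopFunctor (ModuleCat.{0} ℤ) (ComplexShape.down ℕ)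

/-- The integral singular cohomology functor `X ↦ H^q(X, ℤ)`. -/
def singularCohomology (q : ℕ) : TopCat.{0}ᵒᵖ ⥤ ModuleCat.{0} ℤ :=
  singularCochains ⋙ HomologicalComplex.homologyFunctor (ModuleCat.{0} ℤ) (ComplexShape.up ℕ) q

/-- If a group `G` acts on a space `X` by homeomorphisms, then `G` acts linearly on `H^q(X, ℤ)`
from the left, an element `g` acting as the pull-back along `x ↦ g⁻¹ • x`. -/
def cohomologyRepresentation (G X : Type) [Group G] [TopologicalSpace X] [MulAction G X]
    [ContinuousConstSMul G X] (q : ℕ) :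
    Representation ℤ G ((singularCohomology q).obj (.op (TopCat.of X))) where
  toFun g := ((singularCohomology q).map
    (TopCat.ofHom ⟨fun x : X => g⁻¹ • x, continuous_const_smul g⁻¹⟩).op).hom
  map_one' := by
    have : TopCat.ofHom (⟨fun x : X => (1 : G)⁻¹ • x, continuous_const_smul _⟩ : C(X, X)) =
        𝟙 (TopCat.of X) := by
      ext x; simp
    rw [this, op_id, CategoryTheory.Functor.map_id]
    rfl
  map_mul' g h := by
    have : TopCat.ofHom (⟨fun x : X => (g * h)⁻¹ • x, continuous_const_smul _⟩ : C(X, X)) =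
        TopCat.ofHom (⟨fun x : X => g⁻¹ • x, continuous_const_smul _⟩ : C(X, X)) ≫
        TopCat.ofHom (⟨fun x : X => h⁻¹ • x, continuous_const_smul _⟩ : C(X, X)) := by
      ext x
      simp [mul_smul]
    rw [this, op_comp, Functor.map_comp]
    rfl

/-! ### Complex abelian varieties -/

/-- A lattice `Λ` in a complex vector space `V` is polarizable if there is a positive definite
Hermitian form on `V` whose imaginary part is integer-valued on `Λ`. A complex torus `V ⧸ Λ` is
an abelian variety precisely if `Λ` is polarizable. -/
def IsPolarizable {V : Type} [AddCommGroup V] [Module ℂ V] (Λ : Submodule ℤ V) : Prop :=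
  ∃ H : V →ₗ⋆[ℂ] V →ₗ[ℂ] ℂ,
    (∀ x y, H y x = starRingEnd ℂ (H x y)) ∧
    (∀ x, x ≠ 0 → 0 < (H x x).re) ∧
    ∀ x ∈ Λ, ∀ y ∈ Λ, ∃ m : ℤ, (H x y).im = m

/-! ### The kernel of the summation map -/

section Kernel

variable (A : Type) [AddCommGroup A] (n : ℕ)

/-- The summation map `ε : A ^ n → A`. -/
def summation : (Fin n → A) →+ A where
  toFun a := ∑ i, a i
  map_zero' := by simp
  map_add' a b := by simp [Finset.sum_add_distrib]

/-- The variety `K_{n-1}(A) = ε⁻¹(0) ⊆ A ^ n`. -/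
abbrev kerSum : AddSubgroup (Fin n → A) := (summation A n).ker

/-- The action of the symmetric group on `K_{n-1}(A)` by permutation of the entries,
`σ • (a_1, …, a_n) = (a_{σ⁻¹(1)}, …, a_{σ⁻¹(n)})`. -/
instance : MulAction (Equiv.Perm (Fin n)) (kerSum A n) where
  smul σ a := ⟨fun i => a.1 (σ⁻¹ i), by
    have h : ∑ i, a.1 i = 0 := a.2
    change ∑ i, a.1 (σ⁻¹ i) = 0
    rw [Equiv.sum_comp σ⁻¹ a.1, h]⟩
  one_smul a := by ext i; rfl
  mul_smul σ τ a := by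
    ext i
    change a.1 ((σ * τ)⁻¹ i) = a.1 (τ⁻¹ (σ⁻¹ i))
    rw [mul_inv_rev, Equiv.Perm.mul_apply]

instance [TopologicalSpace A] : ContinuousConstSMul (Equiv.Perm (Fin n)) (kerSum A n) where
  continuous_const_smul σ := by
    have h : Continuous fun a : kerSum A n => fun i => a.1 (σ⁻¹ i) :=
      continuous_pi fun i => (continuous_apply (σ⁻¹ i)).comp continuous_subtype_val
    exact h.subtype_mk _

instance [TopologicalSpace A] :
    ContinuousConstSMul (alternatingGroup (Fin n)) (kerSum A n) where
  continuous_const_smul σ := continuous_const_smul (σ : Equiv.Perm (Fin n))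

/-- The group cohomology `H^p(𝔄_n, H^q(K_{n-1}(A), ℤ))` of the alternating group. -/
def alternatingCohomology [TopologicalSpace A] (p q : ℕ) : ModuleCat.{0} ℤ :=
  groupCohomology
    (Rep.of (cohomologyRepresentation (alternatingGroup (Fin n)) (kerSum A n) q)) p

end Kernel

end KummerCohomology

end

/-! The space X = K_{n-1}(A) is a torus W / L, where L is the group of sum-zero n-tuples in Λ and W
the space of sum-zero vectors. Equivariantly for the alternating group G, its cohomology in degrees
0, 1, 2 is therefore ℤ, Hom(L, ℤ) and the group Alt(L, ℤ) of alternating forms. Singular cochains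
are arbitrary functions on simplices, so cones in W together with a set-theoretic equivariant
rounding map W → L provide explicit primitives (`TorusCover.evalOne_eq_zero_iff`,
`TorusCover.evalTwo_eq_zero_iff`). In degree two the values on lattice triangles form a group
2-cocycle of L, and a symmetric 2-cocycle on a free abelian group is a coboundary.

Since G is finite, uniquely divisible coefficients are acyclic, and ℤ → ℚ → ℚ/ℤ shifts degrees:
H^3(G, ℤ) = H^2(G, ℚ/ℤ), H^2(G, Hom(L, ℤ)) = H^1(G, Hom(L, ℚ/ℤ)), and H^1(G, Alt(L, ℤ)) consists of
the invariant ℚ/ℤ-valued forms modulo reductions of invariant rational forms.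

H^2(G, ℚ/ℤ) classifies central extensions. Carmichael's presentation has generators x_i = (0 1 i)
with x_i^3 = 1 and (x_i x_j)^2 = 1, so an extension splits as soon as lifts satisfy these relations.
As ℚ/ℤ is 3-divisible, the x_i have lifts of trivial cube. What remains is the spin defect (XY)^6
X^(-6) Y^(-6), killed by two, and the commutator of lifts of two disjoint three-cycles, killed by
three. The latter matters only for n = 6, 7, where the alternating group on the n - 3 letters fixed
by a three-cycle is neither trivial nor perfect. Both defects occur: one in a Clifford algebra over
the field with three elements, the other in a projective representation of dimension three over the
field with twenty-five elements.

With T = Hom(Λ, ℚ/ℤ), the module Hom(L, ℚ/ℤ) is T^n modulo constants. Its crossed homomorphisms are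
controlled by a connecting class in H^2(G, T) and, by Shapiro's lemma, by homomorphisms from a point
stabilizer to T. The connecting class has no defect on elements with a common fixed point, so the
spin defect survives only for n = 4 and the commutator defect only for n = 6. For n = 5 a class
arises from the cubic characters of the stabilizer.

An invariant alternating form on L is determined by one bilinear form s on Λ. For n = 3 it is
arbitrary and lifts to ℚ. For n = 4 the condition is 2(s(x, y) + s(y, x)) = 0, and for n ≥ 5 triple
transitivity makes s antisymmetric. Over ℚ these last two conditions say that s is alternating; over
ℚ/ℤ the failure to be alternating, read off on a basis of Λ, is the cohomology. -/

noncomputable section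

namespace KummerCohomology

open CategoryTheory

/-! ### Singular cochains as functions on the set of singular simplices. -/

section SingularCochains
open Simplicial

/-- Singular `k`-simplices. -/
abbrev Simplex (X : Type) [TopologicalSpace X] (k : ℕ) := C(stdSimplex ℝ (Fin (k + 1)), X)

/-- The `i`-th face of a singular simplex. -/
def Simplex.face {X : Type} [TopologicalSpace X] {k : ℕ} (σ : Simplex X (k + 1)) (i : Fin (k + 2)) :
    Simplex X k :=
  σ.comp ⟨stdSimplex.map i.succAbove, stdSimplex.continuous_map _⟩

def simplexEquiv (X : Type) [TopologicalSpace X] (k : ℕ) :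
    (TopCat.toSSet.obj (TopCat.of X)) _⦋k⦌ ≃ Simplex X k :=
  TopCat.toSSetObjEquiv (TopCat.of X) (.op ⦋k⦌)

lemma simplexEquiv_face {X : Type} [TopologicalSpace X] {k : ℕ}
    (x : (TopCat.toSSet.obj (TopCat.of X)) _⦋k+1⦌) (i : Fin (k + 2)) :
    simplexEquiv X k ((TopCat.toSSet.obj (TopCat.of X)).δ i x) = (simplexEquiv X (k+1) x).face i := by
  rfl

/-- The integral chain complex of the singular simplicial set. -/
abbrev simplicialChains (X : Type) [TopologicalSpace X] :
    ChainComplex (ModuleCat.{0} ℤ) ℕ :=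
  (TopCat.toSSet.obj (TopCat.of X)).chainComplex (ModuleCat.of ℤ ℤ)

/-- Singular cochains are homomorphisms from the group of singular chains. -/
def cochainToHom (X : Type) [TopologicalSpace X] (k : ℕ) :
    (singularCochains.obj (.op (TopCat.of X))).X k ≃ₗ[ℤ]
      ((simplicialChains X).X k ⟶ ModuleCat.of ℤ ℤ) :=
  LinearEquiv.refl ℤ ((simplicialChains X).X k ⟶ ModuleCat.of ℤ ℤ)

lemma cochainToHom_d (X : Type) [TopologicalSpace X] (k : ℕ)
    (c : (singularCochains.obj (.op (TopCat.of X))).X k) :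
    cochainToHom X (k + 1) ((singularCochains.obj (.op (TopCat.of X))).d k (k + 1) c) =
      (simplicialChains X).d (k + 1) k ≫ cochainToHom X k c := by
  rfl

lemma cochainToHom_map {X Y : Type} [TopologicalSpace X] [TopologicalSpace Y] {k : ℕ} (f : C(X, Y))
    (c : (singularCochains.obj (.op (TopCat.of Y))).X k) :
    cochainToHom X k ((singularCochains.map (TopCat.ofHom f).op).f k c) =
      (SSet.chainComplexMap (TopCat.toSSet.map (TopCat.ofHom f)) (ModuleCat.of ℤ ℤ)).f k ≫
        cochainToHom Y k c := by
  rfl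

/-- Singular cochains as functions on the set of singular simplices. -/
def cochainEquiv (X : Type) [TopologicalSpace X] (k : ℕ) :
    (singularCochains.obj (.op (TopCat.of X))).X k ≃ₗ[ℤ] (Simplex X k → ℤ) :=
  (cochainToHom X k).trans
  { toFun c σ := ((TopCat.toSSet.obj (TopCat.of X)).ιChainComplex ((simplexEquiv X k).symm σ) ≫ c).hom (1 : ℤ)
    map_add' c c' := by ext σ; rw [Preadditive.comp_add]; rfl
    map_smul' m c := by ext σ; rw [Linear.comp_smul]; rfl
    invFun f := Limits.Cofan.IsColimit.desc
      ((TopCat.toSSet.obj (TopCat.of X)).isColimitChainComplexXCofan (ModuleCat.of ℤ ℤ) k)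
      (fun x => ModuleCat.ofHom (LinearMap.toSpanSingleton ℤ ℤ (f (simplexEquiv X k x))))
    left_inv c := by
      apply SSet.chainComplex_hom_ext
      intro x
      refine (Limits.Cofan.IsColimit.fac ((TopCat.toSSet.obj (TopCat.of X)).isColimitChainComplexXCofan
        (ModuleCat.of ℤ ℤ) k) _ x).trans ?_
      ext
      simp
    right_inv f := by
      ext σ
      have h := Limits.Cofan.IsColimit.fac ((TopCat.toSSet.obj (TopCat.of X)).isColimitChainComplexXCofan
        (ModuleCat.of ℤ ℤ) k) (fun x => ModuleCat.ofHom (LinearMap.toSpanSingleton ℤ ℤ (f (simplexEquiv X k x))))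
        ((simplexEquiv X k).symm σ)
      refine (congrArg (fun φ => (ModuleCat.Hom.hom φ) (1 : ℤ)) h).trans ?_
      simp }

lemma cochainEquiv_apply (X : Type) [TopologicalSpace X] (k : ℕ)
    (c : (singularCochains.obj (.op (TopCat.of X))).X k) (σ : Simplex X k) :
    cochainEquiv X k c σ = ((TopCat.toSSet.obj (TopCat.of X)).ιChainComplex ((simplexEquiv X k).symm σ)
      ≫ cochainToHom X k c).hom (1 : ℤ) := rfl

lemma cochainEquiv_d (X : Type) [TopologicalSpace X] (k : ℕ)
    (c : (singularCochains.obj (.op (TopCat.of X))).X k) (σ : Simplex X (k + 1)) :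
    cochainEquiv X (k + 1) ((singularCochains.obj (.op (TopCat.of X))).d k (k + 1) c) σ =
      ∑ i : Fin (k + 2), (-1) ^ i.val * cochainEquiv X k c (σ.face i) := by
  rw [cochainEquiv_apply, cochainToHom_d]
  have h := SSet.ιChainComplex_d (TopCat.toSSet.obj (TopCat.of X)) (ModuleCat.of ℤ ℤ)
    ((simplexEquiv X (k + 1)).symm σ)
  rw [reassoc_of% h, Preadditive.sum_comp, ModuleCat.hom_sum, LinearMap.sum_apply]
  refine Finset.sum_congr rfl fun i _ => ?_
  rw [cochainEquiv_apply]
  have : (simplexEquiv X k).symm (σ.face i) = (TopCat.toSSet.obj (TopCat.of X)).δ i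
     ((simplexEquiv X (k + 1)).symm σ) := by
    rw [Equiv.symm_apply_eq, simplexEquiv_face, Equiv.apply_symm_apply]
  rw [this, Preadditive.zsmul_comp, ModuleCat.hom_zsmul, LinearMap.smul_apply, smul_eq_mul]

lemma cochainEquiv_map {X Y : Type} [TopologicalSpace X] [TopologicalSpace Y] {k : ℕ} (f : C(X, Y))
    (c : (singularCochains.obj (.op (TopCat.of Y))).X k) (σ : Simplex X k) :
    cochainEquiv X k ((singularCochains.map (TopCat.ofHom f).op).f k c) σ =
      cochainEquiv Y k c (f.comp σ) := by
  rw [cochainEquiv_apply, cochainToHom_map, cochainEquiv_apply]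
  rw [SSet.ι_chainComplexMap_f_assoc]
  congr 4

end SingularCochains

/-- A surjection from the cocycles whose kernel consists of the coboundaries computes homology. -/
theorem exists_shortComplex_homologyEquiv {R : Type} [CommRing R]
    (S : ShortComplex (ModuleCat.{0} R)) {M : Type} [AddCommGroup M] [Module R M]
    (φ : LinearMap.ker S.g.hom →ₗ[R] M) (hφ : Function.Surjective φ)
    (hker : ∀ x, φ x = 0 ↔ ∃ y : S.X₁, S.f y = x.1) :
    ∃ e : S.homology ≃ₗ[R] M, ∀ z : S.cycles, ∀ hz : S.iCycles z ∈ LinearMap.ker S.g.hom,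
      e (S.homologyπ z) = φ ⟨S.iCycles z, hz⟩ := by
  have h₁ : LinearMap.range S.moduleCatToCycles = LinearMap.ker φ := by
    ext x
    rw [LinearMap.mem_ker, hker]
    constructor
    · rintro ⟨y, rfl⟩
      exact ⟨y, rfl⟩
    · rintro ⟨y, hy⟩
      exact ⟨y, Subtype.ext hy⟩
  let e₁ : S.homology ≃ₗ[R] (LinearMap.ker S.g.hom ⧸ LinearMap.range S.moduleCatToCycles) :=
    S.moduleCatHomologyIso.toLinearEquiv
  refine ⟨e₁.trans ((Submodule.quotEquivOfEq _ _ h₁).trans (φ.quotKerEquivOfSurjective hφ)), ?_⟩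
  intro z hz
  have h₂ : e₁ (S.homologyπ z) = Submodule.Quotient.mk ⟨S.iCycles z, hz⟩ := by
    have := congrArg (fun f => f.hom z) S.π_moduleCatCyclesIso_hom
    refine this.trans ?_
    change Submodule.Quotient.mk (S.moduleCatCyclesIso.hom.hom z) = _
    refine congrArg Submodule.Quotient.mk (Subtype.ext ?_)
    exact congrArg (fun f => f.hom z) S.moduleCatCyclesIso_hom_i
  rw [LinearEquiv.trans_apply, LinearEquiv.trans_apply, h₂]
  rfl

/-- The coboundary of a singular cochain. -/
def coboundary (X : Type) [TopologicalSpace X] (k : ℕ) :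
    (Simplex X k → ℤ) →+ (Simplex X (k + 1) → ℤ) where
  toFun c σ := ∑ i : Fin (k + 2), (-1) ^ i.val * c (σ.face i)
  map_zero' := by ext; simp
  map_add' c c' := by ext σ; simp [mul_add, Finset.sum_add_distrib]

/-- The group of singular cocycles. -/
abbrev cocycle (X : Type) [TopologicalSpace X] (k : ℕ) : AddSubgroup (Simplex X k → ℤ) :=
  (coboundary X k).ker

/-- A cochain is exact if it is a coboundary (zero in degree zero). -/
def IsExact {X : Type} [TopologicalSpace X] : (k : ℕ) → (Simplex X k → ℤ) → Prop
  | 0, c => c = 0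
  | k + 1, c => ∃ b, coboundary X k b = c

/-- Pull-back of cocycles. -/
def comapCocycle {X Y : Type} [TopologicalSpace X] [TopologicalSpace Y] (f : C(X, Y)) {k : ℕ}
    (c : cocycle Y k) : cocycle X k :=
  ⟨fun σ => c.1 (f.comp σ), by
    ext σ
    exact congrFun (show coboundary Y k c.1 = 0 from c.2) (f.comp σ)⟩

theorem cochainEquiv_coboundary (X : Type) [TopologicalSpace X] (k : ℕ)
    (c : (singularCochains.obj (.op (TopCat.of X))).X k) :
    cochainEquiv X (k + 1) ((singularCochains.obj (.op (TopCat.of X))).d k (k + 1) c) =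
      coboundary X k (cochainEquiv X k c) := by
  ext σ
  exact cochainEquiv_d X k c σ

theorem isExact_cochainEquiv_iff (X : Type) [TopologicalSpace X] (k : ℕ)
    (c : (singularCochains.obj (.op (TopCat.of X))).X k) :
    IsExact k (cochainEquiv X k c) ↔
      ∃ y, (singularCochains.obj (.op (TopCat.of X))).d ((ComplexShape.up ℕ).prev k) k y = c := by
  cases k with
  | zero =>
    -- No index precedes `0`, so `prev 0` is a default value and the differential into degree zero
    -- vanishes. This matches the convention that only the zero cochain is exact there.
    have h : (singularCochains.obj (.op (TopCat.of X))).d ((ComplexShape.up ℕ).prev 0) 0 = 0 :=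
      HomologicalComplex.shape _ _ _ (by simp)
    rw [h]
    constructor
    · intro hc
      exact ⟨0, ((cochainEquiv X 0).map_eq_zero_iff.1 hc).symm⟩
    · rintro ⟨y, rfl⟩
      exact map_zero (cochainEquiv X 0)
  | succ k =>
    have h : (ComplexShape.up ℕ).prev (k + 1) = k := (ComplexShape.up ℕ).prev_eq' rfl
    rw [h]
    constructor
    · rintro ⟨b, hb⟩
      refine ⟨(cochainEquiv X k).symm b, (cochainEquiv X (k + 1)).injective ?_⟩
      rw [cochainEquiv_coboundary, LinearEquiv.apply_symm_apply, hb]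
    · rintro ⟨y, rfl⟩
      exact ⟨cochainEquiv X k y, (cochainEquiv_coboundary X k y).symm⟩

/-- A surjection from the concrete cocycles whose kernel consists of the exact ones computes
singular cohomology, compatibly with continuous self-maps. -/
theorem exists_singularCohomologyEquiv (X : Type) [TopologicalSpace X] (q : ℕ)
    {M : Type} [AddCommGroup M] (φ : cocycle X q →+ M) (hφ : Function.Surjective φ)
    (hker : ∀ c, φ c = 0 ↔ IsExact q c.1) :
    ∃ e : (singularCohomology q).obj (.op (TopCat.of X)) ≃+ M, ∀ (f : C(X, X)) (ψ : M → M),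
      (∀ c, φ (comapCocycle f c) = ψ (φ c)) → ∀ x,
      e (((singularCohomology q).map (TopCat.ofHom f).op).hom x) = ψ (e x) := by
  let K := singularCochains.obj (.op (TopCat.of X))
  have hnext : (ComplexShape.up ℕ).next q = q + 1 := (ComplexShape.up ℕ).next_eq' rfl
  have hmem : ∀ x : (K.sc q).X₂,
      x ∈ LinearMap.ker (K.sc q).g.hom ↔ cochainEquiv X q x ∈ cocycle X q := by
    intro x
    rw [AddMonoidHom.mem_ker]
    refine Iff.trans ?_ (Eq.congr_left (cochainEquiv_coboundary X q x))
    rw [LinearEquiv.map_eq_zero_iff]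
    change K.d q ((ComplexShape.up ℕ).next q) x = 0 ↔ K.d q (q + 1) x = 0
    rw [hnext]
  let φ' : LinearMap.ker (K.sc q).g.hom →ₗ[ℤ] M :=
    { toFun x := φ ⟨cochainEquiv X q x.1, (hmem _).1 x.2⟩
      map_add' x y := by
        rw [← map_add]
        refine congrArg φ ?_
        exact Subtype.ext (map_add (cochainEquiv X q) x.1 y.1)
      map_smul' m x := by
        rw [RingHom.id_apply, ← map_zsmul]
        refine congrArg φ ?_
        exact Subtype.ext (map_smul (cochainEquiv X q) m x.1) }
  obtain ⟨e, he⟩ := exists_shortComplex_homologyEquiv (K.sc q) φ'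
    (fun m => by
      obtain ⟨c, hc⟩ := hφ m
      refine ⟨⟨(cochainEquiv X q).symm c.1, ?_⟩, ?_⟩
      · refine (hmem _).2 ?_
        rw [LinearEquiv.apply_symm_apply]
        exact c.2
      · rw [← hc]
        exact congrArg φ (Subtype.ext ((cochainEquiv X q).apply_symm_apply _)))
    (fun x => (hker _).trans (isExact_cochainEquiv_iff X q x.1))
  refine ⟨e.toAddEquiv, fun f ψ hψ x => ?_⟩
  obtain ⟨z, rfl⟩ := (ModuleCat.epi_iff_surjective (K.homologyπ q)).1 inferInstance x
  let F := singularCochains.map (TopCat.ofHom f).op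
  have h₁ : ((singularCohomology q).map (TopCat.ofHom f).op).hom (K.homologyπ q z) =
      K.homologyπ q (HomologicalComplex.cyclesMap F q z) :=
    congrArg (fun g => g.hom z) (HomologicalComplex.homologyπ_naturality F q)
  have h₂ : K.iCycles q (HomologicalComplex.cyclesMap F q z) = F.f q (K.iCycles q z) :=
    congrArg (fun g => g.hom z) (HomologicalComplex.cyclesMap_i F q)
  have hz : ∀ z : K.cycles q, K.iCycles q z ∈ LinearMap.ker (K.sc q).g.hom := fun z =>
    congrArg (fun g : (K.sc q).cycles ⟶ (K.sc q).X₃ => g.hom z) (K.sc q).iCycles_g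
  rw [h₁]
  refine (he _ (hz _)).trans ((Eq.trans ?_ (hψ _)).trans (congrArg ψ (he z (hz z)).symm))
  refine congrArg φ (Subtype.ext ?_)
  ext σ
  change cochainEquiv X q (K.iCycles q (HomologicalComplex.cyclesMap F q z)) σ = _
  rw [h₂]
  exact cochainEquiv_map f _ σ

/-! ### Cones and affine simplices -/

section Join

variable {k : ℕ}

/-- The point `u e₀ + (1 - u) s` of the join of a vertex with a standard simplex. -/
def joinPoint (x : stdSimplex ℝ (Fin (k + 1)) × unitInterval) : stdSimplex ℝ (Fin (k + 2)) :=
  ⟨Fin.cons (x.2 : ℝ) fun i => (1 - (x.2 : ℝ)) * x.1 i, by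
    constructor
    · intro i
      refine Fin.cases ?_ (fun i => ?_) i
      · exact x.2.2.1
      · exact mul_nonneg (sub_nonneg.2 x.2.2.2) (x.1.2.1 i)
    · rw [Fin.sum_univ_succ]
      simp only [Fin.cons_zero, Fin.cons_succ]
      rw [← Finset.mul_sum, stdSimplex.sum_eq_one]
      ring⟩

lemma joinPoint_zero (x : stdSimplex ℝ (Fin (k + 1)) × unitInterval) :
    joinPoint x 0 = x.2 := rfl

lemma joinPoint_succ (x : stdSimplex ℝ (Fin (k + 1)) × unitInterval) (i : Fin (k + 1)) :
    joinPoint x i.succ = (1 - (x.2 : ℝ)) * x.1 i := rfl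

lemma continuous_joinPoint : Continuous (joinPoint (k := k)) := by
  refine Continuous.subtype_mk (continuous_pi fun i => ?_) _
  refine Fin.cases ?_ (fun i => ?_) i
  · exact continuous_subtype_val.comp continuous_snd
  · simp only [Fin.cons_succ]
    refine (continuous_const.sub (continuous_subtype_val.comp continuous_snd)).mul ?_
    exact (continuous_apply i).comp (continuous_subtype_val.comp continuous_fst)

lemma joinPoint_surjective : Function.Surjective (joinPoint (k := k)) := by
  intro t
  have h1 : t 0 ≤ 1 := stdSimplex.le_one t 0
  by_cases h : t 0 = 1
  · refine ⟨(stdSimplex.vertex 0, 1), ?_⟩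
    ext i
    have hs : ∑ i : Fin (k + 1), t i.succ = 0 := by
      have := stdSimplex.sum_eq_one t
      rw [Fin.sum_univ_succ, h] at this
      linarith
    rw [Finset.sum_eq_zero_iff_of_nonneg fun i _ => stdSimplex.zero_le t _] at hs
    refine Fin.cases ?_ (fun i => ?_) i
    · rw [joinPoint_zero, h]; rfl
    · rw [joinPoint_succ, hs i (Finset.mem_univ _)]; simp
  · have h2 : 0 < 1 - t 0 := by
      rcases lt_or_eq_of_le h1 with h' | h'
      · linarith
      · exact absurd h' h
    refine ⟨(⟨fun i => t i.succ / (1 - t 0), fun i => div_nonneg (t.2.1 _) h2.le, ?_⟩,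
      ⟨t 0, t.2.1 0, h1⟩), ?_⟩
    · rw [← Finset.sum_div, div_eq_one_iff_eq h2.ne']
      have := stdSimplex.sum_eq_one t
      rw [Fin.sum_univ_succ] at this
      linarith
    · ext i
      refine Fin.cases ?_ (fun i => ?_) i
      · rfl
      · rw [joinPoint_succ]
        exact mul_div_cancel₀ _ h2.ne'

/-- The join parametrization as a bundled continuous map. -/
def joinMap (k : ℕ) :
    C(stdSimplex ℝ (Fin (k + 1)) × unitInterval, stdSimplex ℝ (Fin (k + 2))) :=
  ⟨joinPoint, continuous_joinPoint⟩

/-- A continuous surjection from a compact space onto a Hausdorff space is closed. This yields the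
continuity of cones without any estimate near the apex. -/
lemma isQuotientMap_joinMap : Topology.IsQuotientMap (joinMap k) :=
  (continuous_joinPoint.isClosedMap).isQuotientMap continuous_joinPoint joinPoint_surjective

lemma map_succAbove_apply {m : ℕ} (i : Fin (m + 1)) (t : stdSimplex ℝ (Fin m)) (j : Fin m) :
    stdSimplex.map i.succAbove t (i.succAbove j) = t j := by
  rw [stdSimplex.map_coe, FunOnFinite.linearMap_apply_apply]
  rw [Finset.sum_eq_single j]
  · intro b hb hbj
    simp only [Finset.mem_filter] at hb
    exact absurd (Fin.succAbove_right_injective hb.2) hbj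
  · simp

lemma map_succAbove_self {m : ℕ} (i : Fin (m + 1)) (t : stdSimplex ℝ (Fin m)) :
    stdSimplex.map i.succAbove t i = 0 := by
  rw [stdSimplex.map_coe, FunOnFinite.linearMap_apply_apply]
  refine Finset.sum_eq_zero fun j hj => ?_
  simp only [Finset.mem_filter] at hj
  exact absurd hj.2 (Fin.succAbove_ne i j)

lemma map_zero_succAbove (s : stdSimplex ℝ (Fin (k + 1))) :
    stdSimplex.map (Fin.succAbove 0) s = joinPoint (s, 0) := by
  ext i
  refine Fin.cases ?_ (fun i => ?_) i
  · rw [map_succAbove_self, joinPoint_zero]; rfl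
  · rw [joinPoint_succ, ← Fin.zero_succAbove, map_succAbove_apply]; simp

lemma map_succ_succAbove (i : Fin (k + 2)) (s : stdSimplex ℝ (Fin (k + 1))) (u : unitInterval) :
    stdSimplex.map i.succ.succAbove (joinPoint (s, u)) =
      joinPoint (stdSimplex.map i.succAbove s, u) := by
  ext j
  refine Fin.cases ?_ (fun j => ?_) j
  · rw [joinPoint_zero]
    conv_lhs => rw [← Fin.succ_succAbove_zero i]
    rw [map_succAbove_apply, joinPoint_zero]
  · rw [joinPoint_succ]
    rcases Fin.eq_self_or_eq_succAbove i j with rfl | ⟨j, rfl⟩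
    · rw [map_succAbove_self, map_succAbove_self, mul_zero]
    · rw [← Fin.succ_succAbove_succ, map_succAbove_apply, map_succAbove_apply, joinPoint_succ]

end Join

section Cone

variable {W : Type} [NormedAddCommGroup W] [NormedSpace ℝ W] {k : ℕ}

/-- The cone over a singular simplex, as a homotopy. -/
def coneHomotopy (p : W) (σ : Simplex W k) : C(stdSimplex ℝ (Fin (k + 1)) × unitInterval, W) :=
  ⟨fun x => (x.2 : ℝ) • p + (1 - (x.2 : ℝ)) • σ x.1, by fun_prop⟩

/-- The join parametrization identifies points only at `u = 1`, where the homotopy is constantly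
`p`. -/
lemma coneHomotopy_factorsThrough (p : W) (σ : Simplex W k) :
    Function.FactorsThrough (coneHomotopy p σ) (joinMap k) := by
  rintro ⟨s, u⟩ ⟨s', u'⟩ h
  replace h : joinPoint (s, u) = joinPoint (s', u') := h
  have hu : (u : ℝ) = u' := congrArg (fun t : stdSimplex ℝ (Fin (k + 2)) => t 0) h
  have hs : ∀ i, (1 - (u : ℝ)) * s i = (1 - (u : ℝ)) * s' i := fun i => by
    have := congrArg (fun t : stdSimplex ℝ (Fin (k + 2)) => t i.succ) h
    simp only [joinPoint_succ] at this
    rwa [← hu] at this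
  change (u : ℝ) • p + (1 - (u : ℝ)) • σ s = (u' : ℝ) • p + (1 - (u' : ℝ)) • σ s'
  rw [← hu]
  by_cases h1 : 1 - (u : ℝ) = 0
  · rw [h1, zero_smul, zero_smul]
  · have : s = s' := by
      ext i
      exact mul_left_cancel₀ h1 (hs i)
    rw [this]

/-- The cone over a singular simplex with a given apex. -/
def cone (p : W) (σ : Simplex W k) : Simplex W (k + 1) :=
  isQuotientMap_joinMap.lift (coneHomotopy p σ) (coneHomotopy_factorsThrough p σ)

lemma cone_joinPoint (p : W) (σ : Simplex W k) (s : stdSimplex ℝ (Fin (k + 1)))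
    (u : unitInterval) :
    cone p σ (joinPoint (s, u)) = (u : ℝ) • p + (1 - (u : ℝ)) • σ s :=
  congrArg (fun f : C(stdSimplex ℝ (Fin (k + 1)) × unitInterval, W) => f (s, u))
    (isQuotientMap_joinMap.lift_comp (coneHomotopy p σ) (coneHomotopy_factorsThrough p σ))

lemma cone_face_zero (p : W) (σ : Simplex W k) : (cone p σ).face 0 = σ := by
  ext s
  change cone p σ (stdSimplex.map (Fin.succAbove 0) s) = σ s
  rw [map_zero_succAbove, cone_joinPoint]
  simp

lemma cone_face_succ (p : W) (σ : Simplex W (k + 1)) (i : Fin (k + 2)) :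
    (cone p σ).face i.succ = cone p (σ.face i) := by
  ext t
  obtain ⟨⟨s, u⟩, rfl⟩ := joinPoint_surjective t
  change cone p σ (stdSimplex.map i.succ.succAbove (joinPoint (s, u))) = _
  rw [map_succ_succAbove, cone_joinPoint, cone_joinPoint]
  rfl

/-- The constant zero-simplex at a point. -/
def point (p : W) : Simplex W 0 := ContinuousMap.const _ p

/-- The `i`-th vertex of a singular simplex. -/
def Simplex.vert {X : Type} [TopologicalSpace X] (σ : Simplex X k) (i : Fin (k + 1)) : X :=
  σ (stdSimplex.vertex i)

lemma Simplex.vert_face {X : Type} [TopologicalSpace X] (σ : Simplex X (k + 1)) (i : Fin (k + 2))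
    (j : Fin (k + 1)) : (σ.face i).vert j = σ.vert (i.succAbove j) := by
  change σ (stdSimplex.map i.succAbove (stdSimplex.vertex j)) = _
  rw [stdSimplex.map_vertex]
  rfl

omit [NormedSpace ℝ W] in
lemma eq_point (σ : Simplex W 0) : σ = point (σ.vert 0) := by
  ext t
  exact congrArg σ (Subsingleton.elim _ _)

omit [NormedSpace ℝ W] in
lemma vert_point (p : W) : (point p).vert 0 = p := rfl

omit [NormedSpace ℝ W] in
lemma comp_point {W' : Type} [NormedAddCommGroup W'] (F : C(W, W')) (p : W) :
    F.comp (point p) = point (F p) := rfl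

lemma vertex_zero_eq : (stdSimplex.vertex 0 : stdSimplex ℝ (Fin (k + 2))) =
    joinPoint (stdSimplex.vertex 0, 1) := by
  ext i
  refine Fin.cases ?_ (fun i => ?_) i
  · rw [joinPoint_zero]; simp
  · rw [joinPoint_succ]; simp

lemma vertex_succ_eq (i : Fin (k + 1)) : (stdSimplex.vertex i.succ : stdSimplex ℝ (Fin (k + 2))) =
    joinPoint (stdSimplex.vertex i, 0) := by
  ext j
  refine Fin.cases ?_ (fun j => ?_) j
  · rw [joinPoint_zero]; simp
  · rw [joinPoint_succ]; simp [Pi.single_apply]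

lemma vert_zero_cone (p : W) (σ : Simplex W k) : (cone p σ).vert 0 = p := by
  rw [Simplex.vert, vertex_zero_eq, cone_joinPoint]; simp

lemma vert_succ_cone (p : W) (σ : Simplex W k) (i : Fin (k + 1)) :
    (cone p σ).vert i.succ = σ.vert i := by
  rw [Simplex.vert, vertex_succ_eq, cone_joinPoint]; simp [Simplex.vert]

lemma cone_face_one (p : W) (σ : Simplex W 0) : (cone p σ).face 1 = point p := by
  rw [eq_point ((cone p σ).face 1), Simplex.vert_face]
  congr 1
  exact vert_zero_cone p σ

lemma comp_cone {W' : Type} [NormedAddCommGroup W'] [NormedSpace ℝ W'] (F : C(W, W'))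
    (hF : ∀ (u : ℝ) (a b : W), F (u • a + (1 - u) • b) = u • F a + (1 - u) • F b) (p : W)
    (σ : Simplex W k) : F.comp (cone p σ) = cone (F p) (F.comp σ) := by
  ext t
  obtain ⟨⟨s, u⟩, rfl⟩ := joinPoint_surjective t
  rw [ContinuousMap.comp_apply, cone_joinPoint, cone_joinPoint, hF]
  rfl

/-- Affine segments. -/
def segment (p q : W) : Simplex W 1 := cone p (point q)

/-- Affine triangles. -/
def triangle (p q s : W) : Simplex W 2 := cone p (segment q s)

variable {c : Simplex W k → ℤ}

lemma cocycle_zero_apply {X : Type} [TopologicalSpace X] {c : Simplex X 0 → ℤ} (hc : c ∈ cocycle X 0)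
    (σ : Simplex X 1) : c (σ.face 0) - c (σ.face 1) = 0 := by
  have := congrFun (AddMonoidHom.mem_ker.1 hc) σ
  simpa [coboundary, Fin.sum_univ_succ, sub_eq_add_neg] using this

lemma cocycle_one_apply {X : Type} [TopologicalSpace X] {c : Simplex X 1 → ℤ} (hc : c ∈ cocycle X 1)
    (σ : Simplex X 2) : c (σ.face 0) - c (σ.face 1) + c (σ.face 2) = 0 := by
  have := congrFun (AddMonoidHom.mem_ker.1 hc) σ
  simp [coboundary, Fin.sum_univ_succ] at this
  rw [← this]
  change _ = c (σ.face 0) + (- c (σ.face 1) + c (σ.face 2))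
  ring

lemma cocycle_two_apply {X : Type} [TopologicalSpace X] {c : Simplex X 2 → ℤ} (hc : c ∈ cocycle X 2)
    (σ : Simplex X 3) :
    c (σ.face 0) - c (σ.face 1) + c (σ.face 2) - c (σ.face 3) = 0 := by
  have := congrFun (AddMonoidHom.mem_ker.1 hc) σ
  simp [coboundary, Fin.sum_univ_succ] at this
  rw [← this]
  change _ = c (σ.face 0) + (- c (σ.face 1) + (c (σ.face 2) + - c (σ.face 3)))
  ring

lemma segment_relation {c : Simplex W 0 → ℤ} (hc : c ∈ cocycle W 0) (p q : W) :
    c (point q) - c (point p) = 0 := by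
  have := cocycle_zero_apply hc (segment p q)
  rwa [segment, cone_face_zero, cone_face_one] at this

/-- The cocycle identity on the cone over `σ` trades an arbitrary path for two affine segments
issuing from a chosen point. -/
lemma cone_relation_one {c : Simplex W 1 → ℤ} (hc : c ∈ cocycle W 1) (p : W) (σ : Simplex W 1) :
    c σ - c (segment p (σ.vert 1)) + c (segment p (σ.vert 0)) = 0 := by
  have := cocycle_one_apply hc (cone p σ)
  have h1 : (cone p σ).face 1 = segment p (σ.vert 1) := by
    have h : σ.vert 1 = (σ.face 0).vert 0 := (Simplex.vert_face σ 0 0).symm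
    rw [segment, h, ← eq_point]
    exact cone_face_succ p σ 0
  have h2 : (cone p σ).face 2 = segment p (σ.vert 0) := by
    have h : σ.vert 0 = (σ.face 1).vert 0 := (Simplex.vert_face σ 1 0).symm
    rw [segment, h, ← eq_point]
    exact cone_face_succ p σ 1
  rwa [cone_face_zero, h1, h2] at this

lemma vert_segment_zero (p q : W) : (segment p q).vert 0 = p := vert_zero_cone _ _
lemma vert_segment_one (p q : W) : (segment p q).vert 1 = q := vert_succ_cone p (point q) 0
lemma vert_triangle_zero (p q s : W) : (triangle p q s).vert 0 = p := vert_zero_cone _ _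
lemma vert_triangle_one (p q s : W) : (triangle p q s).vert 1 = q :=
  (vert_succ_cone p (segment q s) 0).trans (vert_segment_zero _ _)
lemma vert_triangle_two (p q s : W) : (triangle p q s).vert 2 = s :=
  (vert_succ_cone p (segment q s) 1).trans (vert_segment_one _ _)

lemma triangle_relation {c : Simplex W 1 → ℤ} (hc : c ∈ cocycle W 1) (p q s : W) :
    c (segment q s) - c (segment p s) + c (segment p q) = 0 := by
  have := cone_relation_one hc p (segment q s)
  rwa [vert_segment_one, vert_segment_zero] at this

lemma cone_relation_two {c : Simplex W 2 → ℤ} (hc : c ∈ cocycle W 2) (p : W) (σ : Simplex W 2) :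
    c σ - c (cone p (σ.face 0)) + c (cone p (σ.face 1)) - c (cone p (σ.face 2)) = 0 := by
  have := cocycle_two_apply hc (cone p σ)
  rw [cone_face_zero] at this
  rw [← this, ← cone_face_succ, ← cone_face_succ, ← cone_face_succ]
  rfl

lemma triangle_faces (p q s : W) : (triangle p q s).face 0 = segment q s ∧
    (triangle p q s).face 1 = segment p s ∧ (triangle p q s).face 2 = segment p q := by
  refine ⟨cone_face_zero _ _, ?_, ?_⟩
  · refine (cone_face_succ p (segment q s) 0).trans ?_
    rw [segment, cone_face_zero]; rfl
  · refine (cone_face_succ p (segment q s) 1).trans ?_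
    rw [segment, cone_face_one]; rfl

lemma tetrahedron_relation {c : Simplex W 2 → ℤ} (hc : c ∈ cocycle W 2) (p q s t : W) :
    c (triangle q s t) - c (triangle p s t) + c (triangle p q t) - c (triangle p q s) = 0 := by
  have := cone_relation_two hc p (triangle q s t)
  rwa [(triangle_faces q s t).1, (triangle_faces q s t).2.1, (triangle_faces q s t).2.2] at this

/-- This is the cocycle identity on the cone from `p` over the cone from `q`; it measures the effect
of moving the apex. -/
lemma cone_cone_relation {c : Simplex W 2 → ℤ} (hc : c ∈ cocycle W 2) (p q : W) (σ : Simplex W 1) :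
    c (cone q σ) - c (cone p σ) + c (triangle p q (σ.vert 1)) - c (triangle p q (σ.vert 0)) = 0 := by
  have := cone_relation_two hc p (cone q σ)
  have h1 : (cone q σ).face 1 = segment q (σ.vert 1) := by
    have h : σ.vert 1 = (σ.face 0).vert 0 := (Simplex.vert_face σ 0 0).symm
    rw [segment, h, ← eq_point]
    exact cone_face_succ q σ 0
  have h2 : (cone q σ).face 2 = segment q (σ.vert 0) := by
    have h : σ.vert 0 = (σ.face 1).vert 0 := (Simplex.vert_face σ 1 0).symm
    rw [segment, h, ← eq_point]
    exact cone_face_succ q σ 1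
  rwa [cone_face_zero, h1, h2] at this

end Cone

/-! ### Two-cocycles of free abelian groups -/

section AbelianCocycle

/-- The extension of an abelian group by `ℤ` attached to a symmetric two-cocycle. -/
structure AbelianExtension {L : Type} (f : L → L → ℤ) where
  /-- the component in `ℤ` -/
  fst : ℤ
  /-- the component in the base -/
  snd : L

lemma AbelianExtension.ext' {L : Type} {f : L → L → ℤ} {x y : AbelianExtension f}
    (h1 : x.fst = y.fst) (h2 : x.snd = y.snd) : x = y := by
  cases x; cases y; simp_all

instance {L : Type} [AddCommGroup L] (f : L → L → ℤ) : Add (AbelianExtension f) :=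
  ⟨fun x y => ⟨x.fst + y.fst + f x.snd y.snd, x.snd + y.snd⟩⟩

instance {L : Type} [AddCommGroup L] (f : L → L → ℤ) : Zero (AbelianExtension f) :=
  ⟨⟨-f 0 0, 0⟩⟩

instance {L : Type} [AddCommGroup L] (f : L → L → ℤ) : Neg (AbelianExtension f) :=
  ⟨fun x => ⟨-x.fst - f (-x.snd) x.snd - f 0 0, -x.snd⟩⟩

variable {L : Type} [AddCommGroup L] {f : L → L → ℤ}
  (hf : ∀ l m n, f m n - f (l + m) n + f l (m + n) - f l m = 0)

include hf

/-- The cocycle identities for `(l, m, n)`, `(n, l, m)` and `(l, n, m)` combine because `L` is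
commutative. Hence the antisymmetrization of any two-cocycle is bilinear. -/
lemma antisymmetrization_add_left (l m n : L) :
    f (l + m) n - f n (l + m) = (f l n - f n l) + (f m n - f n m) := by
  have h1 := hf l m n
  have h2 := hf n l m
  have h3 := hf l n m
  rw [add_comm n l] at h2
  rw [add_comm n m] at h3
  linarith

/-- The group structure on the extension attached to a symmetric two-cocycle. -/
@[reducible] def AbelianExtension.addCommGroup (hs : ∀ l m, f l m = f m l) :
    AddCommGroup (AbelianExtension f) where
  toAddGroup := AddGroup.ofLeftAxioms (fun x y z => by
    refine AbelianExtension.ext' ?_ (add_assoc _ _ _)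
    change x.fst + y.fst + f x.snd y.snd + z.fst + f (x.snd + y.snd) z.snd =
      x.fst + (y.fst + z.fst + f y.snd z.snd) + f x.snd (y.snd + z.snd)
    linarith [hf x.snd y.snd z.snd]) (fun x => by
    refine AbelianExtension.ext' ?_ (zero_add _)
    change -f 0 0 + x.fst + f 0 x.snd = x.fst
    have := hf 0 0 x.snd
    simp only [zero_add] at this
    linarith) (fun x => by
    refine AbelianExtension.ext' ?_ (neg_add_cancel _)
    change -x.fst - f (-x.snd) x.snd - f 0 0 + x.fst + f (-x.snd) x.snd = - f 0 0
    ring)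
  add_comm x y := by
    refine AbelianExtension.ext' ?_ (add_comm _ _)
    change x.fst + y.fst + f x.snd y.snd = y.fst + x.fst + f y.snd x.snd
    rw [hs x.snd y.snd]
    ring

/-- A symmetric two-cocycle on a free abelian group is a coboundary. -/
theorem exists_eq_coboundary_of_symmetric [Module.Free ℤ L] (hs : ∀ l m, f l m = f m l) :
    ∃ g : L → ℤ, ∀ l m, f l m = g m - g (l + m) + g l := by
  let := AbelianExtension.addCommGroup hf hs
  let π : AbelianExtension f →+ L :=
    { toFun x := x.snd
      map_zero' := rfl
      map_add' _ _ := rfl }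
  -- Symmetry makes the extension abelian, so freeness of `L` gives an additive section; minus its
  -- `ℤ`-component is a primitive.
  obtain ⟨s, hs⟩ := Module.projective_lifting_property π.toIntLinearMap LinearMap.id
    (fun l => ⟨⟨0, l⟩, rfl⟩)
  have hs' : ∀ l, (s l).snd = l := fun l => congrArg (fun h => h l) hs
  refine ⟨fun l => - (s l).fst, fun l m => ?_⟩
  have h := congrArg AbelianExtension.fst (map_add s l m)
  change _ = (s l).fst + (s m).fst + f (s l).snd (s m).snd at h
  rw [hs', hs'] at h
  linarith

end AbelianCocycle

/-! ### Alternating forms -/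

/-- Alternating bilinear forms on an abelian group. -/
abbrev altForms (L T : Type) [AddCommGroup L] [AddCommGroup T] : AddSubgroup (L →+ L →+ T) where
  carrier := {B | ∀ x, B x x = 0}
  zero_mem' := by intro x; rfl
  add_mem' {B C} hB hC := by
    intro x
    rw [AddMonoidHom.add_apply, AddMonoidHom.add_apply, hB x, hC x, add_zero]
  neg_mem' {B} hB := by
    intro x
    rw [AddMonoidHom.neg_apply, AddMonoidHom.neg_apply, hB x, neg_zero]

lemma altForms.antisymm {L T : Type} [AddCommGroup L] [AddCommGroup T] {B : L →+ L →+ T}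
    (hB : B ∈ altForms L T) (x y : L) : B x y = -B y x := by
  have h : B (x + y) (x + y) = 0 := hB (x + y)
  simp only [map_add, AddMonoidHom.add_apply] at h
  rw [hB x, hB y, zero_add, add_zero, add_comm] at h
  exact eq_neg_of_add_eq_zero_left h

/-- Every alternating form on a free abelian group is the antisymmetrization of a bilinear form. -/
theorem exists_antisymmetrization {L T : Type} [AddCommGroup L] [Module.Free ℤ L] [AddCommGroup T]
    {B : L →+ L →+ T} (hB : B ∈ altForms L T) :
    ∃ β : L →+ L →+ T, ∀ l m, B l m = β l m - β m l := by
  classical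
  let b := Module.Free.chooseBasis ℤ L
  -- With the basis totally ordered, `β` keeps the part of `B` above the diagonal.
  let : LinearOrder (Module.Free.ChooseBasisIndex ℤ L) := IsWellOrder.linearOrder WellOrderingRel
  let β : L →ₗ[ℤ] L →ₗ[ℤ] T := b.constr ℤ fun i => b.constr ℤ fun j =>
    if i < j then B (b i) (b j) else 0
  have hβ : ∀ i j, β (b i) (b j) = if i < j then B (b i) (b j) else 0 := fun i j => by
    simp [β, Module.Basis.constr_basis]
  let B' : L →ₗ[ℤ] L →ₗ[ℤ] T :=
    { toFun l := (B l).toIntLinearMap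
      map_add' x y := by ext z; simp
      map_smul' m x := by ext z; simp }
  have h : B' = β - β.flip := by
    refine b.ext fun i => b.ext fun j => ?_
    rw [LinearMap.sub_apply, LinearMap.sub_apply, LinearMap.flip_apply, hβ, hβ]
    change B (b i) (b j) = _
    rcases lt_trichotomy i j with h | rfl | h
    · rw [if_pos h, if_neg h.not_gt, sub_zero]
    · rw [if_neg (lt_irrefl _), sub_zero]; exact hB _
    · rw [if_neg h.not_gt, if_pos h, zero_sub]; exact altForms.antisymm hB _ _
  refine ⟨⟨⟨fun l => (β l).toAddMonoidHom, ?_⟩, ?_⟩, fun l m => ?_⟩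
  · ext z; simp
  · intro x y; ext z; simp
  · exact congrArg (fun h => h l m) h

/-! ### Cohomology of a torus in low degrees -/

/-- A covering of a space by a normed space with deck transformation group `L` acting by
translations, such that singular simplices lift uniquely up to deck transformations. -/
structure TorusCover (W L X : Type) [NormedAddCommGroup W] [NormedSpace ℝ W] [AddCommGroup L]
    [TopologicalSpace X] where
  /-- the inclusion of the lattice -/
  incl : L →+ W
  incl_injective : Function.Injective incl
  /-- the covering map -/
  proj : C(W, X)
  proj_add : ∀ w l, proj (w + incl l) = proj w
  exists_lift : ∀ (k : ℕ) (σ : Simplex X k), ∃ τ : Simplex W k, proj.comp τ = σ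
  lift_unique : ∀ (k : ℕ) (τ τ' : Simplex W k), proj.comp τ = proj.comp τ' →
    ∃ l, ∀ t, τ' t = τ t + incl l

namespace TorusCover

variable {W L X : Type} [NormedAddCommGroup W] [NormedSpace ℝ W] [AddCommGroup L]
    [TopologicalSpace X] (P : TorusCover W L X)

/-- Translation by an element of the lattice. -/
def shift (l : L) : C(W, W) := ⟨fun w => w + P.incl l, by fun_prop⟩

lemma proj_comp_shift (l : L) {k : ℕ} (τ : Simplex W k) :
    P.proj.comp ((P.shift l).comp τ) = P.proj.comp τ := by
  ext t
  exact P.proj_add _ _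

lemma shift_cone (l : L) {k : ℕ} (p : W) (σ : Simplex W k) :
    (P.shift l).comp (cone p σ) = cone (p + P.incl l) ((P.shift l).comp σ) := by
  refine comp_cone _ (fun u a b => ?_) p σ
  change u • a + (1 - u) • b + P.incl l = u • (a + P.incl l) + (1 - u) • (b + P.incl l)
  rw [smul_add, smul_add, sub_smul 1 u (P.incl l), one_smul]
  abel

/-- A choice of coset representatives rounds vectors to lattice points equivariantly. Continuity is
not needed, since cochains are arbitrary functions; the explicit cochains in degrees one and two are
built from rounded vertices. -/
lemma exists_retraction : ∃ r : W → L, (∀ w l, r (w + P.incl l) = r w + l) ∧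
    ∀ l, r (P.incl l) = l := by
  let s : W ⧸ P.incl.range → W := Quotient.out
  have hs : ∀ w, ∃ l, P.incl l = w - s (QuotientAddGroup.mk w) := fun w => by
    have : -s (QuotientAddGroup.mk w) + w ∈ P.incl.range :=
      QuotientAddGroup.eq.1 (Quotient.out_eq _)
    obtain ⟨l, hl⟩ := this
    exact ⟨l, by rw [hl]; abel⟩
  choose r hr using hs
  have h1 : ∀ w l, r (w + P.incl l) = r w + l := fun w l => by
    apply P.incl_injective
    rw [map_add, hr, hr]
    have : (QuotientAddGroup.mk (w + P.incl l) : W ⧸ P.incl.range) = QuotientAddGroup.mk w := by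
      rw [QuotientAddGroup.eq]
      exact ⟨-l, by rw [map_neg]; abel⟩
    rw [this]; abel
  refine ⟨fun w => r w - r 0, fun w l => ?_, fun l => ?_⟩
  · change r (w + P.incl l) - r 0 = r w - r 0 + l
    rw [h1]; abel
  · change r (P.incl l) - r 0 = l
    rw [← zero_add (P.incl l), h1]; abel

/-- Functions on simplices invariant under deck transformations descend. -/
lemma exists_descend {k : ℕ} (f : Simplex W k → ℤ)
    (hf : ∀ l (τ : Simplex W k), f ((P.shift l).comp τ) = f τ) :
    ∃ c : Simplex X k → ℤ, ∀ τ : Simplex W k, c (P.proj.comp τ) = f τ := by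
  choose s hs using P.exists_lift k
  refine ⟨fun σ => f (s σ), fun τ => ?_⟩
  obtain ⟨l, hl⟩ := P.lift_unique k τ (s (P.proj.comp τ)) (hs _).symm
  rw [← hf l τ]
  exact congrArg f (ContinuousMap.ext hl)

lemma ext_of_lift {k : ℕ} {c c' : Simplex X k → ℤ}
    (h : ∀ τ : Simplex W k, c (P.proj.comp τ) = c' (P.proj.comp τ)) : c = c' := by
  funext σ
  obtain ⟨τ, rfl⟩ := P.exists_lift k σ
  exact h τ

lemma mem_cocycle_iff {k : ℕ} (c : Simplex X k → ℤ) :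
    c ∈ cocycle X k ↔ (fun τ => c (P.proj.comp τ)) ∈ cocycle W k := by
  constructor
  · intro hc
    exact (comapCocycle P.proj ⟨c, hc⟩).2
  · intro hc
    rw [AddMonoidHom.mem_ker] at hc ⊢
    exact P.ext_of_lift fun τ => congrFun hc τ

lemma coboundary_lift {k : ℕ} (b : Simplex X k → ℤ) (τ : Simplex W (k + 1)) :
    coboundary X k b (P.proj.comp τ) = coboundary W k (fun τ => b (P.proj.comp τ)) τ := rfl

omit [NormedSpace ℝ W] in
lemma coboundary_zero_apply (b : Simplex W 0 → ℤ) (τ : Simplex W 1) :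
    coboundary W 0 b τ = b (point (τ.vert 1)) - b (point (τ.vert 0)) := by
  have h0 : τ.face 0 = point (τ.vert 1) := by
    rw [eq_point (τ.face 0), Simplex.vert_face]; rfl
  have h1 : τ.face 1 = point (τ.vert 0) := by
    rw [eq_point (τ.face 1), Simplex.vert_face]; rfl
  simp [coboundary, Fin.sum_univ_succ, ← h0, ← h1, sub_eq_add_neg]

omit [NormedSpace ℝ W] in
lemma coboundary_one_apply (b : Simplex W 1 → ℤ) (τ : Simplex W 2) :
    coboundary W 1 b τ = b (τ.face 0) - b (τ.face 1) + b (τ.face 2) := by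
  simp [coboundary, Fin.sum_univ_succ]
  change b (τ.face 0) + (- b (τ.face 1) + b (τ.face 2)) = _
  ring

/-! #### Degree zero -/

/-- Evaluation of a cocycle at the base point. -/
def evalZero : cocycle X 0 →+ ℤ where
  toFun c := c.1 (P.proj.comp (point 0))
  map_zero' := rfl
  map_add' _ _ := rfl

lemma evalZero_surjective : Function.Surjective P.evalZero := by
  intro m
  refine ⟨⟨fun _ => m, ?_⟩, rfl⟩
  rw [P.mem_cocycle_iff, AddMonoidHom.mem_ker]
  ext τ
  rw [coboundary_zero_apply]
  simp

lemma evalZero_eq_zero_iff (c : cocycle X 0) : P.evalZero c = 0 ↔ IsExact 0 c.1 := by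
  constructor
  · intro h
    refine P.ext_of_lift fun τ => ?_
    rw [eq_point τ]
    have := segment_relation ((P.mem_cocycle_iff _).1 c.2) 0 (τ.vert 0)
    beta_reduce at this
    rw [sub_eq_zero] at this
    exact this.trans h
  · intro h
    change c.1 _ = 0
    rw [show c.1 = 0 from h]
    rfl

/-! #### Degree one -/

lemma segment_shift (p q : W) (l : L) :
    P.proj.comp (segment (p + P.incl l) (q + P.incl l)) = P.proj.comp (segment p q) := by
  rw [← P.proj_comp_shift l (segment p q), segment, segment, P.shift_cone]
  rfl

lemma segment_incl_incl (l m : L) :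
    P.proj.comp (segment (P.incl l) (P.incl m)) =
      P.proj.comp (segment 0 (P.incl (m - l))) := by
  rw [← P.segment_shift 0 _ l, zero_add, ← map_add, sub_add_cancel]

/-- Evaluation of a one-cocycle on the loops of the torus. -/
def evalOne : cocycle X 1 →+ (L →+ ℤ) where
  toFun c := AddMonoidHom.mk' (fun l => c.1 (P.proj.comp (segment 0 (P.incl l)))) fun l m => by
    have := triangle_relation ((P.mem_cocycle_iff _).1 c.2) 0 (P.incl l) (P.incl (l + m))
    beta_reduce at this
    rw [P.segment_incl_incl, add_sub_cancel_left] at this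
    linarith
  map_zero' := rfl
  map_add' _ _ := rfl

lemma evalOne_apply (c : cocycle X 1) (l : L) :
    P.evalOne c l = c.1 (P.proj.comp (segment 0 (P.incl l))) := rfl

/-- The difference of the rounded endpoints is additive along the edges of a triangle, so its image
under `f` is a cocycle. -/
lemma evalOne_surjective : Function.Surjective P.evalOne := by
  intro f
  obtain ⟨r, hr, hr'⟩ := P.exists_retraction
  obtain ⟨c, hc⟩ := P.exists_descend (k := 1) (fun τ : Simplex W 1 => f (r (τ.vert 1) - r (τ.vert 0)))
    (fun l τ => by
      change f (r (τ.vert 1 + P.incl l) - r (τ.vert 0 + P.incl l)) = _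
      rw [hr, hr, add_sub_add_right_eq_sub])
  refine ⟨⟨c, ?_⟩, ?_⟩
  · rw [P.mem_cocycle_iff, AddMonoidHom.mem_ker]
    ext τ
    rw [coboundary_one_apply]
    simp only [hc]
    simp only [Simplex.vert_face, map_sub, Pi.zero_apply]
    change f (r (τ.vert 2)) - f (r (τ.vert 1)) - (f (r (τ.vert 2)) - f (r (τ.vert 0))) +
      (f (r (τ.vert 1)) - f (r (τ.vert 0))) = 0
    ring
  · ext l
    refine (hc _).trans ?_
    rw [vert_segment_one, vert_segment_zero, hr', ← map_zero P.incl, hr',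
      sub_zero]

/-- The primitive at `w` is the value on the segment from the rounded point to `w`. The lattice
segments left over are loops, on which the cocycle vanishes by assumption. -/
lemma evalOne_eq_zero_iff (c : cocycle X 1) : P.evalOne c = 0 ↔ IsExact 1 c.1 := by
  constructor
  · intro h
    have h0 : ∀ l, c.1 (P.proj.comp (segment 0 (P.incl l))) = 0 := fun l =>
      congrArg (fun f => f l) h
    obtain ⟨r, hr, hr'⟩ := P.exists_retraction
    obtain ⟨b, hb⟩ := P.exists_descend (k := 0)
      (fun τ : Simplex W 0 => c.1 (P.proj.comp (segment (P.incl (r (τ.vert 0))) (τ.vert 0))))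
      (fun l τ => by
        change c.1 (P.proj.comp (segment (P.incl (r (τ.vert 0 + P.incl l)))
          (τ.vert 0 + P.incl l))) = _
        rw [hr, map_add, P.segment_shift])
    refine ⟨b, P.ext_of_lift fun τ => ?_⟩
    rw [coboundary_lift, coboundary_zero_apply]
    simp only [hb]
    rw [vert_point, vert_point]
    have h1 := cone_relation_one ((P.mem_cocycle_iff _).1 c.2) (P.incl (r (τ.vert 0))) τ
    have h2 := triangle_relation ((P.mem_cocycle_iff _).1 c.2) (P.incl (r (τ.vert 0)))
      (P.incl (r (τ.vert 1))) (τ.vert 1)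
    beta_reduce at h1 h2
    rw [P.segment_incl_incl (r _) (r _), h0] at h2
    linarith
  · rintro ⟨b, hb⟩
    ext l
    rw [evalOne_apply, ← hb, coboundary_lift, coboundary_zero_apply, vert_segment_one,
      vert_segment_zero]
    have : P.proj.comp (point (P.incl l)) = P.proj.comp (point 0) := by
      ext t
      change P.proj (P.incl l) = P.proj 0
      rw [← zero_add (P.incl l), P.proj_add]
    rw [this, sub_self]
    rfl

/-! #### Degree two -/

lemma triangle_shift (p q s : W) (l : L) :
    P.proj.comp (triangle (p + P.incl l) (q + P.incl l) (s + P.incl l)) =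
      P.proj.comp (triangle p q s) := by
  rw [← P.proj_comp_shift l (triangle p q s), triangle, triangle, P.shift_cone, segment, segment,
    P.shift_cone]
  rfl

lemma triangle_incl (l m n : L) :
    P.proj.comp (triangle (P.incl l) (P.incl m) (P.incl n)) =
      P.proj.comp (triangle 0 (P.incl (m - l)) (P.incl (n - l))) := by
  rw [← P.triangle_shift 0 _ _ l, zero_add, ← map_add, ← map_add, sub_add_cancel,
    sub_add_cancel]

/-- Up to translation, the values on lattice triangles form a two-cocycle of the group `L`; the
relation comes from the tetrahedron with vertices `0`, `l`, `l + m`, `l + m + n`. -/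
lemma triangle_cocycle {c : Simplex X 2 → ℤ} (hc : c ∈ cocycle X 2) (l m n : L) :
    c (P.proj.comp (triangle 0 (P.incl m) (P.incl (m + n)))) -
    c (P.proj.comp (triangle 0 (P.incl (l + m)) (P.incl (l + m + n)))) +
    c (P.proj.comp (triangle 0 (P.incl l) (P.incl (l + (m + n))))) -
    c (P.proj.comp (triangle 0 (P.incl l) (P.incl (l + m)))) = 0 := by
  have := tetrahedron_relation ((P.mem_cocycle_iff _).1 hc) 0 (P.incl l) (P.incl (l + m))
    (P.incl (l + m + n))
  beta_reduce at this
  rw [P.triangle_incl l, add_sub_cancel_left, add_assoc l m n, add_sub_cancel_left] at this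
  rw [add_assoc l m n]
  exact this

/-- Evaluation of a two-cocycle on the two-dimensional subtori. -/
def evalTwo : cocycle X 2 →+ altForms L ℤ where
  toFun c := ⟨AddMonoidHom.mk' (fun l => AddMonoidHom.mk' (fun m =>
      c.1 (P.proj.comp (triangle 0 (P.incl l) (P.incl (l + m)))) -
      c.1 (P.proj.comp (triangle 0 (P.incl m) (P.incl (m + l))))) fun m n => by
        have := antisymmetrization_add_left (P.triangle_cocycle c.2) m n l
        linarith) fun l m => by
          ext n
          exact antisymmetrization_add_left (P.triangle_cocycle c.2) l m n,
    fun l => sub_self _⟩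
  map_zero' := rfl
  map_add' c c' := by
    refine Subtype.ext ?_
    ext l m
    change c.1 _ + c'.1 _ - (c.1 _ + c'.1 _) = c.1 _ - c.1 _ + (c'.1 _ - c'.1 _)
    ring

lemma evalTwo_apply (c : cocycle X 2) (l m : L) : (P.evalTwo c).1 l m =
    c.1 (P.proj.comp (triangle 0 (P.incl l) (P.incl (l + m)))) -
      c.1 (P.proj.comp (triangle 0 (P.incl m) (P.incl (m + l)))) := rfl

/-- If `B` is the antisymmetrization of a bilinear `β`, the cup-product cochain applying `β` to the
rounded edges `01` and `12` is a cocycle with image `B`. -/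
lemma evalTwo_surjective [Module.Free ℤ L] : Function.Surjective P.evalTwo := by
  rintro ⟨B, hB⟩
  obtain ⟨β, hβ⟩ := exists_antisymmetrization hB
  obtain ⟨r, hr, hr'⟩ := P.exists_retraction
  obtain ⟨c, hc⟩ := P.exists_descend (k := 2)
    (fun τ : Simplex W 2 => β (r (τ.vert 1) - r (τ.vert 0)) (r (τ.vert 2) - r (τ.vert 1))) (fun l τ => by
      change β (r (τ.vert 1 + P.incl l) - r (τ.vert 0 + P.incl l))
        (r (τ.vert 2 + P.incl l) - r (τ.vert 1 + P.incl l)) = _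
      rw [hr, hr, hr, add_sub_add_right_eq_sub, add_sub_add_right_eq_sub])
  refine ⟨⟨c, ?_⟩, ?_⟩
  · rw [P.mem_cocycle_iff, AddMonoidHom.mem_ker]
    ext τ
    simp only [coboundary, AddMonoidHom.coe_mk, ZeroHom.coe_mk, hc, Simplex.vert_face,
      Pi.zero_apply]
    simp only [Fin.sum_univ_succ, Fin.sum_univ_zero]
    generalize hw : τ.vert = w
    change (-1) ^ 0 * β (r (w 2) - r (w 1)) (r (w 3) - r (w 2)) +
      ((-1) ^ 1 * β (r (w 2) - r (w 0)) (r (w 3) - r (w 2)) +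
      ((-1) ^ 2 * β (r (w 1) - r (w 0)) (r (w 3) - r (w 1)) +
      ((-1) ^ 3 * β (r (w 1) - r (w 0)) (r (w 2) - r (w 1)) + 0))) = 0
    simp only [map_sub, AddMonoidHom.sub_apply]
    ring
  · refine Subtype.ext ?_
    ext l m
    rw [evalTwo_apply]
    change c _ - c _ = _
    rw [hc, hc]
    simp only [vert_triangle_zero, vert_triangle_one, vert_triangle_two, hr']
    rw [← map_zero P.incl, hr', hβ]
    simp

/-- The primitive compares a path with its rounding: it is the cone over the path from the rounded
start, minus the triangle on the two rounded endpoints and the true endpoint. Its coboundary differs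
from `c` only by values on lattice triangles. -/
lemma exact_of_triangle_eq_zero {c : Simplex X 2 → ℤ} (hc : c ∈ cocycle X 2)
    (h : ∀ l m n, c (P.proj.comp (triangle (P.incl l) (P.incl m) (P.incl n))) = 0) :
    IsExact 2 c := by
  obtain ⟨r, hr, hr'⟩ := P.exists_retraction
  obtain ⟨b, hb⟩ := P.exists_descend (k := 1)
    (fun τ : Simplex W 1 => c (P.proj.comp (cone (P.incl (r (τ.vert 0))) τ)) -
      c (P.proj.comp (triangle (P.incl (r (τ.vert 0))) (P.incl (r (τ.vert 1))) (τ.vert 1))))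
    (fun l τ => by
      change c (P.proj.comp (cone (P.incl (r (τ.vert 0 + P.incl l))) ((P.shift l).comp τ))) -
        c (P.proj.comp (triangle (P.incl (r (τ.vert 0 + P.incl l)))
          (P.incl (r (τ.vert 1 + P.incl l))) (τ.vert 1 + P.incl l))) = _
      rw [hr, hr, map_add, map_add, P.triangle_shift, ← P.shift_cone, P.proj_comp_shift])
  refine ⟨b, P.ext_of_lift fun τ => ?_⟩
  rw [coboundary_lift, coboundary_one_apply]
  simp only [hb, Simplex.vert_face]
  have hc' := (P.mem_cocycle_iff _).1 hc
  have h1 := cone_relation_two hc' (P.incl (r (τ.vert 0))) τ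
  have h2 := cone_cone_relation hc' (P.incl (r (τ.vert 0))) (P.incl (r (τ.vert 1))) (τ.face 0)
  have h3 := tetrahedron_relation hc' (P.incl (r (τ.vert 0))) (P.incl (r (τ.vert 1)))
    (P.incl (r (τ.vert 2))) (τ.vert 2)
  simp only [h, Simplex.vert_face] at h1 h2 h3
  generalize hw : τ.vert = w at *
  change c (P.proj.comp (cone (P.incl (r (w 1))) _)) - c (P.proj.comp (triangle (P.incl (r (w 1)))
    (P.incl (r (w 2))) (w 2))) - (c (P.proj.comp (cone (P.incl (r (w 0))) _)) -
    c (P.proj.comp (triangle (P.incl (r (w 0))) (P.incl (r (w 2))) (w 2)))) +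
    (c (P.proj.comp (cone (P.incl (r (w 0))) _)) - c (P.proj.comp (triangle (P.incl (r (w 0)))
    (P.incl (r (w 1))) (w 1)))) = _
  change _ - _ + c (P.proj.comp (triangle (P.incl (r (w 0))) (P.incl (r (w 1))) (w 2))) -
    c (P.proj.comp (triangle (P.incl (r (w 0))) (P.incl (r (w 1))) (w 1))) = 0 at h2
  linarith

/-- When the antisymmetrization vanishes, the two-cocycle on `L` is symmetric, hence the coboundary
of some `g`. Subtracting the coboundary of `g` applied to rounded edges leaves a cocycle vanishing
on lattice triangles. Conversely, for a coboundary the edges of the triangles for `(l, m)` and `(m,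
l)` agree up to translation. -/
lemma evalTwo_eq_zero_iff [Module.Free ℤ L] (c : cocycle X 2) :
    P.evalTwo c = 0 ↔ IsExact 2 c.1 := by
  constructor
  · intro h
    have h0 : ∀ l m, (P.evalTwo c).1 l m = 0 := fun l m => by rw [h]; rfl
    obtain ⟨g, hg⟩ := exists_eq_coboundary_of_symmetric (P.triangle_cocycle c.2)
      (fun l m => sub_eq_zero.1 (h0 l m))
    obtain ⟨r, hr, hr'⟩ := P.exists_retraction
    obtain ⟨a, ha⟩ := P.exists_descend (k := 1) (fun τ : Simplex W 1 => g (r (τ.vert 1) - r (τ.vert 0)))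
      (fun l τ => by
        change g (r (τ.vert 1 + P.incl l) - r (τ.vert 0 + P.incl l)) = _
        rw [hr, hr, add_sub_add_right_eq_sub])
    have hmem : c.1 - coboundary X 1 a ∈ cocycle X 2 := by
      refine sub_mem c.2 ?_
      rw [P.mem_cocycle_iff, AddMonoidHom.mem_ker]
      ext τ
      simp only [coboundary_lift, coboundary_one_apply, ha]
      simp only [coboundary, AddMonoidHom.coe_mk, ZeroHom.coe_mk, Simplex.vert_face,
        Pi.zero_apply]
      simp only [Fin.sum_univ_succ, Fin.sum_univ_zero]
      generalize hw : τ.vert = w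
      change (-1) ^ 0 * (g (r (w 3) - r (w 2)) - g (r (w 3) - r (w 1)) + g (r (w 2) - r (w 1))) +
       ((-1) ^ 1 * (g (r (w 3) - r (w 2)) - g (r (w 3) - r (w 0)) + g (r (w 2) - r (w 0))) +
       ((-1) ^ 2 * (g (r (w 3) - r (w 1)) - g (r (w 3) - r (w 0)) + g (r (w 1) - r (w 0))) +
       ((-1) ^ 3 * (g (r (w 2) - r (w 1)) - g (r (w 2) - r (w 0)) + g (r (w 1) - r (w 0))) + 0)))
         = 0
      ring
    obtain ⟨b, hb⟩ := P.exact_of_triangle_eq_zero hmem (fun l m n => by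
      rw [Pi.sub_apply, P.triangle_incl, coboundary_lift, coboundary_one_apply, ha, ha, ha]
      rw [(triangle_faces _ _ _).1, (triangle_faces _ _ _).2.1, (triangle_faces _ _ _).2.2]
      simp only [vert_segment_one, vert_segment_zero, hr']
      have := hg (m - l) (n - m)
      rw [show m - l + (n - m) = n - l by abel] at this
      have hr0 : r 0 = 0 := by rw [← map_zero P.incl, hr']
      rw [this, hr0, sub_zero, sub_zero, sub_sub_sub_cancel_right]
      ring)
    refine ⟨b + a, ?_⟩
    rw [map_add, hb, sub_add_cancel]
  · rintro ⟨b, hb⟩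
    refine Subtype.ext ?_
    ext l m
    rw [evalTwo_apply, ← hb]
    simp only [coboundary_lift, coboundary_one_apply]
    rw [(triangle_faces _ _ _).1, (triangle_faces _ _ _).2.1, (triangle_faces _ _ _).2.2,
      (triangle_faces _ _ _).1, (triangle_faces _ _ _).2.1, (triangle_faces _ _ _).2.2]
    have h1 := P.segment_shift 0 (P.incl m) l
    have h2 := P.segment_shift 0 (P.incl l) m
    rw [zero_add, ← map_add] at h1 h2
    rw [add_comm m l] at h1 ⊢
    rw [h1, h2]
    change _ = (0 : ℤ)
    ring

end TorusCover

/-! ### Representations on homomorphisms and alternating forms -/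

section Representations

variable (G L T : Type) [Group G] [AddCommGroup L] [DistribMulAction G L] [AddCommGroup T]

/-- The representation on homomorphisms out of a `G`-module. -/
def homRep : Representation ℤ G (L →+ T) where
  toFun g := (AddMonoidHom.mk' (fun f : L →+ T => f.comp (DistribSMul.toAddMonoidHom L g⁻¹))
    fun _ _ => rfl).toIntLinearMap
  map_one' := by
    ext f l
    change f ((1 : G)⁻¹ • l) = f l
    rw [inv_one, one_smul]
  map_mul' g h := by
    ext f l
    change f ((g * h)⁻¹ • l) = f (h⁻¹ • g⁻¹ • l)
    rw [mul_inv_rev, mul_smul]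

variable {G L T} in
lemma homRep_apply (g : G) (f : L →+ T) (l : L) : homRep G L T g f l = f (g⁻¹ • l) := rfl

variable {G L T} in
/-- Pull-back of an alternating form by a group element. -/
def altAct (g : G) (B : altForms L T) : altForms L T :=
  ⟨(B.1.compl₂ (DistribSMul.toAddMonoidHom L g⁻¹)).comp (DistribSMul.toAddMonoidHom L g⁻¹),
    fun x => B.2 (g⁻¹ • x)⟩

lemma altForms.ext' {L T : Type} [AddCommGroup L] [AddCommGroup T] {B C : altForms L T}
    (h : ∀ l m, B.1 l m = C.1 l m) : B = C := by
  refine Subtype.ext ?_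
  ext l m
  exact h l m

/-- The representation on alternating forms on a `G`-module. -/
def altRep : Representation ℤ G (altForms L T) where
  toFun g := (AddMonoidHom.mk' (fun B : altForms L T => altAct g B)
    fun _ _ => rfl).toIntLinearMap
  map_one' := by
    ext B : 1
    refine altForms.ext' fun l m => ?_
    change B.1 ((1 : G)⁻¹ • l) ((1 : G)⁻¹ • m) = B.1 l m
    rw [inv_one, one_smul, one_smul]
  map_mul' g h := by
    ext B : 1
    refine altForms.ext' fun l m => ?_
    change B.1 ((g * h)⁻¹ • l) ((g * h)⁻¹ • m) = B.1 (h⁻¹ • g⁻¹ • l) (h⁻¹ • g⁻¹ • m)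
    rw [mul_inv_rev, mul_smul, mul_smul]

variable {G L T} in
lemma altRep_apply (g : G) (B : altForms L T) (l m : L) :
    (altRep G L T g B).1 l m = B.1 (g⁻¹ • l) (g⁻¹ • m) := rfl

end Representations

/-! ### Naturality of the computation of the cohomology of a torus -/

namespace TorusCover

variable {W L X : Type} [NormedAddCommGroup W] [NormedSpace ℝ W] [AddCommGroup L]
    [TopologicalSpace X] (P : TorusCover W L X) {f : C(X, X)} {F : W →L[ℝ] W} {γ : L → L}
    (hF : ∀ w, f (P.proj w) = P.proj (F w)) (hγ : ∀ l, F (P.incl l) = P.incl (γ l))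

lemma comp_cone_linear {k : ℕ} (p : W) (σ : Simplex W k) :
    (F : C(W, W)).comp (cone p σ) = cone (F p) ((F : C(W, W)).comp σ) :=
  comp_cone (F : C(W, W)) (fun u a b => by simp) p σ

include hF

lemma comp_proj_comp {k : ℕ} (σ : Simplex W k) :
    f.comp (P.proj.comp σ) = P.proj.comp ((F : C(W, W)).comp σ) := by
  ext t
  exact hF _

lemma evalZero_comap (c : cocycle X 0) : P.evalZero (comapCocycle f c) = P.evalZero c := by
  change c.1 (f.comp (P.proj.comp (point 0))) = c.1 (P.proj.comp (point 0))
  rw [P.comp_proj_comp hF, comp_point]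
  simp

include hγ

lemma evalOne_comap (c : cocycle X 1) (l : L) :
    P.evalOne (comapCocycle f c) l = P.evalOne c (γ l) := by
  change c.1 (f.comp (P.proj.comp (segment 0 (P.incl l)))) = c.1 _
  rw [P.comp_proj_comp hF, segment, comp_cone_linear, comp_point]
  simp only [ContinuousMap.coe_coe, map_zero, hγ]
  rfl

lemma evalTwo_comap (hadd : ∀ l m, γ (l + m) = γ l + γ m) (c : cocycle X 2) (l m : L) :
    (P.evalTwo (comapCocycle f c)).1 l m = (P.evalTwo c).1 (γ l) (γ m) := by
  have h : ∀ l m, (comapCocycle f c).1 (P.proj.comp (triangle 0 (P.incl l) (P.incl m))) =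
      c.1 (P.proj.comp (triangle 0 (P.incl (γ l)) (P.incl (γ m)))) := fun l m => by
    change c.1 (f.comp (P.proj.comp (triangle 0 (P.incl l) (P.incl m)))) = c.1 _
    rw [P.comp_proj_comp hF, triangle, segment, comp_cone_linear, comp_cone_linear, comp_point]
    simp only [ContinuousMap.coe_coe, map_zero, hγ]
    rfl
  rw [evalTwo_apply, evalTwo_apply, h, h, hadd, hadd]

end TorusCover

/-! ### The torus attached to the kernel of the summation map -/

section KernelCover

instance (A : Type) [AddCommGroup A] (n : ℕ) :
    DistribMulAction (Equiv.Perm (Fin n)) (kerSum A n) where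
  smul_zero _ := rfl
  smul_add _ _ _ := rfl

variable {V : Type} [NormedAddCommGroup V] [NormedSpace ℂ V] (Λ : Submodule ℤ V)
  [DiscreteTopology Λ] (n : ℕ)

/-- The vectors with sum zero. -/
abbrev sumZero (V : Type) [NormedAddCommGroup V] [NormedSpace ℂ V] (n : ℕ) :
    Submodule ℝ (Fin n → V) :=
  LinearMap.ker (∑ i, LinearMap.proj i : (Fin n → V) →ₗ[ℝ] V)

omit [DiscreteTopology Λ] in
lemma mem_sumZero (w : Fin n → V) : w ∈ sumZero V n ↔ ∑ i, w i = 0 := by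
  rw [LinearMap.mem_ker, LinearMap.sum_apply]
  rfl

omit [NormedSpace ℂ V] in
lemma isCoveringMap_mkQ : IsCoveringMap (Λ.mkQ : V → V ⧸ Λ) := by
  have hq : Topology.IsQuotientMap (Λ.mkQ : V → V ⧸ Λ) := isQuotientMap_quot_mk
  refine (hq.isAddQuotientCoveringMap_of_addSubgroup Λ.toAddSubgroup ?_ ?_).isCoveringMap
  · exact isDiscrete_iff_discreteTopology.2 ‹_›
  · intro e₁ e₂
    rw [eq_comm, Submodule.mkQ_apply, Submodule.mkQ_apply, Submodule.Quotient.eq, sub_eq_add_neg]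
    rfl

omit [NormedSpace ℂ V] in
lemma exists_lift_mkQ {k : ℕ} (σ : Simplex (V ⧸ Λ) k) :
    ∃ τ : Simplex V k, ∀ t, Λ.mkQ (τ t) = σ t := by
  have : ContractibleSpace (stdSimplex ℝ (Fin (k + 1))) :=
    (convex_stdSimplex ℝ (Fin (k + 1))).contractibleSpace ⟨_, single_mem_stdSimplex ℝ 0⟩
  have : LocallyPathConnectedSpace (stdSimplex ℝ (Fin (k + 1))) :=
    (convex_stdSimplex ℝ (Fin (k + 1))).locallyPathConnectedSpace
  obtain ⟨v, hv⟩ := Λ.mkQ_surjective (σ (stdSimplex.vertex 0))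
  obtain ⟨τ, ⟨-, hτ⟩, -⟩ :=
    (isCoveringMap_mkQ Λ).existsUnique_continuousMap_lifts σ (stdSimplex.vertex 0) v hv
  exact ⟨τ, fun t => congrFun hτ t⟩

/-- The universal covering of the kernel of the summation map on a complex torus. -/
def kerSumCover [NeZero n] : TorusCover (sumZero V n) (kerSum Λ n) (kerSum (V ⧸ Λ) n) where
  incl := AddMonoidHom.mk' (fun l => ⟨fun i => (l.1 i : V), by
    rw [mem_sumZero]
    have h : ∑ i, l.1 i = 0 := l.2
    simpa using congrArg (fun x : Λ => (x : V)) h⟩) fun _ _ => rfl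
  incl_injective := by
    intro l m h
    refine Subtype.ext (funext fun i => Subtype.ext ?_)
    exact congrFun (congrArg Subtype.val h) i
  proj := ⟨fun w => ⟨fun i => Λ.mkQ (w.1 i), by
      have h : ∑ i, w.1 i = 0 := (mem_sumZero n w.1).1 w.2
      change ∑ i, Λ.mkQ (w.1 i) = 0
      rw [← map_sum, h, map_zero]⟩, by
    refine Continuous.subtype_mk (continuous_pi fun i => ?_) _
    exact (isCoveringMap_mkQ Λ).continuous.comp
      ((continuous_apply i).comp continuous_subtype_val)⟩
  proj_add w l := by
    refine Subtype.ext (funext fun i => ?_)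
    change Λ.mkQ (w.1 i + (l.1 i : V)) = Λ.mkQ (w.1 i)
    have h : Λ.mkQ (l.1 i : V) = 0 := (Submodule.Quotient.mk_eq_zero Λ).2 (l.1 i).2
    rw [map_add, h, add_zero]
  exists_lift k σ := by
    have h : ∀ i, ∃ τ : Simplex V k, ∀ t, Λ.mkQ (τ t) = (σ t).1 i := fun i =>
      exists_lift_mkQ Λ (σ := ⟨fun t => (σ t).1 i,
        (continuous_apply i).comp (continuous_subtype_val.comp σ.continuous)⟩)
    choose τ hτ using h
    have hs : ∀ t, ∑ i, τ i t ∈ Λ := fun t => by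
      have : ∑ i, (σ t).1 i = 0 := (σ t).2
      rw [← Submodule.Quotient.mk_eq_zero, ← Submodule.mkQ_apply, map_sum, ← this]
      exact Finset.sum_congr rfl fun i _ => hτ i t
    -- The coordinatewise lifts have their sum in `Λ`. Subtracting it from coordinate `0` makes the
    -- sum zero and does not affect the projection.
    refine ⟨⟨fun t => ⟨fun i => τ i t - Pi.single (M := fun _ => V) 0 (∑ j, τ j t) i, ?_⟩, ?_⟩, ?_⟩
    · rw [mem_sumZero, Finset.sum_sub_distrib, Finset.sum_pi_single']
      simp
    · refine Continuous.subtype_mk (continuous_pi fun i => ?_) _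
      refine (τ i).continuous.sub ?_
      exact (continuous_apply i).comp ((continuous_single (A := fun _ => V) 0).comp
        (continuous_finsetSum _ fun j _ => (τ j).continuous))
    · refine ContinuousMap.ext fun t => Subtype.ext (funext fun i => ?_)
      change Λ.mkQ (τ i t - Pi.single (M := fun _ => V) 0 (∑ j, τ j t) i) = (σ t).1 i
      rw [map_sub, hτ]
      have : (Pi.single (M := fun _ => V) 0 (∑ j, τ j t) i) ∈ Λ := by
        by_cases h : i = 0
        · rw [h, Pi.single_eq_same]; exact hs t
        · rw [Pi.single_eq_of_ne h]; exact zero_mem _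
      have h0 : Λ.mkQ (Pi.single (M := fun _ => V) 0 (∑ j, τ j t) i) = 0 :=
        (Submodule.Quotient.mk_eq_zero Λ).2 this
      rw [h0, sub_zero]
  lift_unique k τ τ' h := by
    have h0 : ∀ t i, (τ' t).1 i - (τ t).1 i ∈ Λ := fun t i => by
      have h1 : Λ.mkQ ((τ t).1 i) = Λ.mkQ ((τ' t).1 i) :=
        congrFun (congrArg Subtype.val (DFunLike.congr_fun h t)) i
      rw [← Submodule.Quotient.mk_eq_zero, Submodule.Quotient.mk_sub]
      exact sub_eq_zero.2 h1.symm
    have hc : ∀ i, Continuous fun t => (⟨(τ' t).1 i - (τ t).1 i, h0 t i⟩ : Λ) := fun i => by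
      refine Continuous.subtype_mk ?_ _
      exact ((continuous_apply i).comp (continuous_subtype_val.comp τ'.continuous)).sub
        ((continuous_apply i).comp (continuous_subtype_val.comp τ.continuous))
    -- A continuous map from the connected simplex to the discrete `Λ` is constant.
    have hconst : ∀ i t, (⟨(τ' t).1 i - (τ t).1 i, h0 t i⟩ : Λ) =
        ⟨(τ' (stdSimplex.vertex 0)).1 i - (τ (stdSimplex.vertex 0)).1 i, h0 _ i⟩ := fun i t =>
      PreconnectedSpace.constant inferInstance (hc i)
    refine ⟨⟨fun i => ⟨(τ' (stdSimplex.vertex 0)).1 i - (τ (stdSimplex.vertex 0)).1 i, h0 _ i⟩,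
      ?_⟩, fun t => ?_⟩
    · refine AddMonoidHom.mem_ker.2 (Subtype.ext ?_)
      change ((∑ i, _ : Λ) : V) = 0
      rw [AddSubmonoidClass.coe_finsetSum, Finset.sum_sub_distrib,
        (mem_sumZero n _).1 (τ' _).2, (mem_sumZero n _).1 (τ _).2, sub_zero]
    · refine Subtype.ext (funext fun i => ?_)
      change (τ' t).1 i = (τ t).1 i +
        ((τ' (stdSimplex.vertex 0)).1 i - (τ (stdSimplex.vertex 0)).1 i)
      have h1 : (τ' t).1 i - (τ t).1 i =
          (τ' (stdSimplex.vertex 0)).1 i - (τ (stdSimplex.vertex 0)).1 i :=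
        congrArg Subtype.val (hconst i t)
      rw [← h1]
      abel

/-- The permutation of the entries of a vector with sum zero. -/
def permSumZero (σ : Equiv.Perm (Fin n)) : sumZero V n →L[ℝ] sumZero V n where
  toFun w := ⟨fun i => w.1 (σ⁻¹ i), by
    have h : ∑ i, w.1 i = 0 := (mem_sumZero n w.1).1 w.2
    rw [mem_sumZero, Equiv.sum_comp σ⁻¹ w.1, h]⟩
  map_add' _ _ := rfl
  map_smul' _ _ := rfl
  cont := by
    have h : Continuous fun w : sumZero V n => fun i => w.1 (σ⁻¹ i) :=
      continuous_pi fun i => (continuous_apply (σ⁻¹ i)).comp continuous_subtype_val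
    exact h.subtype_mk _

end KernelCover

/-! ### Equivariant identification of the cohomology of the torus in degrees zero, one and two. -/

section Cohomology

variable {V : Type} [NormedAddCommGroup V] [NormedSpace ℂ V] (Λ : Submodule ℤ V)
  [DiscreteTopology Λ] (n : ℕ)

/-- An additive isomorphism intertwining two integral representations induces an isomorphism on
group cohomology. -/
theorem nonempty_groupCohomology_equiv {G : Type} [Group G] {M N : Type} [AddCommGroup M]
    [Module ℤ M] [AddCommGroup N] [Module ℤ N] (ρ : Representation ℤ G M)
    (σ : Representation ℤ G N)
    (e : M ≃+ N) (he : ∀ g x, e (ρ g x) = σ g (e x)) (p : ℕ) :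
    Nonempty (groupCohomology (Rep.of ρ) p ≃+ groupCohomology (Rep.of σ) p) := by
  let e' : M ≃ₗ[ℤ] N := { e with map_smul' := fun m x => map_intCast_smul e ℤ ℤ m x }
  let i : Rep.of ρ ≅ Rep.of σ := Rep.mkIso (.mk e' fun g => by ext x; exact he g x)
  exact ⟨((groupCohomology.functor ℤ G p).mapIso i).toLinearEquiv.toAddEquiv⟩

/-- The action of a permutation on the kernel of the summation map, as a continuous map. -/
def permKer (σ : alternatingGroup (Fin n)) : C(kerSum (V ⧸ Λ) n, kerSum (V ⧸ Λ) n) :=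
  ⟨fun x => σ⁻¹ • x, continuous_const_smul σ⁻¹⟩

variable [NeZero n]

lemma permKer_proj (σ : alternatingGroup (Fin n)) (w : sumZero V n) :
    permKer Λ n σ ((kerSumCover Λ n).proj w) =
      (kerSumCover Λ n).proj (permSumZero n (σ⁻¹ : alternatingGroup (Fin n)).1 w) := rfl

lemma permSumZero_incl (σ : alternatingGroup (Fin n)) (l : kerSum Λ n) :
    permSumZero n (σ⁻¹ : alternatingGroup (Fin n)).1 ((kerSumCover Λ n).incl l) =
      (kerSumCover Λ n).incl (σ⁻¹ • l) := rfl

omit [NormedSpace ℂ V] [DiscreteTopology Λ] [NeZero n] in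
theorem nonempty_alternatingCohomology_equiv (q : ℕ) {M : Type} [AddCommGroup M]
    (ρ : Representation ℤ (alternatingGroup (Fin n)) M)
    (φ : cocycle (kerSum (V ⧸ Λ) n) q →+ M) (hφ : Function.Surjective φ)
    (hker : ∀ c, φ c = 0 ↔ IsExact q c.1)
    (hρ : ∀ σ c, φ (comapCocycle (permKer Λ n σ) c) = ρ σ (φ c)) (p : ℕ) :
    Nonempty (alternatingCohomology (V ⧸ Λ) n p q ≃+ groupCohomology (Rep.of ρ) p) := by
  obtain ⟨e, he⟩ := exists_singularCohomologyEquiv (kerSum (V ⧸ Λ) n) q φ hφ hker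
  have h : ∀ (σ : alternatingGroup (Fin n))
      (x : (singularCohomology q).obj (.op (TopCat.of (kerSum (V ⧸ Λ) n)))),
      e (cohomologyRepresentation (alternatingGroup (Fin n)) (kerSum (V ⧸ Λ) n) q σ x) =
        ρ σ (e x) :=
    fun σ x => he (permKer Λ n σ) (fun m => ρ σ m) (hρ σ) x
  exact nonempty_groupCohomology_equiv _ _ e h p

lemma evalZero_permKer (σ : alternatingGroup (Fin n)) (c : cocycle (kerSum (V ⧸ Λ) n) 0) :
    (kerSumCover Λ n).evalZero (comapCocycle (permKer Λ n σ) c) =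
      Representation.trivial ℤ (alternatingGroup (Fin n)) ℤ σ ((kerSumCover Λ n).evalZero c) :=
  (kerSumCover Λ n).evalZero_comap (permKer_proj Λ n σ) c

lemma evalOne_permKer (σ : alternatingGroup (Fin n)) (c : cocycle (kerSum (V ⧸ Λ) n) 1) :
    (kerSumCover Λ n).evalOne (comapCocycle (permKer Λ n σ) c) =
      homRep (alternatingGroup (Fin n)) (kerSum Λ n) ℤ σ ((kerSumCover Λ n).evalOne c) := by
  refine AddMonoidHom.ext fun l => ?_
  rw [homRep_apply]
  exact (kerSumCover Λ n).evalOne_comap (permKer_proj Λ n σ) (permSumZero_incl Λ n σ) c l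

lemma evalTwo_permKer (σ : alternatingGroup (Fin n)) (c : cocycle (kerSum (V ⧸ Λ) n) 2) :
    (kerSumCover Λ n).evalTwo (comapCocycle (permKer Λ n σ) c) =
      altRep (alternatingGroup (Fin n)) (kerSum Λ n) ℤ σ ((kerSumCover Λ n).evalTwo c) := by
  refine altForms.ext' fun l m => ?_
  rw [altRep_apply]
  exact (kerSumCover Λ n).evalTwo_comap (permKer_proj Λ n σ) (permSumZero_incl Λ n σ)
    (fun _ _ => smul_add _ _ _) c l m

theorem nonempty_alternatingCohomology_zero (p : ℕ) :
    Nonempty (alternatingCohomology (V ⧸ Λ) n p 0 ≃+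
      groupCohomology (Rep.of (Representation.trivial ℤ (alternatingGroup (Fin n)) ℤ)) p) :=
  nonempty_alternatingCohomology_equiv Λ n 0 _ (kerSumCover Λ n).evalZero
    (kerSumCover Λ n).evalZero_surjective (kerSumCover Λ n).evalZero_eq_zero_iff
    (evalZero_permKer Λ n) p

theorem nonempty_alternatingCohomology_one (p : ℕ) :
    Nonempty (alternatingCohomology (V ⧸ Λ) n p 1 ≃+
      groupCohomology (Rep.of (homRep (alternatingGroup (Fin n)) (kerSum Λ n) ℤ)) p) :=
  nonempty_alternatingCohomology_equiv Λ n 1 _ (kerSumCover Λ n).evalOne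
    (kerSumCover Λ n).evalOne_surjective (kerSumCover Λ n).evalOne_eq_zero_iff
    (evalOne_permKer Λ n) p

theorem nonempty_alternatingCohomology_two [Module.Free ℤ (kerSum Λ n)] (p : ℕ) :
    Nonempty (alternatingCohomology (V ⧸ Λ) n p 2 ≃+
      groupCohomology (Rep.of (altRep (alternatingGroup (Fin n)) (kerSum Λ n) ℤ)) p) :=
  nonempty_alternatingCohomology_equiv Λ n 2 _ (kerSumCover Λ n).evalTwo
    (kerSumCover Λ n).evalTwo_surjective (kerSumCover Λ n).evalTwo_eq_zero_iff
    (evalTwo_permKer Λ n) p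

end Cohomology

/-! ### Group cohomology in low degrees and dimension shifting -/

section DimensionShift

/-- Two surjective homomorphisms with the same kernel have isomorphic targets. -/
theorem nonempty_addEquiv_of_ker_eq {A B C : Type*} [AddCommGroup A] [AddCommGroup B]
    [AddCommGroup C] (f : A →+ B) (g : A →+ C) (hf : Function.Surjective f)
    (hg : Function.Surjective g) (h : ∀ a, f a = 0 ↔ g a = 0) : Nonempty (B ≃+ C) := by
  have hk : f.ker = g.ker := by
    ext a
    exact h a
  exact ⟨((QuotientAddGroup.quotientKerEquivOfSurjective f hf).symm.trans
    (QuotientAddGroup.quotientAddEquivOfEq hk)).trans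
    (QuotientAddGroup.quotientKerEquivOfSurjective g hg)⟩

lemma exact_of_exact_apply {k G : Type} [CommRing k] [Group G] (X : ShortComplex (Rep.{0} k G))
    (h : ∀ x : X.X₂, X.g.hom x = 0 → ∃ y : X.X₁, X.f.hom y = x) : X.Exact :=
  (forget₂ (Rep.{0} k G) (ModuleCat.{0} k)).reflects_exact_of_faithful _ <|
    (ShortComplex.moduleCat_exact_iff _).2 h

variable {G : Type} [Group G] {M N P : Type} [AddCommGroup M] [AddCommGroup N] [AddCommGroup P]
  (ρM : Representation ℤ G M) (ρN : Representation ℤ G N) (ρP : Representation ℤ G P)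

theorem nonempty_groupCohomology_one_equiv {Q : Type} [AddCommGroup Q]
    (φ : groupCohomology.cocycles₁ (Rep.of ρM) →+ Q) (hφ : Function.Surjective φ)
    (hker : ∀ c, φ c = 0 ↔ ∃ m, ∀ g, ρM g m - m = c g) :
    Nonempty (groupCohomology (Rep.of ρM) 1 ≃+ Q) := by
  refine nonempty_addEquiv_of_ker_eq (groupCohomology.H1π (Rep.of ρM)).hom.toAddMonoidHom φ
    ((ModuleCat.epi_iff_surjective _).1 inferInstance) hφ fun c => ?_
  refine (groupCohomology.H1π_eq_zero_iff c).trans ((hker c).trans ?_).symm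
  constructor
  · rintro ⟨m, hm⟩
    exact ⟨m, funext hm⟩
  · rintro ⟨m, hm⟩
    exact ⟨m, congrFun hm⟩

theorem nonempty_groupCohomology_two_equiv {Q : Type} [AddCommGroup Q]
    (φ : groupCohomology.cocycles₂ (Rep.of ρM) →+ Q) (hφ : Function.Surjective φ)
    (hker : ∀ c, φ c = 0 ↔ ∃ b : G → M, ∀ g h, ρM g (b h) - b (g * h) + b g = c (g, h)) :
    Nonempty (groupCohomology (Rep.of ρM) 2 ≃+ Q) := by
  refine nonempty_addEquiv_of_ker_eq (groupCohomology.H2π (Rep.of ρM)).hom.toAddMonoidHom φ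
    ((ModuleCat.epi_iff_surjective _).1 inferInstance) hφ fun c => ?_
  refine (groupCohomology.H2π_eq_zero_iff c).trans ((hker c).trans ?_).symm
  constructor
  · rintro ⟨b, hb⟩
    exact ⟨b, funext fun gh => hb gh.1 gh.2⟩
  · rintro ⟨b, hb⟩
    exact ⟨b, fun g h => congrFun hb (g, h)⟩

/-- An inverse of multiplication by the order of the group is equivariant. -/
lemma inverse_card_equivariant {u : N →+ N} (hu : ∀ x, Nat.card G • u x = x)
    (hu' : ∀ x, u (Nat.card G • x) = x) (g : G) (x : N) : u (ρN g x) = ρN g (u x) := by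
  rw [← hu' (ρN g (u x)), ← map_nsmul, hu]

/-- The cohomology of a finite group with uniquely divisible coefficients vanishes. -/
theorem isZero_groupCohomology_of_inverse_card [Finite G] {u : N →+ N}
    (hu : ∀ x, Nat.card G • u x = x) (hu' : ∀ x, u (Nat.card G • x) = x) (p : ℕ) :
    Limits.IsZero (groupCohomology (Rep.of ρN) (p + 1)) := by
  have := Fintype.ofFinite G
  let S : Subgroup G := ⊥
  let A : Rep ℤ S := Rep.of (ρN.comp S.subtype)
  -- The module is a retract of the acyclic module coinduced from the trivial subgroup: `i` takes
  -- orbit maps, and `r` averages over the group.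
  let i : Rep.of ρN ⟶ Rep.coind S.subtype A := Rep.ofHom (.mk
    { toFun := fun m => ⟨fun g => ρN g m, fun s g => by
        change ρN (s * g) m = ρN s (ρN g m)
        rw [map_mul]; rfl⟩
      map_add' := fun a b => Subtype.ext (funext fun g => map_add _ _ _)
      map_smul' := fun a b => Subtype.ext (funext fun g => map_smul _ _ _) } fun h => by
    ext m : 1
    refine Subtype.ext (funext fun g => ?_)
    change ρN g (ρN h m) = ρN (g * h) m
    rw [map_mul]; rfl)
  let r : Rep.coind S.subtype A ⟶ Rep.of ρN := Rep.ofHom (.mk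
    (AddMonoidHom.mk' (fun f : Representation.coindV S.subtype A.ρ =>
      u (∑ g, ρN g⁻¹ (f.1 g))) fun a b => by
        rw [← map_add, ← Finset.sum_add_distrib]
        exact congrArg u (Finset.sum_congr rfl fun g _ => map_add _ _ _)).toIntLinearMap
    fun h => by
      ext f : 1
      change u (∑ g, ρN g⁻¹ (f.1 (g * h))) = ρN h (u (∑ g, ρN g⁻¹ (f.1 g)))
      rw [← inverse_card_equivariant ρN hu hu', map_sum (ρN h), ← Equiv.sum_comp (Equiv.mulRight h)
        (fun g => ρN h (ρN g⁻¹ (f.1 g)))]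
      refine congrArg u (Finset.sum_congr rfl fun g _ => ?_)
      change _ = ρN h (ρN (g * h)⁻¹ (f.1 (g * h)))
      rw [mul_inv_rev, map_mul, ← Module.End.mul_apply, ← mul_assoc, ← map_mul, mul_inv_cancel,
        map_one, one_mul])
  have hir : i ≫ r = 𝟙 _ := by
    ext m
    change u (∑ g, ρN g⁻¹ (ρN g m)) = m
    have : ∀ g : G, ρN g⁻¹ (ρN g m) = m := fun g => by
      rw [← Module.End.mul_apply, ← map_mul, inv_mul_cancel, map_one]; rfl
    rw [Finset.sum_congr rfl fun g _ => this g, Finset.sum_const, Finset.card_univ,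
      ← Nat.card_eq_fintype_card, hu']
  have hz : Limits.IsZero ((groupCohomology.functor ℤ G (p + 1)).obj (Rep.coind S.subtype A)) :=
    (isZero_groupCohomology_succ_of_subsingleton A p).of_iso
      (groupCohomology.coindIso A (p + 1))
  rw [Limits.IsZero.iff_id_eq_zero]
  have h := (groupCohomology.functor ℤ G (p + 1)).map_comp i r
  rw [hir, CategoryTheory.Functor.map_id] at h
  refine h.trans ?_
  rw [hz.eq_zero_of_tgt ((groupCohomology.functor ℤ G (p + 1)).map i), Limits.zero_comp]
  rfl

variable {ρM ρN ρP} {f : M →+ N} {g : N →+ P} (hf : Function.Injective f)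
  (hg : Function.Surjective g) (hfg : ∀ y, g y = 0 ↔ ∃ x, f x = y)
  (hρf : ∀ a x, f (ρM a x) = ρN a (f x)) (hρg : ∀ a x, g (ρN a x) = ρP a (g x))
  {u : N →+ N} (hu : ∀ x, Nat.card G • u x = x) (hu' : ∀ x, u (Nat.card G • x) = x)

include hf hg hfg hρf hρg hu hu'

/-- Dimension shifting along an extension with uniquely divisible middle term. -/
theorem nonempty_groupCohomology_succ_equiv [Finite G] (p : ℕ) :
    Nonempty (groupCohomology (Rep.of ρP) (p + 1) ≃+ groupCohomology (Rep.of ρM) (p + 2)) := by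
  let F : Rep.of ρM ⟶ Rep.of ρN := Rep.ofHom (.mk f.toIntLinearMap fun a => by ext x; exact hρf a x)
  let H : Rep.of ρN ⟶ Rep.of ρP := Rep.ofHom (.mk g.toIntLinearMap fun a => by ext x; exact hρg a x)
  let X : ShortComplex (Rep ℤ G) := .mk F H (by
    ext x
    exact (hfg _).2 ⟨x, rfl⟩)
  have hX : X.ShortExact :=
    { exact := exact_of_exact_apply X fun x hx => (hfg x).1 hx
      mono_f := (Rep.mono_iff_injective F).2 hf
      epi_g := (Rep.epi_iff_surjective H).2 hg }
  have := groupCohomology.isIso_δ_of_isZero hX (p + 1)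
    (isZero_groupCohomology_of_inverse_card ρN hu hu' p)
    (isZero_groupCohomology_of_inverse_card ρN hu hu' (p + 1))
  exact ⟨(asIso (groupCohomology.δ hX (p + 1) (p + 2) rfl)).toLinearEquiv.toAddEquiv⟩

/-- As `H^1` of the middle term vanishes, the long exact sequence gives the cokernel of the map on
invariants. Concretely, averaging a cocycle `c` produces `y` with `f (c a) = ρN a y - y`, and the
class of `c` corresponds to `g y`. -/
theorem nonempty_groupCohomology_one_equiv_of_invariants [Finite G] {Q : Type} [AddCommGroup Q]
    (ψ : ρP.invariants →+ Q) (hψ : Function.Surjective ψ)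
    (hker : ∀ z, ψ z = 0 ↔ ∃ y, (∀ a, ρN a y = y) ∧ g y = z) :
    Nonempty (groupCohomology (Rep.of ρM) 1 ≃+ Q) := by
  have := Fintype.ofFinite G
  let y : groupCohomology.cocycles₁ (Rep.of ρM) →+ N :=
    AddMonoidHom.mk' (fun c => -u (∑ a, f (c a))) fun c d => by
      rw [← neg_add, ← map_add, ← Finset.sum_add_distrib]
      exact congrArg (fun x => -u x) (Finset.sum_congr rfl fun a _ => map_add f (c a) (d a))
  have hy : ∀ c a, f (c a) = ρN a (y c) - y c := fun c a => by
    have h1 : ∑ b, f (c b) = ρN a (∑ b, f (c b)) + Nat.card G • f (c a) := by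
      conv_lhs => rw [← Equiv.sum_comp (Equiv.mulLeft a)]
      rw [map_sum, Nat.card_eq_fintype_card, ← Finset.card_univ, ← Finset.sum_const,
        ← Finset.sum_add_distrib]
      refine Finset.sum_congr rfl fun b _ => ?_
      have := (groupCohomology.mem_cocycles₁_iff c.1).1 c.2 a b
      rw [← hρf]
      exact (congrArg f this).trans (map_add _ _ _)
    change _ = ρN a (-u _) - -u _
    have h2 := congrArg u h1
    rw [map_add, hu', inverse_card_equivariant ρN hu hu'] at h2
    rw [map_neg, sub_neg_eq_add, neg_add_eq_sub]
    exact eq_sub_of_add_eq' h2.symm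
  have hinv : ∀ c, g (y c) ∈ ρP.invariants := fun c a => by
    rw [← hρg, ← sub_eq_zero, ← map_sub, ← hy]
    exact (hfg _).2 ⟨_, rfl⟩
  let z : groupCohomology.cocycles₁ (Rep.of ρM) →+ ρP.invariants :=
    AddMonoidHom.mk' (fun c => ⟨g (y c), hinv c⟩) fun c d => Subtype.ext (by
      change g (y (c + d)) = g (y c) + g (y d)
      rw [map_add, map_add])
  refine nonempty_groupCohomology_one_equiv ρM (ψ.comp z) ?_ fun c => ?_
  · intro q
    obtain ⟨w, rfl⟩ := hψ q
    obtain ⟨v, hv⟩ := hg w.1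
    have hx : ∀ a, ∃ x, f x = ρN a v - v := fun a => (hfg _).1 (by
      rw [map_sub, hρg, hv, w.2 a, sub_self])
    choose x hx using hx
    have hxc : x ∈ groupCohomology.cocycles₁ (Rep.of ρM) := by
      rw [groupCohomology.mem_cocycles₁_iff]
      refine fun a b => hf ?_
      change f (x (a * b)) = f (ρM a (x b) + x a)
      rw [map_add, hρf, hx, hx, hx, map_sub, map_mul, Module.End.mul_apply]
      abel
    refine ⟨⟨x, hxc⟩, ?_⟩
    change ψ (z ⟨x, hxc⟩) = _
    rw [← sub_eq_zero, ← map_sub, hker]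
    refine ⟨y ⟨x, hxc⟩ - v, fun a => ?_, ?_⟩
    · have h1 := hy ⟨x, hxc⟩ a
      have h2 : f (x a) = ρN a (y ⟨x, hxc⟩) - y ⟨x, hxc⟩ := h1
      rw [hx] at h2
      rw [map_sub, sub_eq_sub_iff_sub_eq_sub, ← h2]
    · rw [map_sub, hv]
      rfl
  · change ψ (z c) = 0 ↔ _
    rw [hker]
    constructor
    · rintro ⟨v, hv, hgv⟩
      have : g (y c - v) = 0 := by
        rw [map_sub, hgv]
        exact sub_self _
      obtain ⟨m, hm⟩ := (hfg _).1 this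
      refine ⟨m, fun a => hf ?_⟩
      rw [map_sub, hρf, hm, map_sub, hv, hy]
      abel
    · rintro ⟨m, hm⟩
      refine ⟨y c - f m, fun a => ?_, ?_⟩
      · have := hy c a
        rw [← hm, map_sub, hρf] at this
        rw [map_sub, sub_eq_sub_iff_sub_eq_sub, ← this]
      · rw [map_sub, (hfg _).2 ⟨m, rfl⟩, sub_zero]
        rfl

end DimensionShift

/-! ### Carmichael's presentation of the alternating group -/

section Carmichael

/-- The relations in Carmichael's presentation of the alternating group. -/
structure IsCarmichael {Γ : Type} [Group Γ] {m : ℕ} (X : Fin m → Γ) : Prop where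
  pow_three : ∀ i, X i ^ 3 = 1
  mul_sq : ∀ i j, i ≠ j → (X i * X j) ^ 2 = 1

variable {Γ : Type} [Group Γ]

lemma mul_mul_eq_inv {x y : Γ} (h : (x * y) ^ 2 = 1) : y * x * y = x⁻¹ := by
  rw [eq_inv_iff_mul_eq_one, ← mul_left_inj x, ← mul_right_inj x⁻¹]
  rw [sq] at h
  calc _ = x⁻¹ * ((y * x) * (y * x)) * x := by group
    _ = x⁻¹ * (x⁻¹ * ((x * y) * (x * y)) * x) * x := by group
    _ = _ := by rw [h]; group

lemma inv_sq_eq {x : Γ} (h : x ^ 3 = 1) : x⁻¹ * x⁻¹ = x := by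
  rw [← mul_inv_rev, inv_eq_iff_mul_eq_one, ← h, pow_three']

lemma mul_eq_inv_mul_inv {x y : Γ} (h : (x * y) ^ 2 = 1) : x * y = y⁻¹ * x⁻¹ := by
  rw [← mul_inv_rev, eq_inv_iff_mul_eq_one, ← h, sq]

namespace IsCarmichael

variable {m : ℕ} {X : Fin m → Γ} (hX : IsCarmichael X)

/-- The subgroup generated by all but the last of the generators. -/
def initial {m : ℕ} (X : Fin (m + 1) → Γ) : Subgroup Γ :=
  Subgroup.closure (Set.range fun i : Fin m => X i.castSucc)

/-- The union of certain right cosets of `IsCarmichael.initial`. -/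
def cosets {m : ℕ} (X : Fin (m + 1) → Γ) : Set Γ :=
  {g | g ∈ initial X ∨ g * (X (.last m))⁻¹ ∈ initial X ∨ g * X (.last m) ∈ initial X ∨
    ∃ j : Fin m, g * (X j.castSucc)⁻¹ * X (.last m) ∈ initial X}

lemma mem_initial {m : ℕ} (X : Fin (m + 1) → Γ) (i : Fin m) : X i.castSucc ∈ initial X :=
  Subgroup.subset_closure ⟨i, rfl⟩

/-- Let `H` be the subgroup generated by the initial elements and `y` the last generator. The cosets
in question are `H`, `H y`, `H y⁻¹` and `H y⁻¹ x_j`. Right multiplication by `y` permutes the first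
three cyclically and, by the relations, preserves each of the others. -/
lemma mul_last_mem {m : ℕ} {X : Fin (m + 1) → Γ} (hX : IsCarmichael X) {g : Γ}
    (hg : g ∈ cosets X) : g * X (.last m) ∈ cosets X := by
  have hy := hX.pow_three (.last m)
  rcases hg with h | h | h | ⟨j, h⟩
  · refine .inr (.inl ?_)
    rwa [mul_inv_cancel_right]
  · refine .inr (.inr (.inl ?_))
    convert h using 1
    rw [mul_assoc, mul_right_inj, eq_inv_iff_mul_eq_one, ← hy, pow_three']
  · exact .inl h
  · refine .inr (.inr (.inr ⟨j, ?_⟩))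
    have hx := hX.pow_three j.castSucc
    have hxy := hX.mul_sq j.castSucc (.last m) (Fin.castSucc_lt_last j).ne
    convert mul_mem h (inv_mem (mem_initial X j)) using 1
    set x := X j.castSucc
    set y := X (.last m)
    calc g * y * x⁻¹ * y = g * x⁻¹ * y * y⁻¹ * (x * y) * x⁻¹ * y := by group
      _ = g * x⁻¹ * y * ((y⁻¹ * y⁻¹) * (x⁻¹ * x⁻¹) * y) := by
        rw [mul_eq_inv_mul_inv hxy]; group
      _ = _ := by rw [inv_sq_eq hy, inv_sq_eq hx, mul_mul_eq_inv hxy]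

/-- Right multiplication by `x_i` preserves `H` and the cosets `H y⁻¹ x_j` with `j ≠ i`, and
permutes `H y`, `H y⁻¹`, `H y⁻¹ x_i` cyclically. -/
lemma mul_initial_mem {m : ℕ} {X : Fin (m + 1) → Γ} (hX : IsCarmichael X) {g : Γ}
    (hg : g ∈ cosets X) (i : Fin m) : g * X i.castSucc ∈ cosets X := by
  have hy := hX.pow_three (.last m)
  have hx := hX.pow_three i.castSucc
  have hxy := hX.mul_sq i.castSucc (.last m) (Fin.castSucc_lt_last i).ne
  rcases hg with h | h | h | ⟨j, h⟩
  · exact .inl (mul_mem h (mem_initial X i))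
  · refine .inr (.inr (.inl ?_))
    convert mul_mem h (inv_mem (mem_initial X i)) using 1
    rw [← mul_mul_eq_inv hxy]
    group
  · refine .inr (.inr (.inr ⟨i, ?_⟩))
    rwa [mul_inv_cancel_right]
  · by_cases hij : i = j
    · subst hij
      refine .inr (.inl ?_)
      convert mul_mem h (mem_initial X i) using 1
      have h2 := mul_mul_eq_inv hxy
      have h3 := inv_sq_eq hx
      set x := X i.castSucc
      set y := X (.last m)
      calc g * x * y⁻¹ = g * x⁻¹ * y * (y⁻¹ * (x * x) * y⁻¹) := by group
        _ = g * x⁻¹ * y * (y⁻¹ * x⁻¹ * y⁻¹) := by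
          rw [show x * x = x⁻¹ by rw [eq_inv_iff_mul_eq_one, ← hx, pow_three']]
        _ = g * x⁻¹ * y * (y * x * y)⁻¹ := by group
        _ = _ := by rw [h2, inv_inv]
    · refine .inr (.inr (.inr ⟨j, ?_⟩))
      have hxj := hX.pow_three j.castSucc
      have hji := hX.mul_sq j.castSucc i.castSucc fun e => hij (Fin.castSucc_injective m e).symm
      have hjy := hX.mul_sq j.castSucc (.last m) (Fin.castSucc_lt_last j).ne
      convert mul_mem (mul_mem h (mem_initial X i)) (inv_mem (mem_initial X j)) using 1
      set x := X i.castSucc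
      set z := X j.castSucc
      set y := X (.last m)
      calc g * x * z⁻¹ * y = g * z⁻¹ * y * (y⁻¹ * (z * x) * z⁻¹ * y) := by group
        _ = g * z⁻¹ * y * ((y⁻¹ * x⁻¹) * (z⁻¹ * z⁻¹) * y) := by
          rw [mul_eq_inv_mul_inv hji]; group
        _ = g * z⁻¹ * y * x * (y * z * y) := by
          rw [← mul_eq_inv_mul_inv hxy, inv_sq_eq hxj]; group
        _ = _ := by rw [mul_mul_eq_inv hjy]

lemma closure_subset_cosets {m : ℕ} {X : Fin (m + 1) → Γ} (hX : IsCarmichael X) :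
    (Subgroup.closure (Set.range X) : Set Γ) ⊆ cosets X := by
  have hmul : ∀ g ∈ cosets X, ∀ i, g * X i ∈ cosets X := fun g hg i => by
    induction i using Fin.lastCases with
    | last => exact mul_last_mem hX hg
    | cast i => exact mul_initial_mem hX hg i
  intro g hg
  refine Subgroup.closure_induction_right (p := fun g _ => g ∈ cosets X)
    (.inl (one_mem _)) ?_ ?_ hg
  · rintro g _ _ ⟨i, rfl⟩ h
    exact hmul _ h i
  · rintro g _ _ ⟨i, rfl⟩ h
    have := hmul _ (hmul _ h i) i
    rwa [mul_assoc, show X i * X i = (X i)⁻¹ by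
      rw [eq_inv_iff_mul_eq_one, ← hX.pow_three i, pow_three']] at this

/-- Coset enumeration: the `m` initial generators span a subgroup with at most `m + 3` cosets, so
each new generator multiplies the bound by `m + 3`. -/
theorem finite_and_card_le : ∀ {m : ℕ} {X : Fin m → Γ}, IsCarmichael X →
    Finite (Subgroup.closure (Set.range X)) ∧
      2 * Nat.card (Subgroup.closure (Set.range X)) ≤ (m + 2).factorial
  | 0, X, _ => by
    have h : Set.range X = ∅ := Set.range_eq_empty X
    rw [h, Subgroup.closure_empty]
    exact ⟨inferInstance, by simp⟩
  | m + 1, X, hX => by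
    have hX' : IsCarmichael fun i : Fin m => X i.castSucc :=
      ⟨fun i => hX.pow_three _,
        fun i j h => hX.mul_sq _ _ fun e => h (Fin.castSucc_injective m e)⟩
    obtain ⟨hf, hc⟩ := finite_and_card_le hX'
    change Finite (initial X) at hf
    change 2 * Nat.card (initial X) ≤ _ at hc
    let rep : Option (Option (Option (Fin m))) → Γ := fun
      | none => 1
      | some none => X (.last m)
      | some (some none) => (X (.last m))⁻¹
      | some (some (some j)) => (X (.last m))⁻¹ * X j.castSucc
    have hsub : (Subgroup.closure (Set.range X) : Set Γ) ⊆
        Set.range fun p : initial X × Option (Option (Option (Fin m))) => p.1.1 * rep p.2 := by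
      refine (closure_subset_cosets hX).trans ?_
      rintro g (h | h | h | ⟨j, h⟩)
      · exact ⟨(⟨g, h⟩, none), mul_one g⟩
      · exact ⟨(⟨_, h⟩, some none), inv_mul_cancel_right g _⟩
      · exact ⟨(⟨_, h⟩, some (some none)), mul_inv_cancel_right g _⟩
      · refine ⟨(⟨_, h⟩, some (some (some j))), ?_⟩
        change g * (X j.castSucc)⁻¹ * X (.last m) * ((X (.last m))⁻¹ * X j.castSucc) = g
        group
    have hfin := (Set.finite_range
      fun p : initial X × Option (Option (Option (Fin m))) => p.1.1 * rep p.2)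
    refine ⟨(hfin.subset hsub).to_subtype, ?_⟩
    have h1 : Nat.card (Subgroup.closure (Set.range X)) ≤ Nat.card (initial X) * (m + 3) := by
      refine (Nat.card_mono hfin hsub).trans ((Finite.card_range_le _).trans ?_)
      rw [Nat.card_prod]
      simp
    calc _ ≤ (m + 3) * (2 * Nat.card (initial X)) := by
          have := Nat.mul_le_mul_left 2 h1
          linarith
      _ ≤ (m + 3) * (m + 2).factorial := Nat.mul_le_mul_left _ hc
      _ = (m + 1 + 2).factorial := (Nat.factorial_succ (m + 2)).symm

end IsCarmichael

/-- The three-cycle `(0 1 i)`, where `i` runs through the indices greater than one. -/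
def tri {m : ℕ} (i : Fin m) : alternatingGroup (Fin (m + 2)) :=
  ⟨Equiv.swap 0 1 * Equiv.swap 1 i.succ.succ, by
    rw [Equiv.Perm.mem_alternatingGroup, Equiv.Perm.sign_mul, Equiv.Perm.sign_swap,
      Equiv.Perm.sign_swap] <;> simp [Fin.ext_iff]⟩

lemma tri_zero {m : ℕ} (i : Fin m) : (tri i).1 0 = 1 := by
  change Equiv.swap 0 1 (Equiv.swap 1 i.succ.succ 0) = 1
  rw [Equiv.swap_apply_of_ne_of_ne (a := 1), Equiv.swap_apply_left] <;> simp [Fin.ext_iff]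

lemma tri_one {m : ℕ} (i : Fin m) : (tri i).1 1 = i.succ.succ := by
  change Equiv.swap 0 1 (Equiv.swap 1 i.succ.succ 1) = _
  rw [Equiv.swap_apply_left, Equiv.swap_apply_of_ne_of_ne] <;> simp [Fin.ext_iff]

lemma tri_self {m : ℕ} (i : Fin m) : (tri i).1 i.succ.succ = 0 := by
  change Equiv.swap 0 1 (Equiv.swap 1 i.succ.succ _) = 0
  rw [Equiv.swap_apply_right, Equiv.swap_apply_right]

lemma tri_of_ne {m : ℕ} {i j : Fin m} (h : j ≠ i) : (tri i).1 j.succ.succ = j.succ.succ := by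
  change Equiv.swap 0 1 (Equiv.swap 1 i.succ.succ _) = _
  have h0 : j.succ.succ ≠ 0 := Fin.succ_ne_zero _
  have h1 : j.succ.succ ≠ 1 := fun e => Fin.succ_ne_zero _ (Fin.succ_injective _ e)
  rw [Equiv.swap_apply_of_ne_of_ne h1 fun e =>
    h (Fin.succ_injective _ (Fin.succ_injective _ e)), Equiv.swap_apply_of_ne_of_ne h0 h1]

lemma forall_fin_succ_succ {m : ℕ} {p : Fin (m + 2) → Prop} :
    (∀ k, p k) ↔ p 0 ∧ p 1 ∧ ∀ k : Fin m, p k.succ.succ := by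
  rw [Fin.forall_fin_succ, Fin.forall_fin_succ]
  rfl

lemma alternatingGroup_ext {n : ℕ} {g h : alternatingGroup (Fin n)} (H : ∀ k, g.1 k = h.1 k) :
    g = h := Subtype.ext (Equiv.ext H)

lemma pow_three_eq_one {n : ℕ} {g : alternatingGroup (Fin n)}
    (h : ∀ k, g.1 (g.1 (g.1 k)) = k) : g ^ 3 = 1 := alternatingGroup_ext h

lemma mul_sq_eq_one {n : ℕ} {g h : alternatingGroup (Fin n)}
    (H : ∀ k, g.1 (h.1 (g.1 (h.1 k))) = k) : (g * h) ^ 2 = 1 := alternatingGroup_ext H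

lemma isCarmichael_tri (m : ℕ) : IsCarmichael (tri (m := m)) where
  pow_three i := by
    refine pow_three_eq_one (forall_fin_succ_succ.2 ⟨?_, ?_, fun k => ?_⟩)
    · rw [tri_zero, tri_one, tri_self]
    · rw [tri_one, tri_self, tri_zero]
    · by_cases h : k = i
      · rw [h, tri_self, tri_zero, tri_one]
      · rw [tri_of_ne h, tri_of_ne h, tri_of_ne h]
  mul_sq i j hij := by
    refine mul_sq_eq_one (forall_fin_succ_succ.2 ⟨?_, ?_, fun k => ?_⟩)
    · rw [tri_zero, tri_one, tri_of_ne hij, tri_self]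
    · rw [tri_one, tri_of_ne hij.symm, tri_self, tri_zero]
    · by_cases h : k = j
      · rw [h, tri_self, tri_zero, tri_one, tri_of_ne hij.symm]
      · rw [tri_of_ne h]
        by_cases h' : k = i
        · rw [h', tri_self, tri_zero, tri_one]
        · rw [tri_of_ne h', tri_of_ne h, tri_of_ne h']

/-- The transposition `(0 1)` normalizes the subgroup `S` generated by these cycles, and together
with `S` it yields every transposition `(1 k)`. So `S ∪ S (0 1)` is the symmetric group, and the
sign shows that even permutations lie in `S`. -/
lemma closure_range_tri (m : ℕ) : Subgroup.closure (Set.range (tri (m := m))) = ⊤ := by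
  set S := Subgroup.closure (Set.range (tri (m := m)))
  let τ : Equiv.Perm (Fin (m + 2)) := Equiv.swap 0 1
  have hττ : τ * τ = 1 := Equiv.swap_mul_self 0 1
  have hconj : ∀ s : alternatingGroup (Fin (m + 2)), s ∈ S →
      ∃ s' ∈ S, s'.1 * τ = τ * s.1 := fun s hs => by
    induction hs using Subgroup.closure_induction with
    | mem x hx =>
      obtain ⟨i, rfl⟩ := hx
      refine ⟨(tri i)⁻¹, inv_mem (Subgroup.subset_closure ⟨i, rfl⟩), ?_⟩
      change (τ * Equiv.swap 1 i.succ.succ)⁻¹ * τ = τ * (τ * Equiv.swap 1 i.succ.succ)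
      rw [mul_inv_rev, inv_mul_cancel_right, ← mul_assoc, hττ, one_mul, Equiv.swap_inv]
    | one => exact ⟨1, one_mem _, by simp⟩
    | mul a b _ _ ha hb =>
      obtain ⟨a', ha', ha⟩ := ha
      obtain ⟨b', hb', hb⟩ := hb
      refine ⟨a' * b', mul_mem ha' hb', ?_⟩
      change a'.1 * b'.1 * τ = τ * (a.1 * b.1)
      rw [mul_assoc, hb, ← mul_assoc, ha, mul_assoc]
    | inv a _ ha =>
      obtain ⟨a', ha', ha⟩ := ha
      refine ⟨a'⁻¹, inv_mem ha', ?_⟩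
      change a'.1⁻¹ * τ = τ * a.1⁻¹
      rw [inv_mul_eq_iff_eq_mul, ← mul_assoc, ha, mul_inv_cancel_right]
  let K : Subgroup (Equiv.Perm (Fin (m + 2))) :=
    { carrier := {g | ∃ s ∈ S, g = s.1 ∨ g = s.1 * τ}
      one_mem' := ⟨1, one_mem _, .inl rfl⟩
      mul_mem' := by
        rintro _ _ ⟨a, ha, rfl | rfl⟩ ⟨b, hb, rfl | rfl⟩
        · exact ⟨a * b, mul_mem ha hb, .inl rfl⟩
        · exact ⟨a * b, mul_mem ha hb, .inr (mul_assoc _ _ _).symm⟩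
        · obtain ⟨b', hb', h⟩ := hconj b hb
          refine ⟨a * b', mul_mem ha hb', .inr ?_⟩
          change a.1 * τ * b.1 = a.1 * b'.1 * τ
          rw [mul_assoc, ← h, mul_assoc]
        · obtain ⟨b', hb', h⟩ := hconj b hb
          refine ⟨a * b', mul_mem ha hb', .inl ?_⟩
          change a.1 * τ * (b.1 * τ) = a.1 * b'.1
          rw [mul_assoc, ← mul_assoc τ, ← h, mul_assoc, hττ, mul_one]
      inv_mem' := by
        rintro _ ⟨a, ha, rfl | rfl⟩
        · exact ⟨a⁻¹, inv_mem ha, .inl rfl⟩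
        · obtain ⟨b', hb', h⟩ := hconj a⁻¹ (inv_mem ha)
          refine ⟨b', hb', .inr ?_⟩
          rw [h, mul_inv_rev]
          rfl }
  have hτ : τ ∈ K := ⟨1, one_mem _, .inr (one_mul τ).symm⟩
  have hone : ∀ k, Equiv.swap 1 k ∈ K := forall_fin_succ_succ.2 ⟨?_, ?_, fun k => ?_⟩
  rotate_left
  · rw [Equiv.swap_comm]; exact hτ
  · rw [Equiv.swap_self]; exact one_mem _
  · have : Equiv.swap 1 k.succ.succ = τ * (tri k).1 := by
      change _ = τ * (τ * _)
      rw [← mul_assoc, hττ, one_mul]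
    rw [this]
    exact mul_mem hτ ⟨tri k, Subgroup.subset_closure ⟨k, rfl⟩, .inl rfl⟩
  have hK : K = ⊤ := by
    rw [eq_top_iff, ← Equiv.Perm.closure_isSwap, Subgroup.closure_le]
    rintro _ ⟨a, b, hab, rfl⟩
    by_cases ha : a = 1
    · rw [ha]; exact hone b
    · by_cases hb : b = 1
      · rw [hb, Equiv.swap_comm]; exact hone a
      · rw [← Equiv.swap_mul_swap_mul_swap hb hab.symm, Equiv.swap_comm b]
        exact mul_mem (mul_mem (hone _) (hone _)) (hone _)
  rw [eq_top_iff]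
  rintro g -
  obtain ⟨s, hs, h | h⟩ := (hK ▸ Subgroup.mem_top g.1 : g.1 ∈ K)
  · rwa [Subtype.ext h]
  · exfalso
    have h1 := congrArg Equiv.Perm.sign h
    rw [Equiv.Perm.sign_mul, Equiv.Perm.mem_alternatingGroup.1 g.2,
      Equiv.Perm.mem_alternatingGroup.1 s.2, Equiv.Perm.sign_swap (by simp)] at h1
    exact absurd h1 (by decide)

/-- Carmichael's presentation of the alternating group. -/
theorem IsCarmichael.exists_hom {m : ℕ} {X : Fin m → Γ} (hX : IsCarmichael X) :
    ∃ f : alternatingGroup (Fin (m + 2)) →* Γ, ∀ i, f (tri i) = X i := by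
  let rels : Set (FreeGroup (Fin m)) :=
    {r | (∃ i, r = FreeGroup.of i ^ 3) ∨
      ∃ i j, i ≠ j ∧ r = (FreeGroup.of i * FreeGroup.of j) ^ 2}
  have hlift : ∀ {Δ : Type} [Group Δ] {Y : Fin m → Δ}, IsCarmichael Y →
      ∀ r ∈ rels, FreeGroup.lift Y r = 1 := by
    rintro Δ _ Y hY _ (⟨i, rfl⟩ | ⟨i, j, hij, rfl⟩)
    · simpa using hY.pow_three i
    · simpa using hY.mul_sq i j hij
  have hgen : IsCarmichael fun i : Fin m => PresentedGroup.of (rels := rels) i :=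
    ⟨fun i => (PresentedGroup.one_of_mem (rels := rels) (.inl ⟨i, rfl⟩) :),
      fun i j h => (PresentedGroup.one_of_mem (rels := rels) (.inr ⟨i, j, h, rfl⟩) :)⟩
  obtain ⟨hfin, hcard⟩ := hgen.finite_and_card_le
  have htop : Subgroup.closure (Set.range fun i : Fin m => PresentedGroup.of (rels := rels) i) = ⊤ :=
    PresentedGroup.closure_range_of rels
  rw [htop] at hfin hcard
  have : Finite (PresentedGroup rels) := Finite.of_equiv _ Subgroup.topEquiv.toEquiv
  rw [Nat.card_congr Subgroup.topEquiv.toEquiv] at hcard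
  let π := PresentedGroup.toGroup (hlift (isCarmichael_tri m))
  have hπ : Function.Surjective π := by
    rw [← MonoidHom.range_eq_top, eq_top_iff, ← closure_range_tri, Subgroup.closure_le]
    rintro _ ⟨i, rfl⟩
    exact ⟨_, PresentedGroup.toGroup.of _⟩
  -- The presented group has at most `(m + 2)! / 2` elements and maps onto a group with exactly that
  -- many.
  have hbij : Function.Bijective π := by
    refine hπ.bijective_of_nat_card_le ?_
    have h1 : 2 * Nat.card (alternatingGroup (Fin (m + 2))) = (m + 2).factorial := by
      rw [two_mul_nat_card_alternatingGroup, Nat.card_perm, Nat.card_fin]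
    linarith
  let e := MulEquiv.ofBijective π hbij
  refine ⟨(PresentedGroup.toGroup (hlift hX)).comp e.symm.toMonoidHom, fun i => ?_⟩
  have : e.symm (tri i) = PresentedGroup.of i := by
    rw [MulEquiv.symm_apply_eq]
    exact (PresentedGroup.toGroup.of (hlift (isCarmichael_tri m))).symm
  change PresentedGroup.toGroup (hlift hX) (e.symm (tri i)) = X i
  rw [this]
  exact PresentedGroup.toGroup.of _

lemma hom_eq_of_tri {m : ℕ} {f g : alternatingGroup (Fin (m + 2)) →* Γ}
    (h : ∀ i, f (tri i) = g (tri i)) : f = g := by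
  refine MonoidHom.eq_of_eqOn_dense (closure_range_tri m) ?_
  rintro _ ⟨i, rfl⟩
  exact h i

end Carmichael

/-! ### Splitting of central extensions of alternating groups -/

section Perm

variable {m : ℕ}

lemma succ_succ_ne_zero (i : Fin m) : i.succ.succ ≠ 0 := Fin.succ_ne_zero _

lemma succ_succ_ne_one (i : Fin m) : i.succ.succ ≠ 1 :=
  fun e => Fin.succ_ne_zero _ (Fin.succ_injective _ e)

lemma succ_succ_ne {i j : Fin m} (h : i ≠ j) : i.succ.succ ≠ j.succ.succ :=
  fun e => h (Fin.succ_injective _ (Fin.succ_injective _ e))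

lemma zero_ne_one_fin : (0 : Fin (m + 2)) ≠ 1 := by simp

/-- The product of two transpositions. -/
def swapSwap {n : ℕ} (a b c d : Fin n) (hab : a ≠ b) (hcd : c ≠ d) : alternatingGroup (Fin n) :=
  ⟨Equiv.swap a b * Equiv.swap c d, by
    rw [Equiv.Perm.mem_alternatingGroup, Equiv.Perm.sign_mul, Equiv.Perm.sign_swap hab,
      Equiv.Perm.sign_swap hcd]
    rfl⟩

lemma swapSwap_apply {n : ℕ} (a b c d : Fin n) (hab : a ≠ b) (hcd : c ≠ d) (k : Fin n) :
    (swapSwap a b c d hab hcd).1 k = Equiv.swap a b (Equiv.swap c d k) := rfl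

lemma conj_swap_mul_swap {α : Type*} [DecidableEq α] (g : Equiv.Perm α) (a b c d : α) :
    g * (Equiv.swap a b * Equiv.swap c d) * g⁻¹ =
      Equiv.swap (g a) (g b) * Equiv.swap (g c) (g d) := by
  have key : ∀ a b, g * Equiv.swap a b * g⁻¹ = Equiv.swap (g a) (g b) := fun a b => by
    rw [Equiv.mul_swap_eq_swap_mul, mul_inv_cancel_right]
  rw [← key, ← key]
  group

lemma conj_tri {g : alternatingGroup (Fin (m + 2))} {i j : Fin m} (h0 : g.1 0 = 0)
    (h1 : g.1 1 = 1) (h2 : g.1 i.succ.succ = j.succ.succ) : g * tri i * g⁻¹ = tri j := by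
  refine Subtype.ext ?_
  change g.1 * (Equiv.swap 0 1 * Equiv.swap 1 i.succ.succ) * g.1⁻¹ =
    Equiv.swap 0 1 * Equiv.swap 1 j.succ.succ
  rw [conj_swap_mul_swap, h0, h1, h2]

lemma conj_tri' {g : alternatingGroup (Fin (m + 2))} {i j : Fin m} (h0 : g.1 0 = 1)
    (h1 : g.1 1 = 0) (h2 : g.1 i.succ.succ = j.succ.succ) : g * tri i * g⁻¹ = (tri j)⁻¹ := by
  refine Subtype.ext ?_
  change g.1 * (Equiv.swap 0 1 * Equiv.swap 1 i.succ.succ) * g.1⁻¹ =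
    (Equiv.swap 0 1 * Equiv.swap 1 j.succ.succ)⁻¹
  rw [conj_swap_mul_swap, h0, h1, h2, mul_inv_rev,
    Equiv.swap_inv, Equiv.swap_inv, Equiv.swap_comm 1 0, Equiv.mul_swap_eq_swap_mul,
    Equiv.swap_apply_left, Equiv.swap_apply_of_ne_of_ne (succ_succ_ne_zero j) (succ_succ_ne_one j)]

lemma tri_mul_swapSwap {i a b c : Fin m} (hab : a ≠ b) (hac : a ≠ c) (hia : i ≠ a) (hib : i ≠ b)
    (hic : i ≠ c) :
    tri i * swapSwap a.succ.succ b.succ.succ a.succ.succ c.succ.succ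
      (succ_succ_ne hab) (succ_succ_ne hac) = swapSwap a.succ.succ b.succ.succ a.succ.succ
      c.succ.succ (succ_succ_ne hab) (succ_succ_ne hac) * tri i := by
  rw [← mul_inv_eq_iff_eq_mul.1 (conj_tri (i := i) (j := i) ?_ ?_ ?_)]
  all_goals rw [swapSwap_apply]
  · rw [Equiv.swap_apply_of_ne_of_ne, Equiv.swap_apply_of_ne_of_ne] <;>
      exact (succ_succ_ne_zero _).symm
  · rw [Equiv.swap_apply_of_ne_of_ne, Equiv.swap_apply_of_ne_of_ne] <;>
      exact (succ_succ_ne_one _).symm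
  · rw [Equiv.swap_apply_of_ne_of_ne (succ_succ_ne hia) (succ_succ_ne hic),
      Equiv.swap_apply_of_ne_of_ne (succ_succ_ne hia) (succ_succ_ne hib)]

lemma swapSwap_pow_three {n : ℕ} {a b c : Fin n} (hab : a ≠ b) (hac : a ≠ c) (hbc : b ≠ c) :
    swapSwap a b a c hab hac ^ 3 = 1 := by
  refine Subtype.ext ?_
  have h := (Equiv.Perm.isThreeCycle_swap_mul_swap_same hab hac hbc).orderOf
  change (Equiv.swap a b * Equiv.swap a c) ^ 3 = 1
  rw [← h, pow_orderOf_eq_one]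

end Perm

/-! ### Lifting Carmichael's generators to a central extension. -/

section Extension

/-- Auxiliary relations for the Klein four-group inside a central extension of the alternating
group on four letters. -/
lemma pow_six_eq_one {E : Type} [Group E] {x y z : E} (hx : x ^ 3 = 1) (hy : y ^ 3 = 1)
    (h : (x * y) ^ 2 = z) (hz : ∀ e, z * e = e * z) : z ^ 6 = 1 := by
  have hzc : ∀ e, Commute z e := hz
  have hxi : x⁻¹ * x⁻¹ = x := inv_sq_eq hx
  have hyi : y⁻¹ * y⁻¹ = y := inv_sq_eq hy
  have hxx : x * x = x⁻¹ := by rw [eq_inv_iff_mul_eq_one, ← hx, pow_three']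
  have hyy : y * y = y⁻¹ := by rw [eq_inv_iff_mul_eq_one, ← hy, pow_three']
  have e1 : x * y * (x * y) = z := by rw [← h, sq]
  have e2 : y * x * (y * x) = z := by
    calc y * x * (y * x) = x⁻¹ * (x * y * (x * y)) * x := by group
      _ = z := by rw [e1, mul_assoc, hz, ← mul_assoc, inv_mul_cancel, one_mul]
  -- These three elements play the part of lifts of the involutions in the Klein four-group. Their
  -- squares all equal `z` and `p * q = r⁻¹`, so `p` and `q` commute up to `z ^ 3`. Moving `q` past
  -- the central `p * p` in two ways gives `z ^ 3 = z⁻¹ ^ 3`.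
  obtain ⟨p, hp⟩ : ∃ p, p = x * y := ⟨_, rfl⟩
  obtain ⟨q, hq⟩ : ∃ q, q = y * x := ⟨_, rfl⟩
  obtain ⟨r, hr⟩ : ∃ r, r = x⁻¹ * y * x⁻¹ := ⟨_, rfl⟩
  rw [← hp] at e1
  rw [← hq] at e2
  have e3 : r * r = z := by
    calc r * r = x⁻¹ * (y * (x⁻¹ * x⁻¹) * y * x⁻¹) := by rw [hr]; group
      _ = x⁻¹ * (y * x * y * x⁻¹) := by rw [hxi]
      _ = x⁻¹ * (y * x * (y * x) * (x⁻¹ * x⁻¹)) := by group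
      _ = x⁻¹ * (z * x) := by rw [← hq, e2, hxi]
      _ = z := by rw [hz, ← mul_assoc, inv_mul_cancel, one_mul]
  have hpq : p * q = r⁻¹ := by
    calc p * q = x * (y * y) * x := by rw [hp, hq]; group
      _ = r⁻¹ := by rw [hyy, hr]; group
  have hr' : r⁻¹ = z⁻¹ * r := by rw [eq_inv_mul_iff_mul_eq, ← e3]; group
  have hpi : p⁻¹ = z⁻¹ * p := by rw [eq_inv_mul_iff_mul_eq, ← e1]; group
  have hqi : q⁻¹ = z⁻¹ * q := by rw [eq_inv_mul_iff_mul_eq, ← e2]; group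
  have hqp : q * p = z ^ 3 * (p * q) := by
    have h1 : r = z⁻¹ * q * (z⁻¹ * p) := by rw [← hqi, ← hpi, ← mul_inv_rev, hpq, inv_inv]
    have h2 : z⁻¹ * q * (z⁻¹ * p) = z⁻¹ * z⁻¹ * (q * p) := by
      calc z⁻¹ * q * (z⁻¹ * p) = z⁻¹ * (q * z⁻¹) * p := by group
        _ = z⁻¹ * (z⁻¹ * q) * p := by rw [((hzc q).inv_left).eq]
        _ = z⁻¹ * z⁻¹ * (q * p) := by group
    rw [hpq, hr', h1, h2]
    group
  have h3 : p * (q * p) = z ^ 3 * (p * p * q) := by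
    rw [hqp, ← mul_assoc, ((hzc p).pow_left 3).symm.eq]
    group
  have h4 : p * (q * p) = z⁻¹ ^ 3 * (q * p) * p := by
    rw [← mul_assoc, show p * q = z⁻¹ ^ 3 * (q * p) by rw [hqp]; group]
  have h5 : z ^ 3 * (z * q) = z⁻¹ ^ 3 * (z * q) := by
    calc z ^ 3 * (z * q) = z ^ 3 * (p * p * q) := by rw [← e1]
      _ = z⁻¹ ^ 3 * (q * (p * p)) := by rw [← h3, h4]; group
      _ = _ := by rw [e1, hz q]
  have h6 : z ^ 3 = z⁻¹ ^ 3 := mul_right_cancel h5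
  calc z ^ 6 = z ^ 3 * z ^ 3 := by group
    _ = 1 := by nth_rw 1 [h6]; group

variable {m : ℕ} {E : Type} [Group E] {π : E →* alternatingGroup (Fin (m + 2))}
  (hπ : Function.Surjective π) (hc : ∀ z, π z = 1 → ∀ e, z * e = e * z)
  (hdiv : ∀ z, π z = 1 → ∃ w, π w = 1 ∧ w ^ 3 = z)

-- The cube of any lift is central and has a central cube root, by which the lift can be divided.
include hπ hc hdiv in
lemma exists_lift_pow_three {x : alternatingGroup (Fin (m + 2))} (hx : x ^ 3 = 1) :
    ∃ X, π X = x ∧ X ^ 3 = 1 := by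
  obtain ⟨X, rfl⟩ := hπ x
  obtain ⟨w, hw, hw3⟩ := hdiv (X ^ 3) (by rw [map_pow, hx])
  refine ⟨w⁻¹ * X, by rw [map_mul, map_inv, hw, inv_one, one_mul], ?_⟩
  have : Commute w⁻¹ X := (show Commute w X from hc w hw X).inv_left
  rw [this.mul_pow, inv_pow, hw3, inv_mul_cancel]

lemma IsCarmichael.exists_section {X : Fin m → E} (hX : IsCarmichael X)
    (h : ∀ i, π (X i) = tri i) :
    ∃ s : alternatingGroup (Fin (m + 2)) →* E, ∀ g, π (s g) = g := by
  obtain ⟨s, hs⟩ := hX.exists_hom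
  refine ⟨s, fun g => ?_⟩
  have : π.comp s = MonoidHom.id _ := hom_eq_of_tri fun i => by
    rw [MonoidHom.comp_apply, hs, h]
    rfl
  exact DFunLike.congr_fun this g

end Extension

theorem exists_section_three {E : Type} [Group E] {π : E →* alternatingGroup (Fin (1 + 2))}
    (hπ : Function.Surjective π) (hc : ∀ z, π z = 1 → ∀ e, z * e = e * z)
    (hdiv : ∀ z, π z = 1 → ∃ w, π w = 1 ∧ w ^ 3 = z) :
    ∃ s : alternatingGroup (Fin (1 + 2)) →* E, ∀ g, π (s g) = g := by
  obtain ⟨X, hX, hX3⟩ := exists_lift_pow_three hπ hc hdiv ((isCarmichael_tri 1).pow_three 0)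
  refine IsCarmichael.exists_section (X := fun _ => X)
    ⟨fun _ => hX3, fun i j h => (h (Subsingleton.elim i j)).elim⟩ fun i => ?_
  rw [hX, Subsingleton.elim i 0]

/-- For lifts of trivial cube, `z = (X * Y) ^ 2` is central, and the identity of sixth powers gives
`z ^ 3 = 1`. Replacing `Y` by `z * Y` keeps its cube and multiplies `(X * Y) ^ 2` by `z ^ 2`, so
that it becomes trivial. -/
theorem exists_section_four {E : Type} [Group E] {π : E →* alternatingGroup (Fin (2 + 2))}
    (hπ : Function.Surjective π) (hc : ∀ z, π z = 1 → ∀ e, z * e = e * z)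
    (hdiv : ∀ z, π z = 1 → ∃ w, π w = 1 ∧ w ^ 3 = z)
    (hζ : ∀ X Y, π X = tri 0 → π Y = tri 1 → (X * Y) ^ 6 = X ^ 6 * Y ^ 6) :
    ∃ s : alternatingGroup (Fin (2 + 2)) →* E, ∀ g, π (s g) = g := by
  obtain ⟨X, hX, hX3⟩ := exists_lift_pow_three hπ hc hdiv ((isCarmichael_tri 2).pow_three 0)
  obtain ⟨Y, hY, hY3⟩ := exists_lift_pow_three hπ hc hdiv ((isCarmichael_tri 2).pow_three 1)
  have hz : π ((X * Y) ^ 2) = 1 := by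
    rw [map_pow, map_mul, hX, hY]
    exact (isCarmichael_tri 2).mul_sq 0 1 (by decide)
  set z := (X * Y) ^ 2 with hzdef
  have hz3 : z ^ 3 = 1 := by
    rw [hzdef, ← pow_mul, hζ X Y hX hY, show 6 = 3 * 2 from rfl, pow_mul, pow_mul, hX3, hY3]
    simp
  have hzc := hc _ hz
  have h1 : (X * (z * Y)) ^ 2 = 1 := by
    rw [← mul_assoc, ← hzc X, mul_assoc, (show Commute z (X * Y) from hzc _).mul_pow, ← hzdef,
      ← hz3]
    group
  refine IsCarmichael.exists_section (X := ![X, z * Y]) ⟨fun i => ?_, fun i j hij => ?_⟩ fun i => ?_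
  · fin_cases i
    · exact hX3
    · change (z * Y) ^ 3 = 1
      rw [(show Commute z Y from hzc _).mul_pow, hz3, hY3, one_mul]
  · fin_cases i <;> fin_cases j
    · exact (hij rfl).elim
    · exact h1
    · change (z * Y * X) ^ 2 = 1
      calc (z * Y * X) ^ 2 = X⁻¹ * (X * (z * Y)) ^ 2 * X := by rw [sq, sq]; group
        _ = 1 := by rw [h1]; group
    · exact (hij rfl).elim
  · fin_cases i
    · exact hX
    · change π (z * Y) = _
      rw [map_mul, hz, one_mul, hY]
      rfl

/-! ### Splitting of central extensions in degree at least five. -/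

section LargeDegree

variable {m : ℕ} {E : Type} [Group E] {π : E →* alternatingGroup (Fin (m + 2))}
  (hπ : Function.Surjective π) (hc : ∀ z, π z = 1 → ∀ e, z * e = e * z)

/-- The conjugation action of the quotient of a central extension. -/
def conjAct (hπ : Function.Surjective π) (hc : ∀ z, π z = 1 → ∀ e, z * e = e * z) :
    alternatingGroup (Fin (m + 2)) →* MulAut E :=
  π.liftOfSurjective hπ ⟨MulAut.conj, fun z hz => by
    refine MulEquiv.ext fun e => ?_
    change z * e * z⁻¹ = e
    rw [hc z hz, mul_inv_cancel_right]⟩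

lemma conjAct_proj (g X : E) : conjAct hπ hc (π g) X = g * X * g⁻¹ := by
  have h := π.liftOfRightInverse_comp_apply (Function.surjInv hπ) (Function.rightInverse_surjInv hπ)
    ⟨MulAut.conj, fun z hz => by
    refine MulEquiv.ext fun e => ?_
    change z * e * z⁻¹ = e
    rw [hc z hz, mul_inv_cancel_right]⟩ g
  exact DFunLike.congr_fun h X

lemma proj_conjAct (g : alternatingGroup (Fin (m + 2))) (X : E) :
    π (conjAct hπ hc g X) = g * π X * g⁻¹ := by
  obtain ⟨g, rfl⟩ := hπ g
  rw [conjAct_proj, map_mul, map_mul, map_inv]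

lemma conjAct_of_proj_eq_one (g : alternatingGroup (Fin (m + 2))) {z : E} (hz : π z = 1) :
    conjAct hπ hc g z = z := by
  obtain ⟨g, rfl⟩ := hπ g
  rw [conjAct_proj, ← hc z hz, mul_inv_cancel_right]

/-- A lift `X` of one generator is normalized so that its cube is trivial and an involution
exchanging `0` and `1` inverts it. By `hK`, its conjugates under permutations fixing `0` and `1`
depend only on the image of `i`. They provide lifts of all generators, permuted by these
permutations and inverted by those exchanging `0` and `1`. Thus the relation for the single pair
`i`, `j` implies the relation for every pair. -/
theorem exists_section_of_centralizes (hdiv : ∀ z, π z = 1 → ∃ w, π w = 1 ∧ w ^ 3 = z)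
    {i j k : Fin m} (hij : i ≠ j) (hik : i ≠ k) (hjk : j ≠ k)
    (hζ : ∀ X Y, π X = tri i → π Y = tri j → (X * Y) ^ 6 = X ^ 6 * Y ^ 6)
    (hK : ∀ (g : alternatingGroup (Fin (m + 2))) (X : E), g.1 0 = 0 → g.1 1 = 1 →
      g.1 i.succ.succ = i.succ.succ → π X = tri i → conjAct hπ hc g X = X) :
    ∃ s : alternatingGroup (Fin (m + 2)) →* E, ∀ g, π (s g) = g := by
  set c := conjAct hπ hc with hcdef
  obtain ⟨X₀, hX₀, hX₀3⟩ := exists_lift_pow_three hπ hc hdiv ((isCarmichael_tri m).pow_three i)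
  let γ : alternatingGroup (Fin (m + 2)) :=
    swapSwap 0 1 j.succ.succ k.succ.succ zero_ne_one_fin (succ_succ_ne hjk)
  have hγ0 : γ.1 0 = 1 := by
    rw [swapSwap_apply, Equiv.swap_apply_of_ne_of_ne (succ_succ_ne_zero j).symm
      (succ_succ_ne_zero k).symm, Equiv.swap_apply_left]
  have hγ1 : γ.1 1 = 0 := by
    rw [swapSwap_apply, Equiv.swap_apply_of_ne_of_ne (succ_succ_ne_one j).symm
      (succ_succ_ne_one k).symm, Equiv.swap_apply_right]
  have hγi : γ.1 i.succ.succ = i.succ.succ := by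
    rw [swapSwap_apply, Equiv.swap_apply_of_ne_of_ne (succ_succ_ne hij) (succ_succ_ne hik),
      Equiv.swap_apply_of_ne_of_ne (succ_succ_ne_zero i) (succ_succ_ne_one i)]
  obtain ⟨X, hX, hX3, hγX⟩ : ∃ X, π X = tri i ∧ X ^ 3 = 1 ∧ c γ X = X⁻¹ := by
    -- Since `γ` inverts `tri i`, `t` is central. Both `X₀` and its conjugate have trivial cube, so
    -- `t ^ 3 = 1`, and then `t * X₀` is inverted by `γ` because `t ^ 2 = t⁻¹`.
    obtain ⟨t, ht⟩ : ∃ t, t = c γ X₀ * X₀ := ⟨_, rfl⟩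
    have hπt : π t = 1 := by
      rw [ht, map_mul, proj_conjAct, hX₀, conj_tri' hγ0 hγ1 hγi, inv_mul_cancel]
    have htc : ∀ e, Commute t e := hc t hπt
    have h1 : c γ X₀ = t * X₀⁻¹ := by rw [ht, mul_inv_cancel_right]
    have ht3 : t ^ 3 = 1 := by
      have h2 : (t * X₀⁻¹) ^ 3 = 1 := by rw [← h1, ← map_pow, hX₀3, map_one]
      rwa [(htc _).mul_pow, inv_pow, hX₀3, inv_one, mul_one] at h2
    refine ⟨t * X₀, by rw [map_mul, hπt, one_mul, hX₀], ?_, ?_⟩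
    · rw [(htc _).mul_pow, ht3, hX₀3, one_mul]
    · rw [map_mul, conjAct_of_proj_eq_one _ _ _ hπt, h1, eq_inv_iff_mul_eq_one]
      calc t * (t * X₀⁻¹) * (t * X₀) = t * (t * (X₀⁻¹ * t) * X₀) := by group
        _ = t * (t * (t * X₀⁻¹) * X₀) := by rw [(htc X₀⁻¹).eq]
        _ = t ^ 3 := by rw [pow_three']; group
        _ = 1 := ht3
  have hg : ∀ l : Fin m, ∃ g : alternatingGroup (Fin (m + 2)), g.1 0 = 0 ∧ g.1 1 = 1 ∧
      g.1 i.succ.succ = l.succ.succ := fun l => by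
    by_cases h : i = l
    · exact ⟨1, rfl, rfl, by rw [h]; rfl⟩
    · refine ⟨swapSwap i.succ.succ l.succ.succ j.succ.succ k.succ.succ (succ_succ_ne h)
        (succ_succ_ne hjk), ?_, ?_, ?_⟩
      · rw [swapSwap_apply, Equiv.swap_apply_of_ne_of_ne, Equiv.swap_apply_of_ne_of_ne] <;>
          exact (succ_succ_ne_zero _).symm
      · rw [swapSwap_apply, Equiv.swap_apply_of_ne_of_ne, Equiv.swap_apply_of_ne_of_ne] <;>
          exact (succ_succ_ne_one _).symm
      · rw [swapSwap_apply, Equiv.swap_apply_of_ne_of_ne (succ_succ_ne hij) (succ_succ_ne hik),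
          Equiv.swap_apply_left]
  choose g hg0 hg1 hg2 using hg
  have hinv : ∀ (u : alternatingGroup (Fin (m + 2))) {a b}, u.1 a = b → (u⁻¹).1 b = a :=
    fun u a b h => by
      change u.1⁻¹ b = a
      rw [← h]
      exact u.1.symm_apply_apply a
  have hF : ∀ (u : alternatingGroup (Fin (m + 2))) (p q : Fin m), u.1 0 = 0 → u.1 1 = 1 →
      u.1 p.succ.succ = q.succ.succ → c u (c (g p) X) = c (g q) X := fun u p q h0 h1 h2 => by
    have h := hK ((g q)⁻¹ * (u * g p)) X
      (show (g q)⁻¹.1 (u.1 ((g p).1 0)) = 0 by rw [hg0, h0, hinv _ (hg0 q)])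
      (show (g q)⁻¹.1 (u.1 ((g p).1 1)) = 1 by rw [hg1, h1, hinv _ (hg1 q)])
      (show (g q)⁻¹.1 (u.1 ((g p).1 _)) = _ by rw [hg2, h2, hinv _ (hg2 q)]) hX
    rw [map_mul, map_mul, MulAut.mul_apply, MulAut.mul_apply, map_inv] at h
    exact (MulEquiv.symm_apply_eq _).1 h
  have hF' : ∀ (u : alternatingGroup (Fin (m + 2))) (p q : Fin m), u.1 0 = 1 → u.1 1 = 0 →
      u.1 p.succ.succ = q.succ.succ → c u (c (g p) X) = (c (g q) X)⁻¹ := fun u p q h0 h1 h2 => by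
    have h := hK ((g q)⁻¹ * (u * (g p * γ))) X
      (show (g q)⁻¹.1 (u.1 ((g p).1 (γ.1 0))) = 0 by rw [hγ0, hg1, h1, hinv _ (hg0 q)])
      (show (g q)⁻¹.1 (u.1 ((g p).1 (γ.1 1))) = 1 by rw [hγ1, hg0, h0, hinv _ (hg1 q)])
      (show (g q)⁻¹.1 (u.1 ((g p).1 (γ.1 _))) = _ by rw [hγi, hg2, h2, hinv _ (hg2 q)]) hX
    rw [map_mul, map_mul, map_mul, MulAut.mul_apply, MulAut.mul_apply, MulAut.mul_apply,
      map_inv, hγX, map_inv, map_inv] at h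
    rw [← (MulEquiv.symm_apply_eq _).1 h, inv_inv]
  have hπX : ∀ l, π (c (g l) X) = tri l := fun l => by
    rw [proj_conjAct, hX, conj_tri (hg0 l) (hg1 l) (hg2 l)]
  have hX3' : ∀ l, c (g l) X ^ 3 = 1 := fun l => by rw [← map_pow, hX3, map_one]
  set W : Fin m → E := fun l => c (g l) X with hW
  -- This central element is killed by three, by the identity of sixth powers. It also equals its
  -- inverse, because `(0 1)(i j)` sends `W i * W j` to its inverse.
  have hz : (W i * W j) ^ 2 = 1 := by
    set z := (W i * W j) ^ 2 with hzdef
    have hπz : π z = 1 := by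
      rw [map_pow, map_mul, hπX, hπX]
      exact (isCarmichael_tri m).mul_sq i j hij
    have hz3 : z ^ 3 = 1 := by
      rw [hzdef, ← pow_mul, hζ _ _ (hπX i) (hπX j), show 6 = 3 * 2 from rfl, pow_mul, pow_mul,
        hX3', hX3']
      simp
    let h : alternatingGroup (Fin (m + 2)) :=
      swapSwap 0 1 i.succ.succ j.succ.succ zero_ne_one_fin (succ_succ_ne hij)
    have h0 : h.1 0 = 1 := by
      rw [swapSwap_apply, Equiv.swap_apply_of_ne_of_ne (succ_succ_ne_zero i).symm
        (succ_succ_ne_zero j).symm, Equiv.swap_apply_left]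
    have h1 : h.1 1 = 0 := by
      rw [swapSwap_apply, Equiv.swap_apply_of_ne_of_ne (succ_succ_ne_one i).symm
        (succ_succ_ne_one j).symm, Equiv.swap_apply_right]
    have hi : h.1 i.succ.succ = j.succ.succ := by
      rw [swapSwap_apply, Equiv.swap_apply_left,
        Equiv.swap_apply_of_ne_of_ne (succ_succ_ne_zero j) (succ_succ_ne_one j)]
    have hj : h.1 j.succ.succ = i.succ.succ := by
      rw [swapSwap_apply, Equiv.swap_apply_right,
        Equiv.swap_apply_of_ne_of_ne (succ_succ_ne_zero i) (succ_succ_ne_one i)]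
    have h2 : c h z = z⁻¹ := by
      rw [hzdef, map_pow, map_mul, hF' h i j h0 h1 hi, hF' h j i h0 h1 hj, ← mul_inv_rev, inv_pow]
    rw [conjAct_of_proj_eq_one _ _ _ hπz, eq_inv_iff_mul_eq_one] at h2
    calc z = z ^ 3 * (z * z)⁻¹ := by group
      _ = 1 := by rw [hz3, h2, inv_one, one_mul]
  have hswap : ∀ {a b : E}, (a * b) ^ 2 = 1 → (b * a) ^ 2 = 1 := fun {a b} h => by
    calc (b * a) ^ 2 = a⁻¹ * (a * b) ^ 2 * a := by rw [sq, sq]; group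
      _ = 1 := by rw [h]; group
  refine IsCarmichael.exists_section (X := W) ⟨hX3', fun p q hpq => ?_⟩ hπX
  -- The permutation `τ` fixes `0` and `1` and carries `i`, `j` to `p`, `q`. If it is odd, it is
  -- composed with `(0 1)`, which inverts the lifts.
  let σ : Equiv.Perm (Fin (m + 2)) := Equiv.swap i.succ.succ p.succ.succ
  let τ : Equiv.Perm (Fin (m + 2)) := Equiv.swap (σ j.succ.succ) q.succ.succ * σ
  have hσj : ∃ l : Fin m, σ j.succ.succ = l.succ.succ ∧ l ≠ p := by
    by_cases h : j = p
    · exact ⟨i, by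
        change Equiv.swap _ p.succ.succ j.succ.succ = _
        rw [h, Equiv.swap_apply_right], by rwa [← h]⟩
    · exact ⟨j, Equiv.swap_apply_of_ne_of_ne (succ_succ_ne hij.symm) (succ_succ_ne h), h⟩
  obtain ⟨l, hl, hlp⟩ := hσj
  have hτ0 : τ 0 = 0 := by
    change Equiv.swap (σ j.succ.succ) q.succ.succ (Equiv.swap _ _ 0) = 0
    rw [hl, Equiv.swap_apply_of_ne_of_ne, Equiv.swap_apply_of_ne_of_ne] <;>
      exact (succ_succ_ne_zero _).symm
  have hτ1 : τ 1 = 1 := by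
    change Equiv.swap (σ j.succ.succ) q.succ.succ (Equiv.swap _ _ 1) = 1
    rw [hl, Equiv.swap_apply_of_ne_of_ne, Equiv.swap_apply_of_ne_of_ne] <;>
      exact (succ_succ_ne_one _).symm
  have hτi : τ i.succ.succ = p.succ.succ := by
    change Equiv.swap (σ j.succ.succ) q.succ.succ (Equiv.swap _ _ _) = _
    rw [hl, Equiv.swap_apply_left,
      Equiv.swap_apply_of_ne_of_ne (succ_succ_ne hlp.symm) (succ_succ_ne hpq)]
  have hτj : τ j.succ.succ = q.succ.succ := Equiv.swap_apply_left _ _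
  by_cases hs : Equiv.Perm.sign τ = 1
  · change (c (g p) X * c (g q) X) ^ 2 = 1
    rw [← hF ⟨τ, hs⟩ i p hτ0 hτ1 hτi, ← hF ⟨τ, hs⟩ j q hτ0 hτ1 hτj, ← map_mul, ← map_pow]
    change c _ ((W i * W j) ^ 2) = 1
    rw [hz, map_one]
  · have hs' : τ * Equiv.swap 0 1 ∈ alternatingGroup (Fin (m + 2)) := by
      rw [Equiv.Perm.mem_alternatingGroup, Equiv.Perm.sign_mul,
        Equiv.Perm.sign_swap zero_ne_one_fin, (Int.units_eq_one_or _).resolve_left hs]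
      rfl
    have hs0 : (τ * Equiv.swap 0 1 : Equiv.Perm (Fin (m + 2))) 0 = 1 := by
      rw [Equiv.Perm.mul_apply, Equiv.swap_apply_left, hτ1]
    have hs1 : (τ * Equiv.swap 0 1 : Equiv.Perm (Fin (m + 2))) 1 = 0 := by
      rw [Equiv.Perm.mul_apply, Equiv.swap_apply_right, hτ0]
    have hsi : (τ * Equiv.swap 0 1 : Equiv.Perm (Fin (m + 2))) i.succ.succ = p.succ.succ := by
      rw [Equiv.Perm.mul_apply,
        Equiv.swap_apply_of_ne_of_ne (succ_succ_ne_zero i) (succ_succ_ne_one i), hτi]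
    have hsj : (τ * Equiv.swap 0 1 : Equiv.Perm (Fin (m + 2))) j.succ.succ = q.succ.succ := by
      rw [Equiv.Perm.mul_apply,
        Equiv.swap_apply_of_ne_of_ne (succ_succ_ne_zero j) (succ_succ_ne_one j), hτj]
    refine hswap (inv_eq_one.1 ?_)
    rw [← inv_pow, mul_inv_rev]
    change ((c (g p) X)⁻¹ * (c (g q) X)⁻¹) ^ 2 = 1
    rw [← hF' ⟨_, hs'⟩ i p hs0 hs1 hsi, ← hF' ⟨_, hs'⟩ j q hs0 hs1 hsj, ← map_mul, ← map_pow]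
    change c _ ((W i * W j) ^ 2) = 1
    rw [hz, map_one]

end LargeDegree

/-! ### Abelian quotients of alternating groups and centralizers of three-cycles. -/

section Centralizer

/-- A homomorphism from an alternating group to a commutative group is trivial in degree at least
five, and if it kills a three-cycle. -/
lemma hom_alternatingGroup_eq_one {α : Type} [Fintype α] [DecidableEq α] {M : Type*} [CommGroup M]
    (κ : alternatingGroup α →* M) (h : Nat.card α ≤ 2 ∨ 5 ≤ Nat.card α ∨
      ∃ y : alternatingGroup α, y.1.IsThreeCycle ∧ κ y = 1) : κ = 1 := by
  rcases h with h | h | ⟨y, hy, hκ⟩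
  · have h1 := alternatingGroup.eq_bot_of_card_le_two h
    refine MonoidHom.ext fun g => ?_
    have h2 : g = 1 := Subtype.ext (Subgroup.mem_bot.1 (h1.le g.2))
    rw [h2, map_one, map_one]
  · refine MonoidHom.ext fun g => ?_
    have h1 : g ∈ commutator (alternatingGroup α) := by
      rw [commutator_alternatingGroup_eq_top h]
      trivial
    exact Abelianization.commutator_subset_ker κ h1
  · refine MonoidHom.eq_of_eqOn_dense alternatingGroup.closure_isThreeCycles_eq_top ?_
    intro c hc
    have hconj : ∀ (z : alternatingGroup α) (τ : Equiv.Perm α), κ z = 1 →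
        Equiv.Perm.sign τ = 1 → τ * z.1 * τ⁻¹ = c.1 → κ c = 1 := fun z τ hz hτ h => by
      have : c = ⟨τ, hτ⟩ * z * ⟨τ, hτ⟩⁻¹ := Subtype.ext h.symm
      rw [this, map_mul, map_mul, hz, mul_one, ← map_mul, mul_inv_cancel, map_one]
    obtain ⟨τ, hτ⟩ := isConj_iff.1 (Equiv.Perm.isConj_iff_cycleType_eq.2
      (hy.cycleType.trans (show c.1.IsThreeCycle from hc).cycleType.symm))
    change κ c = 1
    -- An odd conjugating permutation is made even by a transposition of two letters of the cycle
    -- `y`, at the cost of inverting `y`.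
    by_cases hs : Equiv.Perm.sign τ = 1
    · exact hconj y τ hκ hs hτ
    · obtain ⟨a, ha⟩ : ∃ a, a ∈ y.1.support := by
        rw [← Finset.Nonempty, ← Finset.card_pos, hy.card_support]
        norm_num
      have h1 := hy.eq_swap_mul_swap_iff_mem_support.2 ha
      have h2 := hy.nodup_iff_mem_support.2 ha
      set b := y.1 a
      set d := y.1 b
      have hab : a ≠ b := by simp at h2; tauto
      have had : a ≠ d := by simp at h2; tauto
      have hbd : b ≠ d := by simp at h2; tauto
      refine hconj y⁻¹ (τ * Equiv.swap a b) (by rw [map_inv, hκ, inv_one]) ?_ ?_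
      · rw [Equiv.Perm.sign_mul, Equiv.Perm.sign_swap hab, (Int.units_eq_one_or _).resolve_left hs]
        rfl
      · rw [← hτ, mul_inv_rev, Equiv.swap_inv]
        have h3 : Equiv.swap a b * y.1⁻¹ * Equiv.swap a b = y.1 := by
          have h4 : Equiv.swap a b * Equiv.swap b d = Equiv.swap a d * Equiv.swap a b := by
            rw [Equiv.mul_swap_eq_swap_mul, Equiv.swap_apply_right,
              Equiv.swap_apply_of_ne_of_ne had.symm hbd.symm]
          rw [h1, mul_inv_rev, Equiv.swap_inv, Equiv.swap_inv, mul_assoc, mul_assoc,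
            Equiv.swap_mul_self, mul_one]
        calc τ * Equiv.swap a b * y.1⁻¹ * (Equiv.swap a b * τ⁻¹)
            = τ * (Equiv.swap a b * y.1⁻¹ * Equiv.swap a b) * τ⁻¹ := by group
          _ = _ := by rw [h3]

variable {m : ℕ} {E : Type} [Group E] {π : E →* alternatingGroup (Fin (m + 2))}
  (hπ : Function.Surjective π) (hc : ∀ z, π z = 1 → ∀ e, z * e = e * z)

/-- The obstruction to the equivariance of a lift of a permutation. -/
def conjDefect (s : Finset (Fin (m + 2))) {X : E}
    (hX : ∀ g : alternatingGroup s, Commute (alternatingGroup.ofSubtype s g) (π X)) :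
    alternatingGroup s →* Subgroup.center E :=
  have hker : ∀ g, π (conjAct hπ hc (alternatingGroup.ofSubtype s g) X * X⁻¹) = 1 := fun g => by
    rw [map_mul, map_inv, proj_conjAct, (hX g).eq, mul_inv_cancel_right, mul_inv_cancel]
  MonoidHom.mk' (fun g => ⟨conjAct hπ hc (alternatingGroup.ofSubtype s g) X * X⁻¹,
    Subgroup.mem_center_iff.2 fun e => (hc _ (hker g) e).symm⟩) fun g h => by
      refine Subtype.ext ?_
      change conjAct hπ hc (alternatingGroup.ofSubtype s (g * h)) X * X⁻¹ =
        conjAct hπ hc (alternatingGroup.ofSubtype s g) X * X⁻¹ *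
          (conjAct hπ hc (alternatingGroup.ofSubtype s h) X * X⁻¹)
      rw [← hc _ (hker h), map_mul, map_mul, MulAut.mul_apply]
      conv_lhs => rw [← inv_mul_cancel_right (conjAct hπ hc (alternatingGroup.ofSubtype s h) X) X]
      rw [map_mul, conjAct_of_proj_eq_one _ _ _ (hker h), mul_assoc]

/-- Permutations fixing `0`, `1` and the letter of `i` commute with `tri i`, so conjugation changes
`X` by a homomorphism from an alternating group on `m - 1` letters to the centre. That group is
trivial for `m = 3` and perfect for `m ≥ 6`; otherwise it is enough that a single three-cycle be
killed. -/
theorem conjAct_eq_self (i : Fin m) (h : m = 3 ∨ 6 ≤ m ∨ ∃ a b c : Fin m, a ≠ b ∧ a ≠ c ∧ b ≠ c ∧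
      i ≠ a ∧ i ≠ b ∧ i ≠ c ∧ ∀ X Y, π X = tri i →
      (π Y).1 = Equiv.swap a.succ.succ b.succ.succ * Equiv.swap a.succ.succ c.succ.succ →
      X * Y = Y * X)
    (g : alternatingGroup (Fin (m + 2))) (X : E) (hg0 : g.1 0 = 0) (hg1 : g.1 1 = 1)
    (hgi : g.1 i.succ.succ = i.succ.succ) (hX : π X = tri i) : conjAct hπ hc g X = X := by
  let s : Finset (Fin (m + 2)) := {0, 1, i.succ.succ}ᶜ
  have hs : Nat.card s = m - 1 := by
    rw [Nat.card_eq_fintype_card, Fintype.card_coe, Finset.card_compl, Fintype.card_fin,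
      Finset.card_eq_three.2 ⟨0, 1, i.succ.succ, zero_ne_one_fin, (succ_succ_ne_zero i).symm,
        (succ_succ_ne_one i).symm, rfl⟩]
    omega
  have hfix : ∀ (k : alternatingGroup s) (p : Fin (m + 2)), p = 0 ∨ p = 1 ∨ p = i.succ.succ →
      (alternatingGroup.ofSubtype s k).1 p = p := fun k p hp =>
    Equiv.Perm.ofSubtype_apply_of_not_mem _ (by simp only [s, Finset.mem_compl, Finset.mem_insert, Finset.mem_singleton]; tauto)
  have hcomm : ∀ k : alternatingGroup s, Commute (alternatingGroup.ofSubtype s k) (π X) :=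
    fun k => by
      have := conj_tri (hfix k 0 (.inl rfl)) (hfix k 1 (.inr (.inl rfl)))
        (hfix k _ (.inr (.inr rfl)))
      rw [hX]
      exact mul_inv_eq_iff_eq_mul.1 this
  have hκ : conjDefect hπ hc s hcomm = 1 := by
    let _ : CommGroup (Subgroup.center E) :=
      { (inferInstance : Group (Subgroup.center E)) with
        mul_comm := fun a b => Subtype.ext (Subgroup.mem_center_iff.1 b.2 a.1) }
    refine hom_alternatingGroup_eq_one (M := Subgroup.center E) (conjDefect hπ hc s hcomm) ?_
    rw [hs]
    rcases h with h | h | ⟨a, b, c, hab, hac, hbc, hia, hib, hic, h⟩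
    · exact .inl (by omega)
    · exact .inr (.inl (by omega))
    · have hmem : ∀ {p : Fin m}, i ≠ p → p.succ.succ ∈ s := fun {p} hp => by
        simp only [s, Finset.mem_compl, Finset.mem_insert, Finset.mem_singleton, not_or]
        exact ⟨succ_succ_ne_zero p, succ_succ_ne_one p, succ_succ_ne hp.symm⟩
      have hne : ∀ {p q : Fin m} (hp : i ≠ p) (hq : i ≠ q), p ≠ q →
          (⟨_, hmem hp⟩ : s) ≠ ⟨_, hmem hq⟩ :=
        fun hp hq hpq e => succ_succ_ne hpq (congrArg Subtype.val e)
      have h3 := Equiv.Perm.isThreeCycle_swap_mul_swap_same (hne hia hib hab) (hne hia hic hac)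
        (hne hib hic hbc)
      refine .inr (.inr ⟨⟨_, h3.mem_alternatingGroup⟩, h3, Subtype.ext ?_⟩)
      change conjAct hπ hc (alternatingGroup.ofSubtype s _) X * X⁻¹ = 1
      obtain ⟨Y, hY⟩ := hπ (alternatingGroup.ofSubtype s ⟨_, h3.mem_alternatingGroup⟩)
      rw [← hY, conjAct_proj, ← h X Y hX, mul_inv_cancel_right, mul_inv_cancel]
      rw [hY, alternatingGroup.coe_ofSubtype, map_mul, Equiv.Perm.ofSubtype_swap_eq,
        Equiv.Perm.ofSubtype_swap_eq]
  obtain ⟨k, rfl⟩ := (alternatingGroup.mem_range_ofSubtype_iff s g).2 fun p hp => by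
    simp only [s, Finset.mem_compl, Finset.mem_insert, Finset.mem_singleton]
    rintro (rfl | rfl | rfl)
    · exact Equiv.Perm.mem_support.1 hp hg0
    · exact Equiv.Perm.mem_support.1 hp hg1
    · exact Equiv.Perm.mem_support.1 hp hgi
  have := congrArg Subtype.val (DFunLike.congr_fun hκ k)
  exact mul_inv_eq_one.1 this

end Centralizer

/-! ### Two-cocycles with trivial action and central extensions -/

section TwoCocycles

variable (G T : Type) [Group G] [AddCommGroup T]

/-- The two-cocycles of a group with values in a group with trivial action. -/
def twoCocycles : AddSubgroup (G → G → T) where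
  carrier := {f | ∀ g h j, f (g * h) j + f g h = f h j + f g (h * j)}
  zero_mem' := fun _ _ _ => rfl
  add_mem' {a b} ha hb g h j := by
    change a (g * h) j + b (g * h) j + (a g h + b g h) = a h j + b h j + (a g (h * j) + b g (h * j))
    rw [add_add_add_comm, ha, hb, add_add_add_comm]
  neg_mem' {a} ha g h j := by
    change -a (g * h) j + -a g h = -a h j + -a g (h * j)
    rw [← neg_add, ha, neg_add]

variable {G T}

/-- The predicate of being a coboundary. -/
def IsCoboundary (f : G → G → T) : Prop := ∃ b : G → T, ∀ g h, f g h = b g + b h - b (g * h)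

variable (T) in
/-- The value on the cube of a lift of an element of order three. -/
def cubeDefect (x : G) : (G → G → T) →+ T where
  toFun f := f x x + f (x * x) x + f 1 1
  map_zero' := by simp
  map_add' a b := by simp only [Pi.add_apply]; abel

variable (T) in
/-- The value on the square of a lift of an element of order two. -/
def squareDefect (x : G) : (G → G → T) →+ T where
  toFun f := f x x + f 1 1
  map_zero' := by simp
  map_add' a b := by simp only [Pi.add_apply]; abel

variable (T) in
/-- The value on the commutator of lifts of two commuting elements. -/
def commDefect (x y : G) : (G → G → T) →+ T where
  toFun f := f x y - f y x
  map_zero' := by simp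
  map_add' a b := by simp only [Pi.add_apply]; abel

variable (T) in
/-- The value on `(X * Y) ^ 6 * X ^ (-6) * Y ^ (-6)`, for lifts `X` and `Y` of elements `x` and `y`
of order three with product of order two. -/
def spinDefect (x y : G) : (G → G → T) →+ T where
  toFun f := 3 • (2 • f x y + squareDefect T (x * y) f) -
    (2 • cubeDefect T x f + 2 • cubeDefect T y f)
  map_zero' := by simp
  map_add' a b := by simp only [map_add, Pi.add_apply, smul_add]; abel

lemma mul_mul_self_of_pow_three {x : G} (hx : x ^ 3 = 1) : x * x * x = 1 := by
  rw [← hx, pow_three']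

lemma cubeDefect_coboundary {f : G → G → T} {b : G → T}
    (hb : ∀ g h, f g h = b g + b h - b (g * h)) {x : G} (hx : x ^ 3 = 1) :
    cubeDefect T x f = 3 • b x := by
  change f x x + f (x * x) x + f 1 1 = _
  rw [hb, hb, hb, mul_mul_self_of_pow_three hx, mul_one]
  abel

lemma spinDefect_coboundary {f : G → G → T} (hf : IsCoboundary f) {x y : G} (hx : x ^ 3 = 1)
    (hy : y ^ 3 = 1) (hxy : (x * y) ^ 2 = 1) : spinDefect T x y f = 0 := by
  obtain ⟨b, hb⟩ := hf
  change 3 • (2 • f x y + (f (x * y) (x * y) + f 1 1)) -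
    (2 • cubeDefect T x f + 2 • cubeDefect T y f) = 0
  rw [cubeDefect_coboundary hb hx, cubeDefect_coboundary hb hy, hb, hb, hb, ← sq, hxy, mul_one]
  abel

lemma commDefect_coboundary {f : G → G → T} (hf : IsCoboundary f) {x y : G}
    (hxy : x * y = y * x) : commDefect T x y f = 0 := by
  obtain ⟨b, hb⟩ := hf
  change f x y - f y x = 0
  rw [hb, hb, hxy]
  abel

/-- The central extension attached to a two-cocycle. -/
@[ext]
structure CocycleExt (f : twoCocycles G T) where
  /-- The component in the coefficients. -/
  fst : T
  /-- The component in the group. -/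
  snd : G

namespace CocycleExt

variable (f : twoCocycles G T)

lemma apply_one_left (g : G) : f.1 1 g = f.1 1 1 := by
  have := f.2 1 1 g
  rw [one_mul, one_mul] at this
  exact (add_left_cancel this).symm

lemma apply_one_right (g : G) : f.1 g 1 = f.1 1 1 := by
  have := f.2 g 1 1
  rw [mul_one, mul_one] at this
  exact add_right_cancel this

instance : Mul (CocycleExt f) := ⟨fun X Y => ⟨X.fst + Y.fst + f.1 X.snd Y.snd, X.snd * Y.snd⟩⟩
instance : One (CocycleExt f) := ⟨⟨-f.1 1 1, 1⟩⟩
instance : Inv (CocycleExt f) := ⟨fun X => ⟨-X.fst - f.1 X.snd⁻¹ X.snd - f.1 1 1, X.snd⁻¹⟩⟩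

lemma mul_def (X Y : CocycleExt f) :
    X * Y = ⟨X.fst + Y.fst + f.1 X.snd Y.snd, X.snd * Y.snd⟩ := rfl

lemma one_def : (1 : CocycleExt f) = ⟨-f.1 1 1, 1⟩ := rfl

lemma inv_def (X : CocycleExt f) : X⁻¹ = ⟨-X.fst - f.1 X.snd⁻¹ X.snd - f.1 1 1, X.snd⁻¹⟩ := rfl

instance : Group (CocycleExt f) := Group.ofLeftAxioms
  (fun X Y Z => by
    rw [mul_def, mul_def, mul_def, mul_def]
    refine CocycleExt.ext ?_ (mul_assoc _ _ _)
    have := f.2 X.snd Y.snd Z.snd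
    dsimp only
    rw [show X.fst + Y.fst + f.1 X.snd Y.snd + Z.fst + f.1 (X.snd * Y.snd) Z.snd =
      X.fst + Y.fst + Z.fst + (f.1 (X.snd * Y.snd) Z.snd + f.1 X.snd Y.snd) by abel, this]
    abel)
  (fun X => by
    rw [mul_def, one_def]
    refine CocycleExt.ext ?_ (one_mul _)
    dsimp only
    rw [apply_one_left f X.snd]
    abel)
  (fun X => by
    rw [mul_def, one_def, inv_def]
    refine CocycleExt.ext ?_ (inv_mul_cancel _)
    dsimp only
    abel)

/-- The projection of the central extension. -/
def proj : CocycleExt f →* G where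
  toFun := snd
  map_one' := rfl
  map_mul' _ _ := rfl

lemma proj_surjective : Function.Surjective (proj f) := fun g => ⟨⟨0, g⟩, rfl⟩

/-- The inclusion of the coefficients. -/
def inl : Multiplicative T →* CocycleExt f where
  toFun t := ⟨t.toAdd - f.1 1 1, 1⟩
  map_one' := by
    rw [one_def, toAdd_one, zero_sub]
  map_mul' s t := by
    rw [mul_def]
    refine CocycleExt.ext ?_ (mul_one _).symm
    dsimp only
    rw [toAdd_mul]
    abel

lemma inl_injective : Function.Injective (inl f) := fun _ _ h =>
  Multiplicative.toAdd.injective (sub_left_injective (congrArg CocycleExt.fst h))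

lemma exists_inl {z : CocycleExt f} (hz : proj f z = 1) :
    ∃ t : T, inl f (.ofAdd t) = z := by
  refine ⟨z.fst + f.1 1 1, CocycleExt.ext ?_ hz.symm⟩
  exact add_sub_cancel_right _ _

lemma central (z : CocycleExt f) (hz : proj f z = 1) (e : CocycleExt f) : z * e = e * z := by
  obtain ⟨t, a⟩ := z
  obtain rfl : a = 1 := hz
  rw [mul_def, mul_def]
  refine CocycleExt.ext ?_ ((one_mul _).trans (mul_one _).symm)
  dsimp only
  rw [apply_one_left f e.snd, apply_one_right f e.snd, add_comm t]

lemma exists_cube_root (hT : ∀ t : T, ∃ u, 3 • u = t) (z : CocycleExt f) (hz : proj f z = 1) :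
    ∃ w, proj f w = 1 ∧ w ^ 3 = z := by
  obtain ⟨t, rfl⟩ := exists_inl f hz
  obtain ⟨u, rfl⟩ := hT t
  exact ⟨inl f (.ofAdd u), rfl, by rw [← map_pow, ofAdd_nsmul]⟩

lemma pow_three_eq {X : CocycleExt f} (hX : proj f X ^ 3 = 1) :
    X ^ 3 = inl f (.ofAdd (3 • X.fst + cubeDefect T (proj f X) f.1)) := by
  rw [pow_three', mul_def, mul_def]
  refine CocycleExt.ext ?_ (mul_mul_self_of_pow_three hX)
  change _ = 3 • X.fst + (f.1 X.snd X.snd + f.1 (X.snd * X.snd) X.snd + f.1 1 1) - f.1 1 1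
  dsimp only
  abel

lemma mul_sq_eq {X Y : CocycleExt f} (h : (proj f X * proj f Y) ^ 2 = 1) :
    (X * Y) ^ 2 = inl f (.ofAdd (2 • X.fst + 2 • Y.fst + (2 • f.1 (proj f X) (proj f Y) +
      squareDefect T (proj f X * proj f Y) f.1))) := by
  rw [sq, mul_def, mul_def]
  refine CocycleExt.ext ?_ (by rw [sq] at h; exact h)
  change _ = 2 • X.fst + 2 • Y.fst + (2 • f.1 X.snd Y.snd +
    (f.1 (X.snd * Y.snd) (X.snd * Y.snd) + f.1 1 1)) - f.1 1 1
  dsimp only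
  abel

lemma mul_pow_six_eq {X Y : CocycleExt f} {x y : G} (hX : proj f X = x) (hY : proj f Y = y)
    (hx : x ^ 3 = 1) (hy : y ^ 3 = 1) (hxy : (x * y) ^ 2 = 1) :
    (X * Y) ^ 6 = inl f (.ofAdd (spinDefect T x y f.1)) * (X ^ 6 * Y ^ 6) := by
  subst hX hY
  rw [show 6 = 2 * 3 from rfl, pow_mul, mul_sq_eq f hxy, show 2 * 3 = 3 * 2 from rfl, pow_mul,
    pow_mul Y, pow_three_eq f hx, pow_three_eq f hy, ← map_pow (inl f), ← map_pow (inl f), ← map_pow (inl f),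
    ← map_mul (inl f), ← map_mul (inl f), ← ofAdd_nsmul, ← ofAdd_nsmul, ← ofAdd_nsmul, ← ofAdd_add, ← ofAdd_add]
  refine congrArg (fun t => inl f (.ofAdd t)) ?_
  change _ = 3 • (2 • f.1 (proj f X) (proj f Y) + squareDefect T (proj f X * proj f Y) f.1) -
    (2 • cubeDefect T (proj f X) f.1 + 2 • cubeDefect T (proj f Y) f.1) + _
  abel

lemma mul_eq_mul {X Y : CocycleExt f} {x y : G} (hX : proj f X = x) (hY : proj f Y = y)
    (hxy : x * y = y * x) : X * Y = inl f (.ofAdd (commDefect T x y f.1)) * (Y * X) := by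
  subst hX hY
  rw [mul_def, mul_def, mul_def]
  refine CocycleExt.ext ?_ (hxy.trans (one_mul _).symm)
  change X.fst + Y.fst + f.1 X.snd Y.snd =
    (f.1 X.snd Y.snd - f.1 Y.snd X.snd - f.1 1 1) + (Y.fst + X.fst + f.1 Y.snd X.snd) +
      f.1 1 (Y.snd * X.snd)
  rw [apply_one_left f (Y.snd * X.snd)]
  abel

lemma isCoboundary_of_section (s : G →* CocycleExt f) (hs : ∀ g, proj f (s g) = g) :
    IsCoboundary f.1 := by
  refine ⟨fun g => -(s g).fst, fun g h => ?_⟩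
  have := congrArg CocycleExt.fst (map_mul s g h)
  rw [mul_def] at this
  have h1 : (s g).snd = g := hs g
  have h2 : (s h).snd = h := hs h
  dsimp only at this
  rw [h1, h2] at this
  change f.1 g h = -(s g).fst + -(s h).fst - -(s (g * h)).fst
  rw [this]
  abel

end CocycleExt

open CocycleExt

/-- For lifts of trivial cube the defect is `(X * Y) ^ 6`, the cube of the central element `(X * Y)
^ 2`; its square is trivial by `pow_six_eq_one`. -/
lemma two_nsmul_spinDefect (hT : ∀ t : T, ∃ u, 3 • u = t) (f : twoCocycles G T) {x y : G}
    (hx : x ^ 3 = 1) (hy : y ^ 3 = 1) (hxy : (x * y) ^ 2 = 1) : 2 • spinDefect T x y f.1 = 0 := by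
  have hroot : ∀ x : G, x ^ 3 = 1 → ∃ X, proj f X = x ∧ X ^ 3 = 1 := fun x hx => by
    obtain ⟨u, hu⟩ := hT (-cubeDefect T x f.1)
    refine ⟨⟨u, x⟩, rfl, ?_⟩
    rw [pow_three_eq f hx, hu]
    change inl f (.ofAdd (-cubeDefect T x f.1 + cubeDefect T x f.1)) = 1
    rw [neg_add_cancel, ofAdd_zero, map_one]
  obtain ⟨X, hX, hX3⟩ := hroot x hx
  obtain ⟨Y, hY, hY3⟩ := hroot y hy
  have h6 := mul_pow_six_eq f hX hY hx hy hxy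
  rw [show 6 = 3 * 2 from rfl, pow_mul X, pow_mul Y, hX3, hY3, one_pow, one_mul, mul_one] at h6
  have hz := pow_six_eq_one hX3 hY3 rfl (central f _ (by rw [map_pow, map_mul, hX, hY, hxy]))
  rw [← Multiplicative.ofAdd.injective.eq_iff, ← (inl_injective f).eq_iff, ofAdd_nsmul, map_pow,
    ← h6, ofAdd_zero, map_one, ← hz, ← pow_mul, ← pow_mul]

/-- If `X * Y * X⁻¹ = z * Y` with `z` central, cubing gives `z ^ 3 = 1`, because `Y ^ 3` is central.
-/
lemma three_nsmul_commDefect (f : twoCocycles G T) {x y : G} (hy : y ^ 3 = 1)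
    (hxy : x * y = y * x) : 3 • commDefect T x y f.1 = 0 := by
  let X : CocycleExt f := ⟨0, x⟩
  let Y : CocycleExt f := ⟨0, y⟩
  have h : X * Y = inl f (.ofAdd (commDefect T x y f.1)) * (Y * X) := mul_eq_mul f rfl rfl hxy
  set z := inl f (.ofAdd (commDefect T x y f.1)) with hz
  have hzc : ∀ e, Commute z e := central f z rfl
  have hY : Commute (Y ^ 3) X := central f (Y ^ 3) (by rw [map_pow]; exact hy) X
  have h1 : X * Y * X⁻¹ = z * Y := by rw [h]; group
  have h2 : (X * Y * X⁻¹) ^ 3 = Y ^ 3 := by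
    rw [conj_pow, ← hY.eq, mul_inv_cancel_right]
  rw [h1, (hzc Y).mul_pow, mul_eq_right] at h2
  rw [← Multiplicative.ofAdd.injective.eq_iff, ← (inl_injective f).eq_iff, ofAdd_nsmul, map_pow,
    ← hz, h2, ofAdd_zero, map_one]

theorem isCoboundary_three (hT : ∀ t : T, ∃ u, 3 • u = t)
    (f : twoCocycles (alternatingGroup (Fin (1 + 2))) T) : IsCoboundary f.1 := by
  obtain ⟨s, hs⟩ := exists_section_three (proj_surjective f) (central f) (exists_cube_root f hT)
  exact isCoboundary_of_section f s hs

theorem isCoboundary_four (hT : ∀ t : T, ∃ u, 3 • u = t)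
    (f : twoCocycles (alternatingGroup (Fin (2 + 2))) T)
    (hf : spinDefect T (tri 0) (tri 1) f.1 = 0) : IsCoboundary f.1 := by
  have hX := isCarmichael_tri 2
  obtain ⟨s, hs⟩ := exists_section_four (proj_surjective f) (central f) (exists_cube_root f hT)
    fun X Y h1 h2 => by
      rw [mul_pow_six_eq f h1 h2 (hX.pow_three 0) (hX.pow_three 1) (hX.mul_sq 0 1 (by decide)), hf,
        ofAdd_zero, map_one, one_mul]
  exact isCoboundary_of_section f s hs

/-- Vanishing of the spin defect is the identity of sixth powers, and vanishing of the commutator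
defect is the centralizer condition of `exists_section_of_centralizes`. The latter is automatic in
degree five and in degrees at least eight. -/
theorem isCoboundary_of_five_le (hT : ∀ t : T, ∃ u, 3 • u = t) {m : ℕ}
    (f : twoCocycles (alternatingGroup (Fin (m + 2))) T)
    {i j k : Fin m} (hij : i ≠ j) (hik : i ≠ k) (hjk : j ≠ k)
    (hf : spinDefect T (tri i) (tri j) f.1 = 0)
    (h : m = 3 ∨ 6 ≤ m ∨ ∃ (a b c : Fin m) (hab : a ≠ b) (hac : a ≠ c), b ≠ c ∧
      i ≠ a ∧ i ≠ b ∧ i ≠ c ∧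
      commDefect T (tri i) (swapSwap a.succ.succ b.succ.succ a.succ.succ c.succ.succ
        (succ_succ_ne hab) (succ_succ_ne hac)) f.1 = 0) : IsCoboundary f.1 := by
  have hX := isCarmichael_tri m
  obtain ⟨s, hs⟩ := exists_section_of_centralizes (proj_surjective f) (central f)
    (exists_cube_root f hT) hij hik hjk
    (fun X Y h1 h2 => by
      rw [mul_pow_six_eq f h1 h2 (hX.pow_three i) (hX.pow_three j) (hX.mul_sq i j hij), hf,
        ofAdd_zero, map_one, one_mul])
    (fun g X h0 h1 hi hX => by
      refine conjAct_eq_self (proj_surjective f) (central f) i ?_ g X h0 h1 hi hX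
      refine h.imp_right (Or.imp_right ?_)
      rintro ⟨a, b, c, hab, hac, hbc, hia, hib, hic, h⟩
      refine ⟨a, b, c, hab, hac, hbc, hia, hib, hic, fun X Y hX hY => ?_⟩
      rw [mul_eq_mul f hX (y := swapSwap a.succ.succ b.succ.succ a.succ.succ c.succ.succ
        (succ_succ_ne hab) (succ_succ_ne hac)) (Subtype.ext hY)
        (tri_mul_swapSwap hab hac hia hib hic), h, ofAdd_zero, map_one, one_mul])
  exact isCoboundary_of_section f s hs

end TwoCocycles

/-! ### Construction of two-cocycles from projective representations -/

section Projective

variable {U : Type} [Group U] {N : Subgroup U} {G : Type} [Group G] {T : Type} [AddCommGroup T]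

/-- A set-theoretic lift of a homomorphism to the quotient of `U` by a central subgroup `N`. -/
structure ProjectiveLift (G : Type) [Group G] {U : Type} [Group U] (N : Subgroup U) where
  /-- the lift -/
  lift : G → U
  /-- the failure of multiplicativity -/
  defect : G → G → N
  lift_mul : ∀ g h, lift g * lift h = defect g h * lift (g * h)
  central : ∀ z ∈ N, ∀ u : U, z * u = u * z

namespace ProjectiveLift

variable {s : ProjectiveLift G N}

variable (s) in
lemma lift_one : s.lift 1 = s.defect 1 1 := by
  have := s.lift_mul 1 1
  rw [one_mul] at this
  exact mul_right_cancel this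

/-- `u` represents `g` up to the central subgroup. -/
def Represents (g : G) (u : U) : Prop := ∃ z ∈ N, s.lift g = z * u

lemma Represents.mul {g h : G} {u v : U} (hu : s.Represents g u) (hv : s.Represents h v) :
    s.Represents (g * h) (u * v) := by
  obtain ⟨z, hz, hu⟩ := hu
  obtain ⟨y, hy, hv⟩ := hv
  refine ⟨(s.defect g h)⁻¹ * (z * y), N.mul_mem (N.inv_mem (s.defect g h).2) (N.mul_mem hz hy), ?_⟩
  rw [mul_assoc, Subgroup.coe_inv, eq_inv_mul_iff_mul_eq, ← s.lift_mul, hu, hv, mul_assoc, mul_assoc,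
    ← mul_assoc u, ← s.central y hy u, mul_assoc]

lemma Represents.inv {g : G} {u : U} (hu : s.Represents g u) : s.Represents g⁻¹ u⁻¹ := by
  obtain ⟨z, hz, hu⟩ := hu
  refine ⟨(s.defect g⁻¹ g : U) * s.defect 1 1 * z⁻¹,
    N.mul_mem (N.mul_mem (s.defect g⁻¹ g).2 (s.defect 1 1).2) (N.inv_mem hz), ?_⟩
  have h := s.lift_mul g⁻¹ g
  rw [inv_mul_cancel, lift_one, hu, s.central z hz] at h
  rw [← h]
  group

variable (s)

/-- The two-cocycle attached to a projective lift and a character. -/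
def cocycle (χ : N →* Multiplicative T) : twoCocycles G T :=
  ⟨fun g h => (χ (s.defect g h)).toAdd, fun g h j => by
    dsimp only
    rw [← toAdd_mul, ← toAdd_mul, ← map_mul, ← map_mul]
    refine congrArg (fun z => (χ z).toAdd) (Subtype.ext ?_)
    refine mul_right_cancel (b := s.lift (g * (h * j))) ?_
    change (s.defect (g * h) j : U) * s.defect g h * _ = s.defect h j * s.defect g (h * j) * _
    calc _ = (s.defect g h : U) * (s.defect (g * h) j * s.lift (g * h * j)) := by
          rw [s.central _ (s.defect (g * h) j).2, mul_assoc, mul_assoc g]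
      _ = s.lift g * s.lift h * s.lift j := by rw [← s.lift_mul, ← mul_assoc, ← s.lift_mul]
      _ = s.lift g * (s.defect h j * s.lift (h * j)) := by rw [mul_assoc, s.lift_mul h j]
      _ = s.defect h j * (s.lift g * s.lift (h * j)) := by
          rw [← mul_assoc, ← s.central _ (s.defect h j).2, mul_assoc]
      _ = _ := by rw [s.lift_mul, mul_assoc]⟩

lemma cube_eq {x : G} (hx : x ^ 3 = 1) :
    s.lift x ^ 3 = (s.defect x x * s.defect (x * x) x * s.defect 1 1 : N) := by
  rw [pow_three', s.lift_mul, mul_assoc, s.lift_mul, mul_mul_self_of_pow_three hx, lift_one,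
    ← mul_assoc]
  rfl

lemma square_eq {x y : G} (h : (x * y) ^ 2 = 1) : (s.lift x * s.lift y) ^ 2 =
    (s.defect x y ^ 2 * (s.defect (x * y) (x * y) * s.defect 1 1) : N) := by
  rw [sq] at h
  rw [s.lift_mul, (show Commute (s.defect x y : U) _ from s.central _ (s.defect x y).2 _).mul_pow,
    sq (s.lift (x * y)), s.lift_mul, h, lift_one]
  rfl

lemma spinDefect_eq (χ : N →* Multiplicative T) {x y : G} (hx : x ^ 3 = 1) (hy : y ^ 3 = 1)
    (hxy : (x * y) ^ 2 = 1) {w : N}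
    (hw : (s.lift x * s.lift y) ^ 6 = w * (s.lift x ^ 6 * s.lift y ^ 6)) :
    spinDefect T x y (s.cocycle χ).1 = (χ w).toAdd := by
  have h1 : (s.defect x y ^ 2 * (s.defect (x * y) (x * y) * s.defect 1 1)) ^ 3 =
      w * ((s.defect x x * s.defect (x * x) x * s.defect 1 1) ^ 2 *
        (s.defect y y * s.defect (y * y) y * s.defect 1 1) ^ 2) := by
    refine Subtype.ext ?_
    rw [Subgroup.coe_pow, ← s.square_eq hxy, Subgroup.coe_mul, Subgroup.coe_mul, Subgroup.coe_pow,
      ← s.cube_eq hx, Subgroup.coe_pow, ← s.cube_eq hy, ← pow_mul, ← pow_mul, ← pow_mul]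
    exact hw
  have h2 := congrArg (fun z => (χ z).toAdd) h1
  simp only [map_mul, map_pow, toAdd_mul, toAdd_pow] at h2
  exact sub_eq_iff_eq_add.2 h2

lemma commDefect_eq (χ : N →* Multiplicative T) {x y : G} (hxy : x * y = y * x) {w : N}
    (hw : s.lift x * s.lift y = w * (s.lift y * s.lift x)) :
    commDefect T x y (s.cocycle χ).1 = (χ w).toAdd := by
  have h1 : s.defect x y = w * s.defect y x := by
    refine Subtype.ext (mul_right_cancel (b := s.lift (x * y)) ?_)
    rw [← s.lift_mul, hw, s.lift_mul, ← hxy, ← mul_assoc]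
    rfl
  have h2 := congrArg (fun z => (χ z).toAdd) h1
  rw [map_mul, toAdd_mul] at h2
  exact sub_eq_iff_eq_add.2 h2

end ProjectiveLift

/-- A nontrivial element of a central subgroup is detected by a character. -/
lemma exists_character (hN : ∀ z ∈ N, ∀ u : U, z * u = u * z) {w : N} (hw : w ≠ 1) :
    ∃ χ : N →* Multiplicative (AddCircle (1 : ℚ)), (χ w).toAdd ≠ 0 := by
  let _ : CommGroup N :=
    { (inferInstance : Group N) with mul_comm := fun a b => Subtype.ext (hN _ a.2 _) }
  obtain ⟨c, hc⟩ := CharacterModule.exists_character_apply_ne_zero_of_ne_zero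
    (A := Additive N) (a := .ofMul w) fun h => hw (Additive.ofMul.injective h)
  exact ⟨AddMonoidHom.toMultiplicativeRight c, hc⟩

variable {m : ℕ} (hN : ∀ z ∈ N, ∀ u : U, z * u = u * z) {X : Fin m → U}
  (h3 : ∀ i, X i ^ 3 ∈ N) (h2 : ∀ i j, i ≠ j → (X i * X j) ^ 2 ∈ N)

include hN h3 h2

/-- Carmichael's relations modulo a central subgroup give a projective lift. -/
lemma exists_projectiveLift : ∃ s : ProjectiveLift (alternatingGroup (Fin (m + 2))) N,
    ∀ i, s.Represents (tri i) (X i) := by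
  have : N.Normal := ⟨fun z hz u => by rwa [← hN z hz u, mul_inv_cancel_right]⟩
  obtain ⟨F, hF⟩ := IsCarmichael.exists_hom (X := fun i => (QuotientGroup.mk' N (X i)))
    ⟨fun i => by rw [← map_pow]; exact (QuotientGroup.eq_one_iff _).2 (h3 i),
      fun i j h => by rw [← map_mul, ← map_pow]; exact (QuotientGroup.eq_one_iff _).2 (h2 i j h)⟩
  have hs := fun g => QuotientGroup.mk'_surjective N (F g)
  choose l hl using hs
  have hmem : ∀ {a b : U}, QuotientGroup.mk' N a = QuotientGroup.mk' N b → a * b⁻¹ ∈ N :=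
    fun {a b} h => (QuotientGroup.eq_one_iff _).1 (by
      change QuotientGroup.mk' N (a * b⁻¹) = 1
      rw [map_mul, map_inv, h, mul_inv_cancel])
  refine ⟨⟨l, fun g h => ⟨l g * l h * (l (g * h))⁻¹, hmem ?_⟩,
    fun g h => (inv_mul_cancel_right _ _).symm, hN⟩, fun i =>
      ⟨_, hmem ((hl (tri i)).trans (hF i)), (inv_mul_cancel_right _ _).symm⟩⟩
  rw [map_mul, hl, hl, hl, map_mul]

/-- The lifts of the generators differ from `X i` and `X j` by central factors, which occur to the
sixth power on both sides and cancel. A character of `N` that detects `w` then produces the cocycle.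
-/
theorem exists_spinDefect_ne_zero {i j : Fin m} (hij : i ≠ j) {w : N} (hw : w ≠ 1)
    (h : (X i * X j) ^ 6 = w * (X i ^ 6 * X j ^ 6)) :
    ∃ f : twoCocycles (alternatingGroup (Fin (m + 2))) (AddCircle (1 : ℚ)),
      spinDefect _ (tri i) (tri j) f.1 ≠ 0 := by
  obtain ⟨s, hs⟩ := exists_projectiveLift hN h3 h2
  obtain ⟨χ, hχ⟩ := exists_character hN hw
  have hT := isCarmichael_tri m
  refine ⟨s.cocycle χ, ?_⟩
  rwa [s.spinDefect_eq χ (hT.pow_three i) (hT.pow_three j) (hT.mul_sq i j hij) (w := w)]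
  obtain ⟨a, ha, h1⟩ := hs i
  obtain ⟨b, hb, h2⟩ := hs j
  have ha' : ∀ u, Commute a u := hN a ha
  have hb' : ∀ u, Commute b u := hN b hb
  rw [h1, h2]
  calc (a * X i * (b * X j)) ^ 6 = ((a * b) * (X i * X j)) ^ 6 := by
        rw [mul_assoc, ← mul_assoc (X i), ← (hb' (X i)).eq]
        group
    _ = (a * b) ^ 6 * (X i * X j) ^ 6 := ((ha' _).mul_left (hb' _)).mul_pow 6
    _ = a ^ 6 * b ^ 6 * (w * (X i ^ 6 * X j ^ 6)) := by rw [(ha' b).mul_pow, h]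
    _ = w * (a ^ 6 * (b ^ 6 * X i ^ 6) * X j ^ 6) := by
        rw [← mul_assoc, ← hN w w.2 (a ^ 6 * b ^ 6)]
        group
    _ = w * (a ^ 6 * (X i ^ 6 * b ^ 6) * X j ^ 6) := by
        rw [((hb' (X i)).pow_pow 6 6).eq]
    _ = _ := by rw [(ha' (X i)).mul_pow, (hb' (X j)).mul_pow]; group

/-- The word `X_a⁻¹ X_b X_c⁻¹ X_a` represents the three-cycle on the letters of `a`, `b`, `c`, which
commutes with `tri i`. Commutators do not depend on the choice of lifts modulo central elements, so
a character detecting `w` detects the defect. -/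
theorem exists_commDefect_ne_zero {i a b c : Fin m} (hab : a ≠ b) (hac : a ≠ c)
    (hia : i ≠ a) (hib : i ≠ b) (hic : i ≠ c) {w : N} (hw : w ≠ 1)
    (h : X i * ((X a)⁻¹ * X b * (X c)⁻¹ * X a) = w * ((X a)⁻¹ * X b * (X c)⁻¹ * X a * X i)) :
    ∃ f : twoCocycles (alternatingGroup (Fin (m + 2))) (AddCircle (1 : ℚ)),
      commDefect _ (tri i) (swapSwap a.succ.succ b.succ.succ a.succ.succ c.succ.succ
        (succ_succ_ne hab) (succ_succ_ne hac)) f.1 ≠ 0 := by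
  obtain ⟨s, hs⟩ := exists_projectiveLift hN h3 h2
  obtain ⟨χ, hχ⟩ := exists_character hN hw
  have hy : (tri a)⁻¹ * (tri b * (tri c)⁻¹) * tri a = swapSwap a.succ.succ b.succ.succ a.succ.succ
      c.succ.succ (succ_succ_ne hab) (succ_succ_ne hac) := by
    refine Subtype.ext ?_
    have h0 : (tri a).1⁻¹ 0 = a.succ.succ := by
      rw [Equiv.Perm.inv_eq_iff_eq, tri_self]
    have h1 : ∀ {d}, a ≠ d → (tri a).1⁻¹ d.succ.succ = d.succ.succ := fun {d} hd => by
      rw [Equiv.Perm.inv_eq_iff_eq, tri_of_ne hd.symm]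
    have h2 : (tri b).1 * (tri c).1⁻¹ =
        Equiv.swap 0 b.succ.succ * Equiv.swap 0 c.succ.succ := by
      have := conj_swap_mul_swap (Equiv.swap (0 : Fin (m + 2)) 1) 1 b.succ.succ 1 c.succ.succ
      rw [Equiv.swap_apply_right, Equiv.swap_apply_of_ne_of_ne (succ_succ_ne_zero b)
        (succ_succ_ne_one b), Equiv.swap_apply_of_ne_of_ne (succ_succ_ne_zero c)
        (succ_succ_ne_one c), Equiv.swap_inv] at this
      rw [← this]
      change Equiv.swap 0 1 * Equiv.swap 1 b.succ.succ *
        (Equiv.swap 0 1 * Equiv.swap 1 c.succ.succ)⁻¹ = _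
      rw [mul_inv_rev, Equiv.swap_inv, Equiv.swap_inv]
      group
    change (tri a).1⁻¹ * ((tri b).1 * (tri c).1⁻¹) * (tri a).1 = _
    have := conj_swap_mul_swap (tri a).1⁻¹ 0 b.succ.succ 0 c.succ.succ
    rw [inv_inv, ← h2, h0, h1 hab, h1 hac] at this
    exact this
  rw [← hy]
  refine ⟨s.cocycle χ, ?_⟩
  have hxy : tri i * ((tri a)⁻¹ * (tri b * (tri c)⁻¹) * tri a) =
      ((tri a)⁻¹ * (tri b * (tri c)⁻¹) * tri a) * tri i := by
    rw [hy, tri_mul_swapSwap hab hac hia hib hic]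
  rwa [s.commDefect_eq χ hxy (w := w)]
  obtain ⟨z, hz, h4⟩ := hs i
  obtain ⟨z', hz', h5⟩ := ((hs a).inv.mul ((hs b).mul (hs c).inv)).mul (hs a)
  have e1 : (X a)⁻¹ * (X b * (X c)⁻¹) * X a = (X a)⁻¹ * X b * (X c)⁻¹ * X a := by group
  rw [e1] at h5
  rw [h4, h5]
  generalize (X a)⁻¹ * X b * (X c)⁻¹ * X a = Y at h e1 h5 ⊢
  calc z * X i * (z' * Y) = z * (z' * (X i * Y)) := by
        rw [mul_assoc, ← mul_assoc (X i), ← hN z' hz' (X i), mul_assoc]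
    _ = z * z' * (w * (Y * X i)) := by rw [h, ← mul_assoc z z']
    _ = w * (z * z' * (Y * X i)) := by
        rw [← mul_assoc, ← hN w w.2 (z * z'), mul_assoc]
    _ = w * (z' * (z * Y) * X i) := by rw [hN z hz z']; group
    _ = _ := by rw [hN z hz Y]; group

end Projective

/-! ### The spin cover -/

section Spin

/-- The relations of Carmichael's generators in a Clifford algebra. -/
lemma cliffordRelations {R : Type} [Ring R] {u v v' : R} (hu : u * u = -1) (hv : v * v = -1)
    (hv' : v' * v' = -1) (huv : u * v + v * u = 1) (huv' : u * v' + v' * u = 1)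
    (hvv' : v * v' + v' * v = -1) :
    (u * v) ^ 3 = -1 ∧ (u * v * (u * v')) ^ 2 = -1 := by
  have h1 : v * u = 1 - u * v := eq_sub_of_add_eq' huv
  have h2 : v' * u = 1 - u * v' := eq_sub_of_add_eq' huv'
  have h3 : v' * v = -1 - v * v' := eq_sub_of_add_eq' hvv'
  have h4 : u * v * (u * v) = u * v - 1 := by
    rw [mul_assoc, ← mul_assoc v, h1, sub_mul, one_mul, mul_sub, mul_assoc, hv, ← mul_assoc, hu]
    simp
  have h5 : u * v * (u * v') = (u + v) * v' := by
    rw [mul_assoc, ← mul_assoc v, h1, sub_mul, one_mul, mul_sub, mul_assoc, ← mul_assoc, hu]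
    noncomm_ring
  have h6 : v' * (u + v) = -((u + v) * v') := by
    rw [mul_add, h2, h3]
    noncomm_ring
  have h7 : (u + v) * (u + v) = -1 := by
    rw [mul_add, add_mul, add_mul, hu, hv, h1]
    noncomm_ring
  constructor
  · rw [pow_three', h4, sub_mul, h4]
    noncomm_ring
  · rw [h5, sq, mul_assoc, ← mul_assoc v', h6, neg_mul, mul_neg, mul_assoc, hv', ← mul_assoc, h7]
    simp

/-- The standard quadratic form over the field with three elements. -/
abbrev standardForm (n : ℕ) : QuadraticForm (ZMod 3) (Fin n → ZMod 3) :=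
  LinearMap.BilinMap.toQuadraticMap (dotProductBilin (ZMod 3) (ZMod 3))

open CliffordAlgebra in
lemma ι_mul_ι_self {n : ℕ} {a b : Fin n} (h : a ≠ b) :
    ι (standardForm n) (Pi.single a 1 - Pi.single b 1) *
      ι (standardForm n) (Pi.single a 1 - Pi.single b 1) = -1 := by
  rw [CliffordAlgebra.ι_sq_scalar]
  have : (standardForm n) (Pi.single a 1 - Pi.single b 1) = -1 := by
    simp [h, h.symm]
    decide
  rw [this, map_neg, map_one]

open CliffordAlgebra in
lemma ι_mul_ι_add {n : ℕ} (x y : Fin n → ZMod 3) :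
    ι (standardForm n) x * ι (standardForm n) y + ι (standardForm n) y * ι (standardForm n) x =
      algebraMap _ _ (x ⬝ᵥ y + y ⬝ᵥ x) := by
  rw [ι_mul_ι_add_swap, LinearMap.BilinMap.polar_toQuadraticMap]
  rfl

instance (n : ℕ) : Nontrivial (CliffordAlgebra (standardForm n)) :=
  have : Invertible (2 : ZMod 3) := ⟨2, by decide, by decide⟩
  inferInstance

/-- The Clifford products `(e_0 - e_1)(e_1 - e_i)` lift the three-cycles. Over the field with three
elements the vectors `e_a - e_b` have norm `2 = -1`, and Carmichael's relations hold up to sign: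
every cube and every square of a product of two generators is `-1`. Hence `(X_i X_j) ^ 6 = -1` while
`X_i ^ 6 = 1`. -/
theorem exists_twoCocycle_spinDefect_ne_zero {m : ℕ} {i j : Fin m} (hij : i ≠ j) :
    ∃ f : twoCocycles (alternatingGroup (Fin (m + 2))) (AddCircle (1 : ℚ)),
      spinDefect _ (tri i) (tri j) f.1 ≠ 0 := by
  let R := CliffordAlgebra (standardForm (m + 2))
  let p : Fin (m + 2) → (Fin (m + 2) → ZMod 3) := fun i => Pi.single i 1
  let toR := CliffordAlgebra.ι (standardForm (m + 2))
  let u : R := toR (p 0 - p 1)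
  let v : Fin m → R := fun i => toR (p 1 - p i.succ.succ)
  have hu : u * u = -1 := ι_mul_ι_self zero_ne_one_fin
  have hv : ∀ i, v i * v i = -1 := fun i => ι_mul_ι_self (succ_succ_ne_one i).symm
  have huv : ∀ i, u * v i + v i * u = 1 := fun i => by
    have h := zero_ne_one_fin (m := m)
    have h0 := succ_succ_ne_zero i
    have h1 := succ_succ_ne_one i
    rw [ι_mul_ι_add, ← map_one (algebraMap (ZMod 3) R)]
    congr 1
    simp [p, h, h.symm, h0, h1, h0.symm, h1.symm]
    try decide
  have hvv : ∀ i j, i ≠ j → v i * v j + v j * v i = -1 := fun i j hij => by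
    have h1 := succ_succ_ne_one i
    have h2 := succ_succ_ne_one j
    have h3 := succ_succ_ne hij
    rw [ι_mul_ι_add, ← map_one (algebraMap (ZMod 3) R), ← map_neg]
    congr 1
    simp [p, h1, h2, h1.symm, h2.symm, h3, h3.symm]
    try decide
  have hneg : (-1 : R) ≠ 1 := fun h => by
    have h1 : algebraMap (ZMod 3) R (-1) = algebraMap (ZMod 3) R 1 := by
      rw [map_neg, map_one, h]
    exact absurd ((algebraMap (ZMod 3) R).injective h1) (by decide)
  let X : Fin m → Rˣ := fun i => ⟨u * v i, v i * u,
    by rw [mul_assoc, ← mul_assoc (v i), hv, neg_one_mul, mul_neg, hu, neg_neg],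
    by rw [mul_assoc, ← mul_assoc u, hu, neg_one_mul, mul_neg, hv, neg_neg]⟩
  have hX : ∀ i, X i ^ 3 = -1 := fun i => by
    refine Units.ext ?_
    -- `cliffordRelations` involves a second index, which exists because two distinct indices are
    -- given.
    by_cases h : ∃ j, j ≠ i
    · obtain ⟨j, h⟩ := h
      exact (cliffordRelations hu (hv i) (hv j) (huv i) (huv j) (hvv i j h.symm)).1
    · exact absurd hij (not_not.2 (by push Not at h; exact (h _).trans (h _).symm))
  have hXX : ∀ i j, i ≠ j → (X i * X j) ^ 2 = -1 := fun i j h => by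
    refine Units.ext ?_
    exact (cliffordRelations hu (hv i) (hv j) (huv i) (huv j) (hvv i j h)).2
  let N : Subgroup Rˣ := Subgroup.zpowers (-1)
  have hm : (-1 : Rˣ) ∈ N := Subgroup.mem_zpowers _
  refine exists_spinDefect_ne_zero (N := N) (X := X) (w := ⟨-1, hm⟩) ?_ (fun i => by rwa [hX])
    (fun i j h => by rwa [hXX i j h]) hij ?_ ?_
  · rintro _ ⟨k, rfl⟩ y
    exact ((Commute.neg_one_left y).zpow_left k).eq
  · exact fun h => hneg (congrArg Units.val (congrArg Subtype.val h))
  · rw [pow_mul (X i * X j) 2 3, hXX i j hij, pow_mul (X i) 3 2, pow_mul (X j) 3 2, hX, hX]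
    simp [pow_three]

end Spin

/-! ### The triple cover of the alternating group on seven letters. -/

section Triple

/-- The field with twenty-five elements, generated by a primitive cube root of unity. -/
abbrev F25 := QuadraticAlgebra (ZMod 5) (-1) (-1)

/-- Generators of the triple cover of the alternating group on seven letters. -/
def tripleGenerator : Fin 5 → Matrix (Fin 3) (Fin 3) F25 := ![
  !![⟨1,0⟩, 0, 0; 0, ⟨0,1⟩, 0; 0,0,⟨4,4⟩],
  !![⟨3,0⟩, ⟨1,1⟩, ⟨1,1⟩; ⟨4,0⟩, ⟨2,2⟩, ⟨1,1⟩; ⟨1,1⟩, ⟨0,4⟩, ⟨0,3⟩],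
  !![⟨3,0⟩, ⟨1,1⟩, ⟨4,4⟩; ⟨4,0⟩, ⟨2,2⟩, ⟨4,4⟩; ⟨4,4⟩, ⟨0,1⟩, ⟨0,3⟩],
  !![⟨3,0⟩, ⟨4,4⟩, ⟨1,1⟩; ⟨1,0⟩, ⟨2,2⟩, ⟨4,4⟩; ⟨1,1⟩, ⟨0,1⟩, ⟨0,3⟩],
  !![⟨3,0⟩, ⟨4,4⟩, ⟨4,4⟩; ⟨1,0⟩, ⟨2,2⟩, ⟨1,1⟩; ⟨4,4⟩, ⟨0,4⟩, ⟨0,3⟩]]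

/-- A primitive cube root of unity. -/
def omega : F25 := ⟨0, 1⟩

lemma tripleGenerator_cube : ∀ i, tripleGenerator i * tripleGenerator i * tripleGenerator i = 1 := by
  decide

lemma tripleGenerator_sq : ∀ i j, i ≠ j → ∃ k : Fin 3,
    tripleGenerator i * tripleGenerator j * (tripleGenerator i * tripleGenerator j) =
      Matrix.of fun a b => if a = b then omega ^ k.1 else 0 := by
  decide

/-- A conjugate of a quotient of generators. -/
def tripleConjugate : Matrix (Fin 3) (Fin 3) F25 :=
  !![0, ⟨1,1⟩, 0; 0, 0, 1; ⟨0,4⟩, 0, 0]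

/-- The generators have trivial cube, so a square replaces an inverse: this says that
`tripleConjugate` is the word `X_1⁻¹ X_2 X_3⁻¹ X_1`. -/
lemma tripleConjugate_eq : tripleGenerator 1 * tripleConjugate =
    tripleGenerator 2 * (tripleGenerator 3 * (tripleGenerator 3 * tripleGenerator 1)) := by
  have h : tripleGenerator 3 * (tripleGenerator 3 * tripleGenerator 1) =
      !![⟨4,0⟩, ⟨4,4⟩, ⟨2,2⟩; ⟨0,4⟩, ⟨2,0⟩, ⟨4,0⟩; ⟨0,3⟩, ⟨1,0⟩, ⟨4,0⟩] := by
    decide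
  rw [h]
  decide

lemma tripleGenerator_comm : tripleGenerator 0 * tripleConjugate =
    (Matrix.of fun a b => if a = b then omega ^ 2 else 0) *
      (tripleConjugate * tripleGenerator 0) := by
  decide

/-- The matrices satisfy Carmichael's relations up to powers of `omega`, while the lifts of two
commuting three-cycles commute only up to the scalar `omega ^ 2`. The injection `e` restricts the
representation to fewer letters. -/
theorem exists_twoCocycle_commDefect_ne_zero {m : ℕ} (e : Fin m → Fin 5)
    (he : Function.Injective e) {i a b c : Fin m} (hab : a ≠ b) (hac : a ≠ c)
    (hi : e i = 0) (ha : e a = 1) (hb : e b = 2) (hc : e c = 3) :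
    ∃ f : twoCocycles (alternatingGroup (Fin (m + 2))) (AddCircle (1 : ℚ)),
      commDefect _ (tri i) (swapSwap a.succ.succ b.succ.succ a.succ.succ c.succ.succ
        (succ_succ_ne hab) (succ_succ_ne hac)) f.1 ≠ 0 := by
  let R := Matrix (Fin 3) (Fin 3) F25
  have hom : omega ^ 3 = 1 := by decide
  let om : F25ˣ := ⟨omega, omega ^ 2, by decide, by decide⟩
  let S : F25ˣ →* Rˣ := Units.map (Matrix.scalar (Fin 3)).toMonoidHom
  have hS : ∀ k : ℕ, ((S (om ^ k) : Rˣ) : R) =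
      Matrix.of fun a b => if a = b then omega ^ k else 0 := fun k => by
    refine Matrix.ext fun a b => ?_
    change Matrix.scalar (Fin 3) ((om ^ k : F25ˣ) : F25) a b = _
    rw [Matrix.scalar_apply, Matrix.diagonal_apply, Units.val_pow_eq_pow_val]
    rfl
  let N : Subgroup Rˣ := S.range
  let X : Fin m → Rˣ := fun i => ⟨tripleGenerator (e i), tripleGenerator (e i) *
    tripleGenerator (e i), by rw [← mul_assoc, tripleGenerator_cube], tripleGenerator_cube _⟩
  have hX : ∀ i, X i ^ 3 = 1 := fun i => Units.ext (by
    rw [pow_three']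
    exact tripleGenerator_cube (e i))
  have hc1 : ∀ z ∈ N, ∀ y : Rˣ, z * y = y * z := by
    rintro _ ⟨z, rfl⟩ y
    exact Units.ext (Matrix.scalar_commute _ (fun _ => Commute.all _ _) _).eq
  refine exists_commDefect_ne_zero (N := N) (X := X) (w := ⟨S (om ^ 2), om ^ 2, rfl⟩) hc1
    (fun i => by rw [hX]; exact N.one_mem) ?_ hab hac ?_ ?_ ?_ ?_ ?_
  · intro i j h
    obtain ⟨k, hk⟩ := tripleGenerator_sq (e i) (e j) (he.ne h)
    refine ⟨om ^ k.1, Units.ext ?_⟩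
    rw [hS, ← hk, sq]
    rfl
  · rintro rfl; rw [hi] at ha; exact absurd ha (by decide)
  · rintro rfl; rw [hi] at hb; exact absurd hb (by decide)
  · rintro rfl; rw [hi] at hc; exact absurd hc (by decide)
  · intro h
    have h1 := congrArg (fun M : Rˣ => (M : R) 0 0) (congrArg Subtype.val h)
    dsimp only at h1
    rw [hS] at h1
    exact absurd h1 (by decide)
  · refine Units.ext ?_
    have hYv : (((X a)⁻¹ * X b * (X c)⁻¹ * X a : Rˣ) : R) = tripleConjugate := by
      have h1 : X a * ((X a)⁻¹ * X b * (X c)⁻¹ * X a) = X b * (X c * (X c * X a)) := by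
        have h2 : (X c)⁻¹ = X c * X c := by
          rw [inv_eq_iff_mul_eq_one, ← pow_three, hX]
        rw [h2]
        group
      have h3 : ((X a : Rˣ) : R) * ((X a)⁻¹ * X b * (X c)⁻¹ * X a : Rˣ) =
          (X a : Rˣ) * tripleConjugate := by
        rw [← Units.val_mul, h1]
        change tripleGenerator (e b) * (tripleGenerator (e c) * (tripleGenerator (e c) *
          tripleGenerator (e a))) = tripleGenerator (e a) * tripleConjugate
        rw [ha, hb, hc, tripleConjugate_eq]
      exact (X a).isUnit.mul_left_cancel h3
    generalize (X a)⁻¹ * X b * (X c)⁻¹ * X a = Y at hYv ⊢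
    rw [Units.val_mul, Units.val_mul, Units.val_mul, hYv]
    change tripleGenerator (e i) * tripleConjugate = (S (om ^ 2) : Rˣ) *
      (tripleConjugate * tripleGenerator (e i))
    rw [hS, hi, tripleGenerator_comm]

end Triple

/-! ### Torsion of the circle -/

section Torsion

/-- The subgroup of elements annihilated by `k`. -/
def torsionSubgroup (T : Type) [AddCommGroup T] (k : ℕ) : AddSubgroup T where
  carrier := {t | k • t = 0}
  zero_mem' := smul_zero k
  add_mem' {a b} ha hb := by
    change k • (a + b) = 0
    rw [smul_add, ha, hb, add_zero]
  neg_mem' {a} ha := by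
    change k • (-a) = 0
    rw [smul_neg, ha, neg_zero]

/-- The group `ℚ ⧸ ℤ`. -/
abbrev QZ := AddCircle (1 : ℚ)

lemma exists_nsmul_eq (t : QZ) {k : ℕ} (hk : k ≠ 0) : ∃ u : QZ, k • u = t := by
  obtain ⟨q, rfl⟩ := QuotientAddGroup.mk_surjective t
  refine ⟨((q / k : ℚ) : QZ), ?_⟩
  rw [← AddCircle.coe_nsmul, nsmul_eq_mul, mul_div_cancel₀ _ (Nat.cast_ne_zero.2 hk)]

theorem nonempty_torsionSubgroup_equiv (k : ℕ) [NeZero k] :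
    Nonempty (torsionSubgroup QZ k ≃+ ZMod k) := by
  have hord : addOrderOf (((1 : ℚ) / k : ℚ) : QZ) = k :=
    AddCircle.addOrderOf_period_div (p := (1 : ℚ)) (Nat.pos_of_ne_zero (NeZero.ne k))
  let t : torsionSubgroup QZ k := ⟨(((1 : ℚ) / k : ℚ) : QZ), by
    have := addOrderOf_nsmul_eq_zero (((1 : ℚ) / k : ℚ) : QZ)
    rwa [hord] at this⟩
  have ht : addOrderOf t = k := by
    exact (addOrderOf_injective (torsionSubgroup QZ k).subtype Subtype.val_injective t).symm.trans
      hord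
  have hz : ∀ x : torsionSubgroup QZ k, x ∈ AddSubgroup.zmultiples t := by
    rintro ⟨x, hx⟩
    obtain ⟨q, rfl⟩ := QuotientAddGroup.mk_surjective x
    change k • ((q : ℚ) : QZ) = 0 at hx
    rw [← AddCircle.coe_nsmul, AddCircle.coe_eq_zero_iff] at hx
    obtain ⟨z, hz⟩ := hx
    refine ⟨z, Subtype.ext ?_⟩
    change z • (((1 : ℚ) / k : ℚ) : QZ) = ((q : ℚ) : QZ)
    rw [← AddCircle.coe_zsmul]
    congr 1
    have hk : (k : ℚ) ≠ 0 := Nat.cast_ne_zero.2 (NeZero.ne k)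
    rw [zsmul_eq_mul] at hz ⊢
    rw [nsmul_eq_mul, mul_one] at hz
    field_simp
    linarith
  have htop : AddSubgroup.zmultiples t = ⊤ := eq_top_iff.2 fun x _ => hz x
  have : IsAddCyclic (torsionSubgroup QZ k) := ⟨⟨t, hz⟩⟩
  have hc : Nat.card (torsionSubgroup QZ k) = k := by
    rw [← Nat.card_zmultiples, htop] at ht
    exact (Nat.card_congr AddSubgroup.topEquiv.toEquiv).symm.trans ht
  exact ⟨(zmodAddCyclicAddEquiv this).symm.trans (ZMod.ringEquivCongr hc).toAddEquiv⟩

lemma surjective_of_prime {A : Type*} [AddCommGroup A] {p : ℕ} [hp : Fact p.Prime]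
    (φ : A →+ ZMod p) {a : A} (ha : φ a ≠ 0) : Function.Surjective φ := fun z =>
  ⟨(z * (φ a)⁻¹).val • a, by
    rw [map_nsmul, nsmul_eq_mul, ZMod.natCast_zmod_val, inv_mul_cancel_right₀ ha]⟩

end Torsion

/-! ### Third integral cohomology as second cohomology with values in ℚ/ℤ. -/

section Trivial

variable {G : Type} [Group G]

/-- Cocycles for the trivial representation as two-cocycles. -/
def toTwoCocycles (T : Type) [AddCommGroup T] :
    groupCohomology.cocycles₂ (Rep.of (Representation.trivial ℤ G T)) →+ twoCocycles G T where
  toFun c := ⟨fun g h => c (g, h), fun g h j => (groupCohomology.mem_cocycles₂_iff _).1 c.2 g h j⟩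
  map_zero' := rfl
  map_add' _ _ := rfl

lemma toTwoCocycles_surjective (T : Type) [AddCommGroup T] :
    Function.Surjective (toTwoCocycles (G := G) T) := fun f =>
  ⟨⟨fun x => f.1 x.1 x.2, (groupCohomology.mem_cocycles₂_iff _).2 f.2⟩, rfl⟩

theorem nonempty_groupCohomology_three_trivial [Finite G] {Q : Type} [AddCommGroup Q]
    (φ : twoCocycles G QZ →+ Q) (hφ : Function.Surjective φ)
    (hker : ∀ f, φ f = 0 ↔ IsCoboundary f.1) :
    Nonempty (groupCohomology (Rep.of (Representation.trivial ℤ G ℤ)) 3 ≃+ Q) := by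
  have hG : (Nat.card G : ℚ) ≠ 0 := Nat.cast_ne_zero.2 Nat.card_pos.ne'
  obtain ⟨e⟩ := nonempty_groupCohomology_succ_equiv (G := G) (f := Int.castAddHom ℚ)
    (g := QuotientAddGroup.mk' (AddSubgroup.zmultiples (1 : ℚ)))
    (u := AddMonoidHom.mulLeft (Nat.card G : ℚ)⁻¹)
    (ρM := Representation.trivial ℤ G ℤ) (ρN := Representation.trivial ℤ G ℚ)
    (ρP := Representation.trivial ℤ G QZ)
    Int.cast_injective (QuotientAddGroup.mk'_surjective _)
    (fun y => by
      refine (AddCircle.coe_eq_zero_iff (1 : ℚ)).trans ?_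
      simp)
    (fun _ _ => rfl) (fun _ _ => rfl)
    (fun x => by simp [hG]) (fun x => by simp [hG]) 1
  obtain ⟨e'⟩ := nonempty_groupCohomology_two_equiv (Representation.trivial ℤ G QZ)
    (φ.comp (toTwoCocycles QZ)) (hφ.comp (toTwoCocycles_surjective QZ)) fun c => by
      refine (hker _).trans (exists_congr fun b => forall_congr' fun g => forall_congr' fun h => ?_)
      change c (g, h) = _ ↔ b h - b (g * h) + b g = c (g, h)
      rw [eq_comm, add_comm (b g), add_sub_right_comm]
  exact ⟨e.symm.trans e'⟩

end Trivial

/-! ### Third integral cohomology of the alternating groups. -/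

section Alternating

lemma exists_three_nsmul (t : QZ) : ∃ u : QZ, 3 • u = t := exists_nsmul_eq t (by norm_num)

variable {m : ℕ}

/-- The spin class. -/
def spinClass (T : Type) [AddCommGroup T] (hT : ∀ t : T, ∃ u, 3 • u = t) {i j : Fin m}
    (hij : i ≠ j) : twoCocycles (alternatingGroup (Fin (m + 2))) T →+ torsionSubgroup T 2 :=
  ((spinDefect T (tri i) (tri j)).comp (twoCocycles _ T).subtype).codRestrict _ fun f =>
    two_nsmul_spinDefect hT f ((isCarmichael_tri m).pow_three i) ((isCarmichael_tri m).pow_three j)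
      ((isCarmichael_tri m).mul_sq i j hij)

theorem subsingleton_three : Subsingleton (groupCohomology
    (Rep.of (Representation.trivial ℤ (alternatingGroup (Fin 3)) ℤ)) 3) := by
  obtain ⟨e⟩ := nonempty_groupCohomology_three_trivial (G := alternatingGroup (Fin (1 + 2)))
    (0 : _ →+ PUnit) (fun x => ⟨0, rfl⟩)
    (fun f => ⟨fun _ => isCoboundary_three exists_three_nsmul f, fun _ => rfl⟩)
  exact e.toEquiv.subsingleton

/-- The spin defect takes values in the two-torsion of ℚ/ℤ and is nonzero by the Clifford algebra,
hence surjective; the hypothesis makes it injective on classes. -/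
lemma nonempty_equiv_zmod_two {i j : Fin m} (hij : i ≠ j)
    (h : ∀ f : twoCocycles (alternatingGroup (Fin (m + 2))) QZ,
      spinDefect QZ (tri i) (tri j) f.1 = 0 → IsCoboundary f.1) :
    Nonempty (groupCohomology
      (Rep.of (Representation.trivial ℤ (alternatingGroup (Fin (m + 2))) ℤ)) 3 ≃+ ZMod 2) := by
  obtain ⟨e⟩ := nonempty_torsionSubgroup_equiv 2
  have key : ∀ f, e (spinClass QZ exists_three_nsmul hij f) = 0 ↔
      spinDefect QZ (tri i) (tri j) f.1 = 0 := fun f => by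
    rw [EmbeddingLike.map_eq_zero_iff]
    exact ⟨fun h => congrArg Subtype.val h, fun h => Subtype.ext h⟩
  obtain ⟨f, hf⟩ := exists_twoCocycle_spinDefect_ne_zero hij
  have hX := isCarmichael_tri m
  exact nonempty_groupCohomology_three_trivial
    (e.toAddMonoidHom.comp (spinClass QZ exists_three_nsmul hij))
    (surjective_of_prime _ (a := f) fun h => hf ((key f).1 h))
    (fun f => (key f).trans ⟨h f, fun h => spinDefect_coboundary h (hX.pow_three i)
      (hX.pow_three j) (hX.mul_sq i j hij)⟩)

theorem nonempty_equiv_four : Nonempty (groupCohomology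
    (Rep.of (Representation.trivial ℤ (alternatingGroup (Fin 4)) ℤ)) 3 ≃+ ZMod 2) :=
  nonempty_equiv_zmod_two (m := 2) (i := 0) (j := 1) (by decide)
    (isCoboundary_four exists_three_nsmul)

theorem nonempty_equiv_five : Nonempty (groupCohomology
    (Rep.of (Representation.trivial ℤ (alternatingGroup (Fin 5)) ℤ)) 3 ≃+ ZMod 2) :=
  nonempty_equiv_zmod_two (m := 3) (i := 0) (j := 1) (by decide) fun f hf =>
    isCoboundary_of_five_le exists_three_nsmul f (i := 0) (j := 1) (k := 2) (by decide) (by decide)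
      (by decide) hf (.inl rfl)

theorem nonempty_equiv_of_eight_le {m : ℕ} (hm : 6 ≤ m) : Nonempty (groupCohomology
    (Rep.of (Representation.trivial ℤ (alternatingGroup (Fin (m + 2))) ℤ)) 3 ≃+ ZMod 2) :=
  have h : ∀ {a b : ℕ} (ha : a < m) (hb : b < m), a ≠ b → (⟨a, ha⟩ : Fin m) ≠ ⟨b, hb⟩ :=
    fun _ _ h e => h (congrArg Fin.val e)
  have h01 := h (show 0 < m by omega) (show 1 < m by omega) (by decide)
  nonempty_equiv_zmod_two h01 fun f hf =>
    isCoboundary_of_five_le exists_three_nsmul f h01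
      (h (a := 0) (b := 2) (by omega) (by omega) (by decide))
      (h (a := 1) (b := 2) (by omega) (by omega) (by decide)) hf (.inr (.inl hm))

/-- In degrees six and seven the spin defect and the commutator defect together detect every class,
and each is nonzero on some cocycle. -/
lemma nonempty_equiv_zmod_six (e : Fin m → Fin 5) (he : Function.Injective e) {i a b c : Fin m}
    (hi : e i = 0) (ha : e a = 1) (hb : e b = 2) (hc : e c = 3) :
    Nonempty (groupCohomology
      (Rep.of (Representation.trivial ℤ (alternatingGroup (Fin (m + 2))) ℤ)) 3 ≃+ ZMod 6) := by
  have hne : ∀ {x y : Fin m} {p q : Fin 5}, e x = p → e y = q → p ≠ q → x ≠ y :=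
    fun hx hy h hxy => h (by rw [← hx, ← hy, hxy])
  have hia : i ≠ a := hne hi ha (by decide)
  have hib : i ≠ b := hne hi hb (by decide)
  have hic : i ≠ c := hne hi hc (by decide)
  have hab : a ≠ b := hne ha hb (by decide)
  have hac : a ≠ c := hne ha hc (by decide)
  have hbc : b ≠ c := hne hb hc (by decide)
  have hX := isCarmichael_tri m
  let y := swapSwap a.succ.succ b.succ.succ a.succ.succ c.succ.succ
    (succ_succ_ne hab) (succ_succ_ne hac)
  have hxy : tri i * y = y * tri i := tri_mul_swapSwap hab hac hia hib hic
  have hcomm : ∀ f : twoCocycles (alternatingGroup (Fin (m + 2))) QZ,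
    3 • commDefect QZ (tri i) y f.1 = 0 := fun f => three_nsmul_commDefect f (swapSwap_pow_three (succ_succ_ne hab)
      (succ_succ_ne hac) (succ_succ_ne hbc)) hxy
  obtain ⟨e2⟩ := nonempty_torsionSubgroup_equiv 2
  obtain ⟨e3⟩ := nonempty_torsionSubgroup_equiv 3
  let φ : twoCocycles (alternatingGroup (Fin (m + 2))) QZ →+ ZMod 2 :=
    e2.toAddMonoidHom.comp (spinClass QZ exists_three_nsmul hia)
  let ψ : twoCocycles (alternatingGroup (Fin (m + 2))) QZ →+ ZMod 3 :=
    e3.toAddMonoidHom.comp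
      (((commDefect QZ (tri i) y).comp (twoCocycles _ QZ).subtype).codRestrict _ hcomm)
  have hφ : ∀ f, φ f = 0 ↔ spinDefect QZ (tri i) (tri a) f.1 = 0 := fun f =>
    (EmbeddingLike.map_eq_zero_iff (f := e2)).trans
      ⟨fun h => congrArg Subtype.val h, fun h => Subtype.ext h⟩
  have hψ : ∀ f, ψ f = 0 ↔ commDefect QZ (tri i) y f.1 = 0 := fun f =>
    (EmbeddingLike.map_eq_zero_iff (f := e3)).trans
      ⟨fun h => congrArg Subtype.val h, fun h => Subtype.ext h⟩
  obtain ⟨f, hf⟩ := exists_twoCocycle_spinDefect_ne_zero hia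
  obtain ⟨g, hg⟩ := exists_twoCocycle_commDefect_ne_zero e he hab hac hi ha hb hc
  let E : ZMod 2 × ZMod 3 ≃+ ZMod 6 :=
    (ZMod.chineseRemainder (m := 2) (n := 3) (by norm_num)).symm.toAddEquiv
  have hs : Function.Surjective (φ.prod ψ) := by
    rintro ⟨x, z⟩
    obtain ⟨f', hf'⟩ := surjective_of_prime φ (mt (hφ f).1 hf) x
    obtain ⟨g', hg'⟩ := surjective_of_prime ψ (mt (hψ g).1 hg) z
    -- Chinese remainders: `3` is one modulo two and zero modulo three, and `4` the other way round.
    refine ⟨3 • f' + 4 • g', Prod.ext ?_ ?_⟩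
    · change φ (3 • f' + 4 • g') = x
      rw [map_add, map_nsmul, map_nsmul, hf']
      generalize φ g' = w
      clear hf'
      revert x w
      decide
    · change ψ (3 • f' + 4 • g') = z
      rw [map_add, map_nsmul, map_nsmul, hg']
      generalize ψ f' = w
      clear hg'
      revert z w
      decide
  refine nonempty_groupCohomology_three_trivial (E.toAddMonoidHom.comp (φ.prod ψ))
    (E.surjective.comp hs) fun f => (EmbeddingLike.map_eq_zero_iff (f := E)).trans ?_
  refine Prod.ext_iff.trans ((and_congr (hφ f) (hψ f)).trans ⟨fun h => ?_, fun h => ⟨?_, ?_⟩⟩)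
  · exact isCoboundary_of_five_le exists_three_nsmul f hia hib hab h.1
      (.inr (.inr ⟨a, b, c, hab, hac, hbc, hia, hib, hic, h.2⟩))
  · exact spinDefect_coboundary h (hX.pow_three _) (hX.pow_three _) (hX.mul_sq _ _ hia)
  · exact commDefect_coboundary h hxy

end Alternating

/-! ### Crossed homomorphisms with values in functions modulo constants -/

section Crossed

variable (m : ℕ) (T : Type) [AddCommGroup T]

/-- Crossed homomorphisms of the alternating group with values in the functions modulo constants,
normalized to vanish at `0`. -/
def crossedHoms : AddSubgroup (alternatingGroup (Fin (m + 2)) → Fin (m + 2) → T) where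
  carrier := {b | (∀ g, b g 0 = 0) ∧ ∀ g h i,
    b g i + b h (g.1⁻¹ i) - b (g * h) i = b h (g.1⁻¹ 0)}
  zero_mem' := ⟨fun _ => rfl, fun _ _ _ => by simp⟩
  add_mem' {a b} ha hb := by
    refine ⟨fun g => ?_, fun g h i => ?_⟩
    · rw [Pi.add_apply, Pi.add_apply, ha.1, hb.1, add_zero]
    · simp only [Pi.add_apply, ← ha.2 g h i, ← hb.2 g h i]
      abel
  neg_mem' {a} ha := by
    refine ⟨fun g => ?_, fun g h i => ?_⟩
    · rw [Pi.neg_apply, Pi.neg_apply, ha.1, neg_zero]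
    · simp only [Pi.neg_apply, ← ha.2 g h i]
      abel

variable {m T}

/-- The predicate of being a principal crossed homomorphism. -/
def IsPrincipal (b : alternatingGroup (Fin (m + 2)) → Fin (m + 2) → T) : Prop :=
  ∃ v : Fin (m + 2) → T, ∀ g i, b g i = v (g.1⁻¹ i) - v i - (v (g.1⁻¹ 0) - v 0)

variable (m T) in
/-- The obstruction to lifting a crossed homomorphism to functions. -/
def obstruction : crossedHoms m T →+ twoCocycles (alternatingGroup (Fin (m + 2))) T where
  toFun b := ⟨fun g h => b.1 h (g.1⁻¹ 0), fun g h j => by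
    have := b.2.2 h j (g.1⁻¹ 0)
    dsimp only
    rw [← this, show ((g * h).1⁻¹ : Equiv.Perm _) 0 = h.1⁻¹ (g.1⁻¹ 0) by
      rw [Subgroup.coe_mul, mul_inv_rev, Equiv.Perm.mul_apply]]
    abel⟩
  map_zero' := rfl
  map_add' _ _ := rfl

/-- The crossed relation makes the right-hand side independent of `i`, so the obstruction may be
computed at any letter. At a letter fixed by `g` it has the shape of a coboundary, which is why its
defects vanish on elements with a common fixed letter. -/
lemma obstruction_apply (b : crossedHoms m T) (g h : alternatingGroup (Fin (m + 2)))
    (i : Fin (m + 2)) :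
    (obstruction m T b).1 g h = b.1 g i + b.1 h (g.1⁻¹ i) - b.1 (g * h) i :=
  (b.2.2 g h i).symm

lemma obstruction_apply_of_fixed (b : crossedHoms m T) {g : alternatingGroup (Fin (m + 2))}
    {k : Fin (m + 2)} (hg : g.1 k = k) (h : alternatingGroup (Fin (m + 2))) :
    (obstruction m T b).1 g h = b.1 g k + b.1 h k - b.1 (g * h) k := by
  rw [obstruction_apply b g h k, Equiv.Perm.inv_eq_iff_eq.2 hg.symm]

lemma isCoboundary_obstruction {b : crossedHoms m T} (hb : IsPrincipal b.1) :
    IsCoboundary (obstruction m T b).1 := by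
  obtain ⟨v, hv⟩ := hb
  refine ⟨fun g => v 0 - v (g.1⁻¹ 0), fun g h => ?_⟩
  change b.1 h (g.1⁻¹ 0) = _
  dsimp only
  rw [hv, Subgroup.coe_mul, mul_inv_rev, Equiv.Perm.mul_apply]
  abel

/-- The obstruction has no spin defect on elements with a common fixed point. -/
lemma spinDefect_obstruction (b : crossedHoms m T) {x y : alternatingGroup (Fin (m + 2))}
    {k : Fin (m + 2)} (hx : x.1 k = k) (hy : y.1 k = k) (hx3 : x ^ 3 = 1) (hy3 : y ^ 3 = 1)
    (hxy : (x * y) ^ 2 = 1) : spinDefect T x y (obstruction m T b).1 = 0 := by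
  let δ : alternatingGroup (Fin (m + 2)) → alternatingGroup (Fin (m + 2)) → T :=
    fun g h => b.1 g k + b.1 h k - b.1 (g * h) k
  have h0 : spinDefect T x y δ = 0 :=
    spinDefect_coboundary ⟨fun g => b.1 g k, fun _ _ => rfl⟩ hx3 hy3 hxy
  have h : ∀ g h : alternatingGroup (Fin (m + 2)), g.1 k = k → (obstruction m T b).1 g h = δ g h :=
    fun g h hg => obstruction_apply_of_fixed b hg h
  have hmul : ∀ {g h : alternatingGroup (Fin (m + 2))}, g.1 k = k → h.1 k = k → (g * h).1 k = k :=
    fun {g h} hg hh => by rw [Subgroup.coe_mul, Equiv.Perm.mul_apply, hh, hg]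
  rw [← h0]
  change 3 • (2 • (obstruction m T b).1 x y + ((obstruction m T b).1 (x * y) (x * y) +
      (obstruction m T b).1 1 1)) - (2 • ((obstruction m T b).1 x x +
      (obstruction m T b).1 (x * x) x + (obstruction m T b).1 1 1) +
      2 • ((obstruction m T b).1 y y + (obstruction m T b).1 (y * y) y +
      (obstruction m T b).1 1 1)) = _
  rw [h x y hx, h (x * y) _ (hmul hx hy), h 1 1 rfl, h x x hx, h (x * x) x (hmul hx hx), h y y hy,
    h (y * y) y (hmul hy hy)]
  rfl

/-- The obstruction has no commutator defect on elements with a common fixed point. -/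
lemma commDefect_obstruction (b : crossedHoms m T) {x y : alternatingGroup (Fin (m + 2))}
    {k : Fin (m + 2)} (hx : x.1 k = k) (hy : y.1 k = k) (hxy : x * y = y * x) :
    commDefect T x y (obstruction m T b).1 = 0 := by
  change (obstruction m T b).1 x y - (obstruction m T b).1 y x = 0
  rw [obstruction_apply_of_fixed b hx, obstruction_apply_of_fixed b hy, hxy]
  abel

/-- The crossed homomorphisms with values in functions. -/
def IsCrossed (c : alternatingGroup (Fin (m + 2)) → Fin (m + 2) → T) : Prop :=
  ∀ g h i, c (g * h) i = c g i + c h (g.1⁻¹ i)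

/-- Subtracting a primitive of the obstruction, the same at every letter, lifts a crossed
homomorphism modulo constants to genuine functions. The lift is unique only up to homomorphisms to
`T`. -/
lemma exists_isCrossed {b : crossedHoms m T} (hb : IsCoboundary (obstruction m T b).1) :
    ∃ β : alternatingGroup (Fin (m + 2)) → T, IsCrossed fun g i => b.1 g i - β g := by
  obtain ⟨β, hβ⟩ := hb
  refine ⟨β, fun g h i => ?_⟩
  have := hβ g h
  rw [obstruction_apply b g h i] at this
  dsimp only
  rw [sub_eq_iff_eq_add] at this
  rw [← sub_eq_zero] at this ⊢
  rw [← neg_eq_zero, ← this]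
  abel

lemma exists_apply_eq (hm : m ≠ 0) (k i : Fin (m + 2)) :
    ∃ s : alternatingGroup (Fin (m + 2)), s.1 k = i := by
  by_cases h : k = i
  · exact ⟨1, h⟩
  · obtain ⟨j, hj⟩ : ∃ j, j ∉ ({k, i} : Finset (Fin (m + 2))) := by
      by_contra! hj
      have := Finset.card_le_card (fun j _ => hj j : Finset.univ ⊆ _)
      rw [Finset.card_fin] at this
      have := this.trans Finset.card_le_two
      omega
    simp only [Finset.mem_insert, Finset.mem_singleton, not_or] at hj
    refine ⟨swapSwap k i i j h (Ne.symm hj.2), ?_⟩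
    rw [swapSwap_apply, Equiv.swap_apply_of_ne_of_ne h (Ne.symm hj.1), Equiv.swap_apply_left]

/-- A crossed homomorphism vanishing on a point stabilizer is principal. -/
lemma isPrincipal_of_stabilizer (hm : m ≠ 0) {b : crossedHoms m T}
    {β : alternatingGroup (Fin (m + 2)) → T} (hc : IsCrossed fun g i => b.1 g i - β g)
    (k : Fin (m + 2)) (hk : ∀ g, g.1 k = k → b.1 g k - β g = 0) : IsPrincipal b.1 := by
  choose s hs using exists_apply_eq hm k
  set c := fun (g : alternatingGroup (Fin (m + 2))) i => b.1 g i - β g with hcdef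
  -- Shapiro's lemma: `(s i)⁻¹ * g * s (g⁻¹ i)` fixes `k`, so `c` vanishes on it there, and `c g` is
  -- expressed through its values on coset representatives.
  have key : ∀ g i, c g i = c (s i) i - c (s (g.1⁻¹ i)) (g.1⁻¹ i) := fun g i => by
    have h1 := hc (s i) ((s i)⁻¹ * (g * s (g.1⁻¹ i))) i
    have h2 : c ((s i)⁻¹ * (g * s (g.1⁻¹ i))) k = 0 := by
      refine hk _ ?_
      change (s i).1⁻¹ (g.1 ((s (g.1⁻¹ i)).1 k)) = k
      rw [hs, show g.1 (g.1⁻¹ i) = i from g.1.apply_symm_apply i, Equiv.Perm.inv_eq_iff_eq, hs]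
    rw [mul_inv_cancel_left, hc, (Equiv.Perm.inv_eq_iff_eq.2 (hs i).symm : (s i).1⁻¹ i = k), h2,
      add_zero] at h1
    exact eq_sub_of_add_eq h1
  refine ⟨fun i => -c (s i) i, fun g i => ?_⟩
  have h1 : b.1 g i = c g i - c g 0 := by
    rw [hcdef]
    dsimp only
    rw [b.2.1 g]
    abel
  rw [h1, key g i, key g 0]
  dsimp only
  generalize c (s i) i = p, c (s (g.1⁻¹ i)) (g.1⁻¹ i) = q, c (s 0) 0 = r,
    c (s (g.1⁻¹ 0)) (g.1⁻¹ 0) = u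
  abel

/-- A crossed homomorphism vanishes on the stabilizer of a point if it does so on a cycle of
length three, or if the stabilizer has no quotient of order three. -/
lemma eq_zero_of_fixed {c : alternatingGroup (Fin (m + 2)) → Fin (m + 2) → T} (hc : IsCrossed c)
    (k : Fin (m + 2)) (h : m ≤ 1 ∨ 4 ≤ m ∨ ∃ y : alternatingGroup (Fin (m + 2)),
      y.1.IsThreeCycle ∧ y.1 k = k ∧ c y k = 0) (g : alternatingGroup (Fin (m + 2)))
    (hg : g.1 k = k) : c g k = 0 := by
  let α := {x : Fin (m + 2) // x ≠ k}
  have hcard : Nat.card α = m + 1 := by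
    rw [Nat.card_eq_fintype_card, Fintype.card_subtype_compl, Fintype.card_fin]
    simp
  let F : alternatingGroup α → alternatingGroup (Fin (m + 2)) := fun σ =>
    ⟨Equiv.Perm.ofSubtype σ.1, by
      rw [Equiv.Perm.mem_alternatingGroup, Equiv.Perm.sign_ofSubtype]
      exact σ.2⟩
  have hF : ∀ σ, (F σ).1 k = k := fun σ =>
    Equiv.Perm.ofSubtype_apply_of_not_mem _ (not_not.2 rfl)
  let κ : alternatingGroup α →* Multiplicative T := MonoidHom.mk' (fun σ => .ofAdd (c (F σ) k))
    fun σ τ => by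
      have : F (σ * τ) = F σ * F τ := Subtype.ext (map_mul _ _ _)
      rw [this, hc, Equiv.Perm.inv_eq_iff_eq.2 (hF σ).symm]
      rfl
  have hex : ∀ g : alternatingGroup (Fin (m + 2)), g.1 k = k → ∃ σ, F σ = g := fun g hg => by
    have h0 : ∀ x, g.1 x ≠ k ↔ x ≠ k := fun x =>
      not_congr ⟨fun h => g.1.injective (h.trans hg.symm), fun h => h ▸ hg⟩
    have h1 : Equiv.Perm.ofSubtype (g.1.subtypePerm h0) = g.1 :=
      Equiv.Perm.ofSubtype_subtypePerm (p := fun x => x ≠ k) h0 fun x hx h => hx (h ▸ hg)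
    refine ⟨⟨g.1.subtypePerm h0, ?_⟩, Subtype.ext h1⟩
    rw [Equiv.Perm.mem_alternatingGroup, ← Equiv.Perm.sign_ofSubtype, h1]
    exact g.2
  have hκ : κ = 1 := by
    refine hom_alternatingGroup_eq_one κ ?_
    rw [hcard]
    rcases h with h | h | ⟨y, hy, hyk, hcy⟩
    · exact .inl (by omega)
    · exact .inr (.inl (by omega))
    · obtain ⟨σ, rfl⟩ := hex y hyk
      refine .inr (.inr ⟨σ, ?_, congrArg Multiplicative.ofAdd hcy⟩)
      rw [Equiv.Perm.IsThreeCycle, ← Equiv.Perm.cycleType_ofSubtype]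
      exact hy
  obtain ⟨σ, rfl⟩ := hex g hg
  exact congrArg Multiplicative.toAdd (DFunLike.congr_fun hκ σ)

end Crossed

/-! ### Crossed homomorphisms of alternating groups of small degree -/

section Kernel

variable {m : ℕ} {T : Type} [AddCommGroup T]

lemma succ_succ_apply_tri {i k : Fin m} (h : i ≠ k) : (tri i).1 k.succ.succ = k.succ.succ :=
  tri_of_ne h.symm

theorem isPrincipal_three (hT : ∀ t : T, ∃ u, 3 • u = t) (b : crossedHoms 1 T) :
    IsPrincipal b.1 := by
  obtain ⟨β, hβ⟩ := exists_isCrossed (b := b) (isCoboundary_three hT _)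
  exact isPrincipal_of_stabilizer one_ne_zero hβ 0 (eq_zero_of_fixed hβ 0 (.inl le_rfl))

/-- A character of the alternating group on four letters with a prescribed value. -/
lemma exists_character_four {t : T} (ht : 3 • t = 0) :
    ∃ χ : alternatingGroup (Fin (2 + 2)) → T, (∀ g h, χ (g * h) = χ g + χ h) ∧ χ (tri 0) = t := by
  obtain ⟨F, hF⟩ := IsCarmichael.exists_hom (m := 2) (Γ := Multiplicative T)
    (X := ![.ofAdd t, .ofAdd (-t)]) (by
      have h1 : Multiplicative.ofAdd t ^ 3 = 1 := by rw [← ofAdd_nsmul, ht, ofAdd_zero]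
      constructor
      · rw [Fin.forall_fin_two]
        refine ⟨h1, ?_⟩
        change (Multiplicative.ofAdd (-t)) ^ 3 = 1
        rw [ofAdd_neg, inv_pow, h1, inv_one]
      · have h2 : (Multiplicative.ofAdd t * Multiplicative.ofAdd (-t)) ^ 2 = 1 := by
          rw [← ofAdd_add, add_neg_cancel, ofAdd_zero, one_pow]
        simp only [Fin.forall_fin_two]
        refine ⟨⟨fun h => absurd rfl h, fun _ => h2⟩, fun _ => ?_, fun h => absurd rfl h⟩
        rw [mul_comm] at h2
        exact h2)
  exact ⟨fun g => (F g).toAdd, fun g h => by dsimp only; rw [map_mul, toAdd_mul],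
    congrArg Multiplicative.toAdd (hF 0)⟩

lemma IsCrossed.map_one {c : alternatingGroup (Fin (m + 2)) → Fin (m + 2) → T} (hc : IsCrossed c)
    (i : Fin (m + 2)) : c 1 i = 0 := by
  have := hc 1 1 i
  rwa [one_mul, left_eq_add] at this

lemma IsCrossed.three_nsmul {c : alternatingGroup (Fin (m + 2)) → Fin (m + 2) → T}
    (hc : IsCrossed c) {x : alternatingGroup (Fin (m + 2))} (hx : x ^ 3 = 1) {k : Fin (m + 2)}
    (hk : x.1 k = k) : 3 • c x k = 0 := by
  have h := hc.map_one k
  rw [← hx, pow_three, hc, hc, Equiv.Perm.inv_eq_iff_eq.2 hk.symm,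
    Equiv.Perm.inv_eq_iff_eq.2 hk.symm] at h
  rw [← h]
  abel

lemma tri_isThreeCycle (i : Fin m) : (tri i).1.IsThreeCycle := by
  have := Equiv.Perm.isThreeCycle_swap_mul_swap_same (a := (1 : Fin (m + 2))) (b := 0)
    (c := i.succ.succ) zero_ne_one_fin.symm (succ_succ_ne_one i).symm (succ_succ_ne_zero i).symm
  rwa [Equiv.swap_comm] at this

/-- The lift may be changed by a character of the alternating group on four letters. The stabilizer
of `3` is generated by `tri 0`; the value there is killed by three and is removed by a character
taking the same value. -/
theorem isPrincipal_four (hT : ∀ t : T, ∃ u, 3 • u = t) (b : crossedHoms 2 T)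
    (hb : spinDefect T (tri 0) (tri 1) (obstruction 2 T b).1 = 0) : IsPrincipal b.1 := by
  obtain ⟨β, hβ⟩ := exists_isCrossed (b := b) (isCoboundary_four hT _ hb)
  have hfix : (tri (0 : Fin 2)).1 3 = 3 := succ_succ_apply_tri (i := 0) (k := 1) (by decide)
  obtain ⟨χ, hχ, hχ0⟩ := exists_character_four
    (hβ.three_nsmul ((isCarmichael_tri 2).pow_three 0) hfix)
  have hβ' : IsCrossed fun g i => b.1 g i - (β g + χ g) := fun g h i => by
    have := hβ g h i
    dsimp only at this ⊢
    rw [← sub_sub, this, hχ]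
    abel
  exact isPrincipal_of_stabilizer two_ne_zero hβ' 3 (eq_zero_of_fixed hβ' 3 (.inr (.inr
    ⟨tri 0, tri_isThreeCycle 0, hfix, by rw [hχ0]; abel⟩)))

/-- The obstruction is a coboundary, as its spin defect is computed on elements fixing `4`.
Conjugation by `(0 1)(3 4)` inverts `tri 0` and exchanges its fixed letters `3` and `4`. If the two
values there agree, they equal their own negative; being killed by three as well, they vanish. -/
theorem isPrincipal_five (hT : ∀ t : T, ∃ u, 3 • u = t) (b : crossedHoms 3 T)
    (hb : b.1 (tri 0) 4 - b.1 (tri 0) 3 = 0) : IsPrincipal b.1 := by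
  have hX := isCarmichael_tri 3
  have h3 : (tri (0 : Fin 3)).1 3 = 3 := succ_succ_apply_tri (i := 0) (k := 1) (by decide)
  have h4 : (tri (0 : Fin 3)).1 4 = 4 := succ_succ_apply_tri (i := 0) (k := 2) (by decide)
  have h4' : (tri (1 : Fin 3)).1 4 = 4 := succ_succ_apply_tri (i := 1) (k := 2) (by decide)
  have h01 : (0 : Fin 3) ≠ 1 := by decide
  obtain ⟨β, hβ⟩ := exists_isCrossed (b := b) (isCoboundary_of_five_le hT _ h01
    (by decide : (0 : Fin 3) ≠ 2) (by decide) (spinDefect_obstruction b h4 h4' (hX.pow_three 0)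
      (hX.pow_three 1) (hX.mul_sq 0 1 h01)) (.inl rfl))
  set c := fun (g : alternatingGroup (Fin (3 + 2))) i => b.1 g i - β g with hc
  have e1 : c (tri 0) 3 = c (tri 0) 4 := by
    rw [hc]
    dsimp only
    rw [sub_eq_zero.1 hb]
  let g : alternatingGroup (Fin (3 + 2)) := swapSwap 0 1 3 4 (by decide) (by decide)
  have hg : g * tri 0 * g⁻¹ = (tri 0)⁻¹ :=
    conj_tri' (by decide) (by decide) (by decide)
  have hg3 : g.1⁻¹ 3 = 4 := by rw [Equiv.Perm.inv_eq_iff_eq]; decide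
  have h4i : (tri (0 : Fin 3)).1⁻¹ 4 = 4 := Equiv.Perm.inv_eq_iff_eq.2 h4.symm
  have h3i : (tri (0 : Fin 3)).1⁻¹ 3 = 3 := Equiv.Perm.inv_eq_iff_eq.2 h3.symm
  have e2 : c (tri 0)⁻¹ 3 = c (tri 0) 4 := by
    rw [← hg, hβ, hβ, Subgroup.coe_mul, mul_inv_rev, Equiv.Perm.mul_apply, hg3, h4i]
    have := hβ g g⁻¹ 3
    rw [mul_inv_cancel, hβ.map_one, hg3] at this
    rw [add_right_comm, ← this, zero_add]
  have e3 : c (tri 0) 3 + c (tri 0)⁻¹ 3 = 0 := by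
    have := hβ (tri 0) (tri 0)⁻¹ 3
    rw [mul_inv_cancel, hβ.map_one, h3i] at this
    exact this.symm
  have e4 := hβ.three_nsmul (hX.pow_three 0) h4
  refine isPrincipal_of_stabilizer three_ne_zero hβ 4 (eq_zero_of_fixed hβ 4 (.inr (.inr
    ⟨tri 0, tri_isThreeCycle 0, h4, ?_⟩)))
  rw [e2, e1] at e3
  have : c (tri 0) 4 = 3 • c (tri 0) 4 - (c (tri 0) 4 + c (tri 0) 4) := by
    generalize c (tri 0) 4 = t
    abel
  rw [this, e4, e3, sub_zero]

/-- The stabilizer of a letter is an alternating group on at least five letters and has no abelian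
quotient, so only the obstruction matters. Its spin defect vanishes because both generators fix the
letter of `k`. -/
theorem isPrincipal_of_six_le (hT : ∀ t : T, ∃ u, 3 • u = t) (hm : 4 ≤ m) (b : crossedHoms m T)
    {i a k : Fin m} (hia : i ≠ a) (hik : i ≠ k) (hak : a ≠ k)
    (h : 6 ≤ m ∨ ∃ (a b' c : Fin m) (hab : a ≠ b') (hac : a ≠ c), b' ≠ c ∧
      i ≠ a ∧ i ≠ b' ∧ i ≠ c ∧
      commDefect T (tri i) (swapSwap a.succ.succ b'.succ.succ a.succ.succ c.succ.succ
        (succ_succ_ne hab) (succ_succ_ne hac)) (obstruction m T b).1 = 0) : IsPrincipal b.1 := by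
  have hX := isCarmichael_tri m
  obtain ⟨β, hβ⟩ := exists_isCrossed (b := b) (isCoboundary_of_five_le hT _ hia hik hak
    (spinDefect_obstruction b (succ_succ_apply_tri hik) (succ_succ_apply_tri hak) (hX.pow_three i)
      (hX.pow_three a) (hX.mul_sq i a hia)) (.inr h))
  exact isPrincipal_of_stabilizer (by omega) hβ 0 (eq_zero_of_fixed hβ 0 (.inr (.inl hm)))

end Kernel

/-! ### Construction of crossed homomorphisms -/

section Construction

/-- The semidirect product of the functions vanishing at `0`, as a model of functions modulo
constants, with the alternating group. -/
@[ext]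
structure TwistedPair (m : ℕ) (R : Type) [AddCommGroup R] where
  /-- the function -/
  fn : Fin (m + 2) → R
  /-- the permutation -/
  perm : alternatingGroup (Fin (m + 2))
  fn_zero : fn 0 = 0

namespace TwistedPair

variable {m : ℕ} {R : Type} [AddCommGroup R]

instance : Mul (TwistedPair m R) := ⟨fun x y =>
  ⟨fun i => x.fn i + (y.fn (x.perm.1⁻¹ i) - y.fn (x.perm.1⁻¹ 0)), x.perm * y.perm, by
    rw [x.fn_zero, sub_self, add_zero]⟩⟩
instance : One (TwistedPair m R) := ⟨⟨0, 1, rfl⟩⟩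
instance : Inv (TwistedPair m R) := ⟨fun x =>
  ⟨fun i => x.fn (x.perm.1 0) - x.fn (x.perm.1 i), x.perm⁻¹, sub_self _⟩⟩

lemma mul_fn (x y : TwistedPair m R) (i : Fin (m + 2)) :
    (x * y).fn i = x.fn i + (y.fn (x.perm.1⁻¹ i) - y.fn (x.perm.1⁻¹ 0)) := rfl

instance : Group (TwistedPair m R) := Group.ofLeftAxioms
  (fun x y z => by
    refine TwistedPair.ext (funext fun i => ?_) (mul_assoc _ _ _)
    rw [mul_fn, mul_fn, mul_fn, mul_fn, mul_fn]
    change _ + (z.fn ((x.perm * y.perm).1⁻¹ i) - z.fn ((x.perm * y.perm).1⁻¹ 0)) = _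
    rw [Subgroup.coe_mul, mul_inv_rev, Equiv.Perm.mul_apply, Equiv.Perm.mul_apply]
    abel)
  (fun x => by
    refine TwistedPair.ext (funext fun i => ?_) (one_mul _)
    rw [mul_fn]
    change 0 + (x.fn i - x.fn 0) = _
    rw [x.fn_zero, sub_zero, zero_add])
  (fun x => by
    refine TwistedPair.ext (funext fun i => ?_) (inv_mul_cancel _)
    rw [mul_fn]
    change x.fn (x.perm.1 0) - x.fn (x.perm.1 i) +
      (x.fn ((x.perm.1⁻¹)⁻¹ i) - x.fn ((x.perm.1⁻¹)⁻¹ 0)) = 0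
    rw [inv_inv]
    abel)

end TwistedPair

/-- A section of the semidirect product is a crossed homomorphism, and Carmichael's presentation
reduces its construction to a check on generators. -/
theorem exists_crossedHom {m : ℕ} {R : Type} [AddCommGroup R] (X : Fin m → TwistedPair m R)
    (hX : ∀ i, (X i).perm = tri i) (h : IsCarmichael X) :
    ∃ (F : alternatingGroup (Fin (m + 2)) →* TwistedPair m R) (b : crossedHoms m R),
      (∀ i, F (tri i) = X i) ∧ ∀ g, b.1 g = (F g).fn := by
  obtain ⟨F, hF⟩ := h.exists_hom
  let π : TwistedPair m R →* alternatingGroup (Fin (m + 2)) :=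
    ⟨⟨fun x => x.perm, rfl⟩, fun _ _ => rfl⟩
  have hπ : π.comp F = MonoidHom.id _ := hom_eq_of_tri fun i => by
    change (F (tri i)).perm = tri i
    rw [hF, hX]
  have hp : ∀ g, (F g).perm = g := DFunLike.congr_fun hπ
  refine ⟨F, ⟨fun g => (F g).fn, fun g => (F g).fn_zero, fun g h i => ?_⟩, hF, fun g => rfl⟩
  dsimp only
  rw [map_mul, TwistedPair.mul_fn, hp]
  abel

/-- The image of a crossed homomorphism under an additive map. -/
def mapCrossed {m : ℕ} {R T : Type} [AddCommGroup R] [AddCommGroup T] (f : R →+ T)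
    (b : crossedHoms m R) : crossedHoms m T :=
  ⟨fun g i => f (b.1 g i), fun g => by dsimp only; rw [b.2.1, map_zero], fun g h i => by
    dsimp only
    rw [← b.2.2 g h i, map_sub, map_add]⟩

lemma isCarmichael_twistedPair {m : ℕ} {R : Type} [AddCommGroup R] (v : Fin m → Fin (m + 2) → R)
    (hv : ∀ i, v i 0 = 0)
    (h1 : ∀ i k, ((⟨v i, tri i, hv i⟩ : TwistedPair m R) *
      (⟨v i, tri i, hv i⟩ * ⟨v i, tri i, hv i⟩)).fn k = 0)
    (h2 : ∀ i j, i ≠ j → ∀ k, ((⟨v i, tri i, hv i⟩ * ⟨v j, tri j, hv j⟩ : TwistedPair m R) *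
      (⟨v i, tri i, hv i⟩ * ⟨v j, tri j, hv j⟩)).fn k = 0) :
    IsCarmichael fun i => (⟨v i, tri i, hv i⟩ : TwistedPair m R) where
  pow_three i := by
    rw [pow_three]
    exact TwistedPair.ext (funext (h1 i))
      ((pow_three (tri i)).symm.trans ((isCarmichael_tri m).pow_three i))
  mul_sq i j hij := by
    rw [sq]
    exact TwistedPair.ext (funext (h2 i j hij))
      ((sq (tri i * tri j)).symm.trans ((isCarmichael_tri m).mul_sq i j hij))

/-- Values on generators of a crossed homomorphism in degree four. -/
def crossedFour : Fin 2 → Fin (2 + 2) → ZMod 2 := ![![0, 0, 0, 0], ![0, 1, 0, 1]]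

/-- Values on generators of a crossed homomorphism in degree five. -/
def crossedFive : Fin 3 → Fin (3 + 2) → ZMod 3 :=
  ![![0, 0, 0, 2, 0], ![0, 0, 2, 0, 1], ![0, 0, 0, 1, 0]]

/-- Values on generators of a crossed homomorphism in degree six. -/
def crossedSix : Fin 4 → Fin (4 + 2) → ZMod 3 :=
  ![![0, 0, 0, 2, 1, 0], ![0, 0, 2, 0, 0, 1], ![0, 0, 1, 0, 0, 2], ![0, 0, 0, 1, 2, 0]]

lemma crossedFour_zero : ∀ i, crossedFour i 0 = 0 := by decide

theorem exists_crossedFour : ∃ b : crossedHoms 2 (ZMod 2),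
    spinDefect _ (tri 0) (tri 1) (obstruction 2 (ZMod 2) b).1 = 1 := by
  obtain ⟨F, b, hF, hb⟩ := exists_crossedHom _ (fun i => rfl)
    (isCarmichael_twistedPair crossedFour crossedFour_zero (by decide) (by decide))
  refine ⟨b, ?_⟩
  change 3 • (2 • b.1 (tri 1) ((tri 0).1⁻¹ 0) + (b.1 (tri 0 * tri 1) ((tri 0 * tri 1).1⁻¹ 0) +
    b.1 1 0)) - (2 • _ + 2 • _) = (1 : ZMod 2)
  -- Modulo two, only the square defect of `tri 0 * tri 1` survives in the spin defect.
  have h2 : ∀ a c d d' : ZMod 2, 3 • (2 • a + c) - (2 • d + 2 • d') = c := by decide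
  rw [h2, b.2.1, add_zero, hb, map_mul, hF, hF]
  decide

lemma crossedFive_zero : ∀ i, crossedFive i 0 = 0 := by decide

theorem exists_crossedFive : ∃ b : crossedHoms 3 (ZMod 3), b.1 (tri 0) 4 - b.1 (tri 0) 3 = 1 := by
  obtain ⟨F, b, hF, hb⟩ := exists_crossedHom _ (fun i => rfl)
    (isCarmichael_twistedPair crossedFive crossedFive_zero (by decide) (by decide))
  refine ⟨b, ?_⟩
  rw [hb, hF]
  decide

lemma crossedSix_zero : ∀ i, crossedSix i 0 = 0 := by decide

theorem exists_crossedSix : ∃ b : crossedHoms 4 (ZMod 3),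
    commDefect _ (tri 0) (swapSwap 3 4 3 5 (by decide) (by decide))
      (obstruction 4 (ZMod 3) b).1 = 1 := by
  obtain ⟨F, b, hF, hb⟩ := exists_crossedHom _ (fun i => rfl)
    (isCarmichael_twistedPair crossedSix crossedSix_zero (by decide) (by decide))
  refine ⟨b, ?_⟩
  -- The values of `F` are known on generators only, so the three-cycle is written as `x₁⁻¹ x₂ x₃⁻¹
  -- x₁`, with squares in place of inverses.
  have hy : swapSwap 3 4 3 5 (by decide) (by decide) =
      tri (1 : Fin 4) * tri 1 * (tri 2 * (tri 3 * tri 3 * tri 1)) := by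
    exact Subtype.ext (Equiv.ext (by decide))
  change b.1 _ ((tri 0).1⁻¹ 0) - b.1 (tri 0) ((swapSwap 3 4 3 5 _ _).1⁻¹ 0) = (1 : ZMod 3)
  rw [Equiv.Perm.inv_eq_iff_eq.2 (show (0 : Fin (4 + 2)) =
    (swapSwap 3 4 3 5 (by decide) (by decide)).1 0 by decide), b.2.1, sub_zero, hb, hy]
  simp only [map_mul, hF]
  decide

end Construction

/-! ### Homomorphisms on the kernel of the summation map -/

section KerSum

variable {Λ : Type} [AddCommGroup Λ] {m : ℕ}

instance [Module.Free ℤ Λ] [Module.Finite ℤ Λ] (n : ℕ) : Module.Free ℤ (kerSum Λ n) :=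
  inferInstanceAs (Module.Free ℤ (AddSubgroup.toIntSubmodule (kerSum Λ n)))

lemma exists_hom_lift {L N P : Type} [AddCommGroup L] [AddCommGroup N] [AddCommGroup P]
    [Module.Free ℤ L] {g : N →+ P} (hg : Function.Surjective g) (f : L →+ P) :
    ∃ f' : L →+ N, g.comp f' = f := by
  obtain ⟨h, hh⟩ := Module.projective_lifting_property g.toIntLinearMap f.toIntLinearMap hg
  exact ⟨h.toAddMonoidHom, AddMonoidHom.ext fun x => LinearMap.congr_fun hh x⟩

/-- The element of the kernel of the summation map with entries `x` and `-x` in the places `i`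
and `j`. -/
def pairing (i j : Fin m) : Λ →+ kerSum Λ m where
  toFun x := ⟨Pi.single i x - Pi.single j x, by
    change summation Λ m _ = 0
    rw [map_sub]
    change ∑ k, (Pi.single i x : Fin m → Λ) k - ∑ k, (Pi.single j x : Fin m → Λ) k = 0
    rw [Finset.sum_pi_single', Finset.sum_pi_single']
    simp⟩
  map_zero' := Subtype.ext (by simp)
  map_add' x y := Subtype.ext (by
    change (Pi.single i (x + y) - Pi.single j (x + y) : Fin m → Λ) =
      Pi.single i x - Pi.single j x + (Pi.single i y - Pi.single j y)
    rw [Pi.single_add, Pi.single_add]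
    abel)

lemma pairing_apply (i j : Fin m) (x : Λ) :
    (pairing i j x).1 = Pi.single i x - Pi.single j x := rfl

lemma pairing_add (i j k : Fin m) (x : Λ) : pairing i j x + pairing j k x = pairing i k x :=
  Subtype.ext (by
    change (pairing i j x).1 + (pairing j k x).1 = _
    rw [pairing_apply, pairing_apply, pairing_apply]
    abel)

lemma pairing_self (i : Fin m) (x : Λ) : pairing i i x = 0 :=
  Subtype.ext (sub_self _)

lemma smul_pairing (g : alternatingGroup (Fin m)) (i j : Fin m) (x : Λ) :
    g • pairing i j x = pairing (g.1 i) (g.1 j) x := by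
  have h : ∀ i k, (Pi.single i x : Fin m → Λ) (g.1⁻¹ k) = (Pi.single (g.1 i) x : Fin m → Λ) k :=
    fun i k => by
      rw [Pi.single_apply, Pi.single_apply]
      exact if_congr Equiv.Perm.inv_eq_iff_eq rfl rfl
  refine Subtype.ext (funext fun k => ?_)
  change (Pi.single i x : Fin m → Λ) (g.1⁻¹ k) - (Pi.single j x : Fin m → Λ) (g.1⁻¹ k) =
    (Pi.single (g.1 i) x : Fin m → Λ) k - (Pi.single (g.1 j) x : Fin m → Λ) k
  rw [h, h]

lemma sum_pairing (j : Fin m) (a : kerSum Λ m) : ∑ i, pairing i j (a.1 i) = a := by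
  have ha : ∑ i, a.1 i = 0 := a.2
  refine Subtype.ext ?_
  rw [AddSubgroup.val_finsetSum]
  simp_rw [pairing_apply]
  rw [Finset.sum_sub_distrib, Finset.univ_sum_single]
  have : ∑ i, (Pi.single j (a.1 i) : Fin m → Λ) = Pi.single j (∑ i, a.1 i) :=
    (map_sum (AddMonoidHom.single (fun _ : Fin m => Λ) j) a.1 Finset.univ).symm
  rw [this, ha, Pi.single_zero, sub_zero]

end KerSum

/-! ### The dual of the kernel of summation as functions modulo constants. -/

section SecondCohomology

variable (Λ : Type) [AddCommGroup Λ] (m : ℕ)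

/-- The normalized crossed homomorphism of a cocycle. -/
def toCrossedHoms : groupCohomology.cocycles₁
    (Rep.of (homRep (alternatingGroup (Fin (m + 2))) (kerSum Λ (m + 2)) QZ)) →+
      crossedHoms m (Λ →+ QZ) where
  toFun c := ⟨fun g i => (c g : kerSum Λ (m + 2) →+ QZ).comp (pairing i 0), fun g => by
    ext x
    change (c g : kerSum Λ (m + 2) →+ QZ) (pairing 0 0 x) = 0
    rw [pairing_self, map_zero], fun g h i => by
    have hc : c (g * h) = homRep _ _ QZ g (c h) + c g :=
      (groupCohomology.mem_cocycles₁_iff _).1 c.2 g h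
    ext x
    change (c g : kerSum Λ (m + 2) →+ QZ) (pairing i 0 x) +
      (c h : kerSum Λ (m + 2) →+ QZ) (pairing _ 0 x) -
      (c (g * h) : kerSum Λ (m + 2) →+ QZ) (pairing i 0 x) =
      (c h : kerSum Λ (m + 2) →+ QZ) (pairing _ 0 x)
    rw [hc]
    change _ - ((c h : kerSum Λ (m + 2) →+ QZ) (g⁻¹ • pairing i 0 x) +
      (c g : kerSum Λ (m + 2) →+ QZ) (pairing i 0 x)) = _
    rw [smul_pairing, ← pairing_add (g.1⁻¹ i) (g.1⁻¹ 0) 0, map_add]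
    change _ - ((c h : kerSum Λ (m + 2) →+ QZ) (pairing (g.1⁻¹ i) (g.1⁻¹ 0) x) + _) = _
    abel⟩
  map_zero' := rfl
  map_add' _ _ := rfl

variable {Λ m}

/-- The homomorphism on the kernel of the summation map defined by a family of homomorphisms. -/
def sumHom (v : Fin m → Λ →+ QZ) : kerSum Λ m →+ QZ where
  toFun a := ∑ i, v i (a.1 i)
  map_zero' := Finset.sum_eq_zero fun i _ => map_zero (v i)
  map_add' a b := by
    rw [← Finset.sum_add_distrib]
    exact Finset.sum_congr rfl fun i _ => map_add (v i) _ _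

lemma sumHom_apply (v : Fin m → Λ →+ QZ) (a : kerSum Λ m) :
    sumHom v a = ∑ i, v i (a.1 i) := rfl

lemma sumHom_pairing (v : Fin m → Λ →+ QZ) (i j : Fin m) (x : Λ) :
    sumHom v (pairing i j x) = v i x - v j x := by
  have h : ∀ i, ∑ k, v k ((Pi.single i x : Fin m → Λ) k) = v i x := fun i => by
    rw [Finset.sum_eq_single i, Pi.single_eq_same]
    · intro k _ hk
      rw [Pi.single_eq_of_ne hk, map_zero]
    · exact fun h => absurd (Finset.mem_univ i) h
  rw [sumHom_apply, ← h i, ← h j, ← Finset.sum_sub_distrib]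
  exact Finset.sum_congr rfl fun k _ => map_sub (v k) _ _

lemma hom_ext_pairing {f f' : kerSum Λ m →+ QZ} (j : Fin m)
    (h : ∀ i x, f (pairing i j x) = f' (pairing i j x)) : f = f' := by
  ext a
  rw [← sum_pairing j a, map_sum, map_sum]
  exact Finset.sum_congr rfl fun i _ => h i _

lemma toCrossedHoms_surjective : Function.Surjective (toCrossedHoms Λ m) := fun b => by
  refine ⟨⟨fun g => sumHom (b.1 g), (groupCohomology.mem_cocycles₁_iff _).2 fun g h =>
    hom_ext_pairing 0 fun i x => ?_⟩, Subtype.ext (funext fun g => funext fun i => ?_)⟩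
  · change sumHom (b.1 (g * h)) (pairing i 0 x) = sumHom (b.1 h) (g⁻¹ • pairing i 0 x) +
      sumHom (b.1 g) (pairing i 0 x)
    rw [smul_pairing, sumHom_pairing, sumHom_pairing, sumHom_pairing, b.2.1, b.2.1]
    change _ = b.1 h (g.1⁻¹ i) x - b.1 h (g.1⁻¹ 0) x + _
    rw [← b.2.2 g h i]
    simp only [AddMonoidHom.sub_apply, AddMonoidHom.add_apply, AddMonoidHom.zero_apply]
    abel
  · ext x
    change sumHom (b.1 g) (pairing i 0 x) = _
    rw [sumHom_pairing, b.2.1, AddMonoidHom.zero_apply, sub_zero]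

lemma isPrincipal_toCrossedHoms_iff (c : groupCohomology.cocycles₁
    (Rep.of (homRep (alternatingGroup (Fin (m + 2))) (kerSum Λ (m + 2)) QZ))) :
    IsPrincipal (toCrossedHoms Λ m c).1 ↔ ∃ f : kerSum Λ (m + 2) →+ QZ, ∀ g,
      homRep _ _ QZ g f - f = c g := by
  constructor
  · rintro ⟨v, hv⟩
    refine ⟨sumHom v, fun g => hom_ext_pairing 0 fun i x => ?_⟩
    refine Eq.trans ?_ (DFunLike.congr_fun (hv g i) x).symm
    change sumHom v (g⁻¹ • pairing i 0 x) - sumHom v (pairing i 0 x) = _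
    rw [smul_pairing, sumHom_pairing, sumHom_pairing]
    change v (g.1⁻¹ i) x - v (g.1⁻¹ 0) x - (v i x - v 0 x) =
      v (g.1⁻¹ i) x - v i x - (v (g.1⁻¹ 0) x - v 0 x)
    abel
  · rintro ⟨f, hf⟩
    refine ⟨fun i => f.comp (pairing i 0), fun g i => AddMonoidHom.ext fun x => ?_⟩
    refine (DFunLike.congr_fun (hf g) (pairing i 0 x)).symm.trans ?_
    change f (g⁻¹ • pairing i 0 x) - f (pairing i 0 x) = f (pairing (g.1⁻¹ i) 0 x) -
      f (pairing i 0 x) - (f (pairing (g.1⁻¹ 0) 0 x) - f (pairing 0 0 x))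
    rw [smul_pairing]
    change f (pairing (g.1⁻¹ i) (g.1⁻¹ 0) x) - _ = _
    rw [← pairing_add (g.1⁻¹ i) (g.1⁻¹ 0) 0, map_add f, pairing_self, map_zero f]
    abel

variable (Λ m)

/-- The kernel of summation is free, so mapping it into `ℤ → ℚ → ℚ/ℤ` keeps exactness and shifts the
degree. Homomorphisms from it to `ℚ/ℤ` are families of homomorphisms `Λ → ℚ/ℤ` modulo constant
families, so the class group is that of crossed modulo principal crossed homomorphisms. -/
theorem nonempty_groupCohomology_two_homRep [Module.Free ℤ Λ] [Module.Finite ℤ Λ] {Q : Type}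
    [AddCommGroup Q]
    (φ : crossedHoms m (Λ →+ QZ) →+ Q) (hφ : Function.Surjective φ)
    (hker : ∀ b, φ b = 0 ↔ IsPrincipal b.1) : Nonempty (groupCohomology
      (Rep.of (homRep (alternatingGroup (Fin (m + 2))) (kerSum Λ (m + 2)) ℤ)) 2 ≃+ Q) := by
  let G := alternatingGroup (Fin (m + 2))
  have hG : (Nat.card G : ℚ) ≠ 0 := Nat.cast_ne_zero.2 Nat.card_pos.ne'
  obtain ⟨e⟩ := nonempty_groupCohomology_succ_equiv (G := G)
    (f := AddMonoidHom.compHom (M := kerSum Λ (m + 2)) (Int.castAddHom ℚ))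
    (g := AddMonoidHom.compHom (M := kerSum Λ (m + 2))
      (QuotientAddGroup.mk' (AddSubgroup.zmultiples (1 : ℚ))))
    (u := AddMonoidHom.compHom (M := kerSum Λ (m + 2)) (AddMonoidHom.mulLeft (Nat.card G : ℚ)⁻¹))
    (ρM := homRep G (kerSum Λ (m + 2)) ℤ) (ρN := homRep G (kerSum Λ (m + 2)) ℚ)
    (ρP := homRep G (kerSum Λ (m + 2)) QZ)
    (fun x y h => AddMonoidHom.ext fun a => Int.cast_injective (DFunLike.congr_fun h a))
    (fun f => exists_hom_lift (QuotientAddGroup.mk'_surjective _) f)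
    (fun y => by
      constructor
      · intro h
        have h1 : ∀ a, ∃ z : ℤ, (z : ℚ) = y a := fun a => by
          obtain ⟨z, hz⟩ := (AddCircle.coe_eq_zero_iff (1 : ℚ)).1 (DFunLike.congr_fun h a)
          exact ⟨z, by rw [← hz, zsmul_eq_mul, mul_one]⟩
        choose z hz using h1
        refine ⟨AddMonoidHom.mk' z fun a b => ?_, AddMonoidHom.ext hz⟩
        exact Int.cast_injective (α := ℚ) (by rw [Int.cast_add, hz, hz, hz, map_add])
      · rintro ⟨x, rfl⟩
        refine AddMonoidHom.ext fun a => (AddCircle.coe_eq_zero_iff (1 : ℚ)).2 ⟨x a, ?_⟩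
        rw [zsmul_eq_mul, mul_one]
        rfl)
    (fun _ _ => rfl) (fun _ _ => rfl)
    (fun x => AddMonoidHom.ext fun a => by
      change Nat.card G • ((Nat.card G : ℚ)⁻¹ * x a) = x a
      rw [nsmul_eq_mul, mul_inv_cancel_left₀ hG])
    (fun x => AddMonoidHom.ext fun a => by
      change (Nat.card G : ℚ)⁻¹ * (Nat.card G • x a) = x a
      rw [nsmul_eq_mul, inv_mul_cancel_left₀ hG]) 0
  obtain ⟨e'⟩ := nonempty_groupCohomology_one_equiv (homRep G (kerSum Λ (m + 2)) QZ)
    (φ.comp (toCrossedHoms Λ m)) (hφ.comp toCrossedHoms_surjective) fun c =>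
      (hker _).trans (isPrincipal_toCrossedHoms_iff c)
  exact ⟨e.symm.trans e'⟩

end SecondCohomology

/-! ### The second cohomology of the dual of the kernel of the summation map -/

section DualTorsion

variable {Λ : Type} [AddCommGroup Λ]

lemma exists_nsmul_eq_hom [Module.Free ℤ Λ] {k : ℕ} (hk : k ≠ 0) (t : Λ →+ QZ) :
    ∃ u : Λ →+ QZ, k • u = t := by
  obtain ⟨u, hu⟩ := exists_hom_lift (g := nsmulAddMonoidHom (α := QZ) k)
    (fun t => exists_nsmul_eq t hk) t
  exact ⟨u, AddMonoidHom.ext fun x => DFunLike.congr_fun hu x⟩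

theorem nonempty_torsionSubgroup_hom_equiv {r : ℕ} (b : Module.Basis (Fin r) ℤ Λ) (k : ℕ)
    [NeZero k] : Nonempty (torsionSubgroup (Λ →+ QZ) k ≃+ (Fin r → ZMod k)) := by
  let F : torsionSubgroup (Λ →+ QZ) k →+ (Fin r → torsionSubgroup QZ k) :=
    { toFun t i := ⟨t.1 (b i), by
        have := DFunLike.congr_fun t.2 (b i)
        exact this⟩
      map_zero' := rfl
      map_add' _ _ := rfl }
  have hF : Function.Bijective F := by
    constructor
    · intro s t h
      refine Subtype.ext ?_
      have : s.1.toIntLinearMap = t.1.toIntLinearMap :=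
        b.ext fun i => congrArg Subtype.val (congrFun h i)
      exact AddMonoidHom.ext fun x => LinearMap.congr_fun this x
    · intro u
      let f := b.constr ℤ (M' := QZ) fun i => (u i).1
      refine ⟨⟨f.toAddMonoidHom, ?_⟩, funext fun i => Subtype.ext (b.constr_basis ℤ _ i)⟩
      have : k • f = 0 := b.ext fun i => by
        rw [LinearMap.smul_apply, b.constr_basis]
        exact (u i).2
      exact AddMonoidHom.ext fun x => LinearMap.congr_fun this x
  obtain ⟨e⟩ := nonempty_torsionSubgroup_equiv k
  exact ⟨(AddEquiv.ofBijective F hF).trans (AddEquiv.piCongrRight fun _ => e)⟩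

lemma exists_hom_of_torsion {T : Type} [AddCommGroup T] {k : ℕ} {t : T} (ht : k • t = 0) :
    ∃ f : ZMod k →+ T, f 1 = t := by
  refine ⟨ZMod.lift k ⟨zmultiplesHom T t, ?_⟩, ?_⟩
  · rw [zmultiplesHom_apply, natCast_zsmul, ht]
  · have := ZMod.lift_coe k ⟨zmultiplesHom T t, by rw [zmultiplesHom_apply, natCast_zsmul, ht]⟩ 1
    rw [Int.cast_one] at this
    exact this.trans (one_zsmul t)

lemma map_spinDefect {G R T : Type} [Group G] [AddCommGroup R] [AddCommGroup T] (f : R →+ T)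
    (x y : G) (F : G → G → R) : spinDefect T x y (fun g h => f (F g h)) = f (spinDefect R x y F) := by
  simp [spinDefect, squareDefect, cubeDefect]

end DualTorsion

/-! ### Crossed modulo principal crossed homomorphisms, degree by degree. -/

section Rows

variable {m : ℕ} {T : Type} [AddCommGroup T]

/-- The invariant is the spin defect of the obstruction. Pushing a crossed homomorphism over `ZMod
2` of defect `1` along `1 ↦ t` realizes every torsion value `t`. -/
lemma exists_twoFour (hT : ∀ t : T, ∃ u, 3 • u = t) :
    ∃ φ : crossedHoms 2 T →+ torsionSubgroup T 2, Function.Surjective φ ∧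
      ∀ b, φ b = 0 ↔ IsPrincipal b.1 := by
  have hX := isCarmichael_tri 2
  have h01 : (0 : Fin 2) ≠ 1 := by decide
  refine ⟨(spinClass T hT h01).comp (obstruction 2 T), fun t => ?_, fun b => ?_⟩
  · obtain ⟨b, hb⟩ := exists_crossedFour
    obtain ⟨f, hf⟩ := exists_hom_of_torsion t.2
    refine ⟨mapCrossed f b, Subtype.ext ?_⟩
    rw [← hf, ← hb]
    exact map_spinDefect f (tri (0 : Fin 2)) (tri 1) (obstruction 2 (ZMod 2) b).1
  · refine (Subtype.ext_iff (a2 := (0 : torsionSubgroup T 2))).trans ⟨isPrincipal_four hT b, fun h =>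
      spinDefect_coboundary (isCoboundary_obstruction h) (hX.pow_three _) (hX.pow_three _)
        (hX.mul_sq _ _ h01)⟩

/-- The invariant is the difference of the values of `b (tri 0)` at the fixed letters `4` and `3`.
It is additive along powers of `tri 0`, hence killed by three. -/
lemma exists_twoFive (hT : ∀ t : T, ∃ u, 3 • u = t) :
    ∃ φ : crossedHoms 3 T →+ torsionSubgroup T 3, Function.Surjective φ ∧
      ∀ b, φ b = 0 ↔ IsPrincipal b.1 := by
  have hX := isCarmichael_tri 3
  have h3 : (tri (0 : Fin 3)).1⁻¹ 3 = 3 := Equiv.Perm.inv_eq_iff_eq.2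
    (succ_succ_apply_tri (show (0 : Fin 3) ≠ 1 by decide)).symm
  have h4 : (tri (0 : Fin 3)).1⁻¹ 4 = 4 := Equiv.Perm.inv_eq_iff_eq.2
    (succ_succ_apply_tri (show (0 : Fin 3) ≠ 2 by decide)).symm
  have hmul : ∀ (b : crossedHoms 3 T) h, b.1 (tri 0 * h) 4 - b.1 (tri 0 * h) 3 =
      b.1 (tri 0) 4 - b.1 (tri 0) 3 + (b.1 h 4 - b.1 h 3) := fun b h => by
    have e3 := b.2.2 (tri 0) h 3
    have e4 := b.2.2 (tri 0) h 4
    rw [h3] at e3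
    rw [h4, ← e3] at e4
    rw [← sub_eq_zero] at e4 ⊢
    rw [← neg_eq_zero, ← e4]
    abel
  have hone : ∀ (b : crossedHoms 3 T) i, b.1 1 i = 0 := fun b i => by
    have := b.2.2 1 1 i
    rw [one_mul, add_sub_assoc] at this
    change b.1 1 i + (b.1 1 i - b.1 1 i) = b.1 1 0 at this
    rwa [sub_self, add_zero, b.2.1] at this
  let φ : crossedHoms 3 T →+ torsionSubgroup T 3 := AddMonoidHom.codRestrict
    (AddMonoidHom.mk' (fun b : crossedHoms 3 T => b.1 (tri 0) 4 - b.1 (tri 0) 3) fun a b => by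
      change a.1 _ 4 + b.1 _ 4 - (a.1 _ 3 + b.1 _ 3) = _
      abel) _ fun b => by
        change 3 • (b.1 (tri 0) 4 - b.1 (tri 0) 3) = 0
        have h1 := hmul b (tri 0 * tri 0)
        rw [← pow_three, hX.pow_three, hone, hone, hmul, sub_zero] at h1
        rw [h1]
        abel
  refine ⟨φ, fun t => ?_, fun b => ?_⟩
  · obtain ⟨b, hb⟩ := exists_crossedFive
    obtain ⟨f, hf⟩ := exists_hom_of_torsion t.2
    refine ⟨mapCrossed f b, Subtype.ext ?_⟩
    rw [← hf, ← hb, map_sub]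
    rfl
  · refine (Subtype.ext_iff (a2 := (0 : torsionSubgroup T 3))).trans ⟨isPrincipal_five hT b, ?_⟩
    rintro ⟨v, hv⟩
    change b.1 _ 4 - b.1 _ 3 = 0
    rw [hv, hv, h3, h4]
    abel

/-- The three-cycles `(0 1 2)` and `(3 4 5)` have no common fixed letter, so the commutator defect
of the obstruction can be nonzero; it is the invariant here. -/
lemma exists_twoSix (hT : ∀ t : T, ∃ u, 3 • u = t) :
    ∃ φ : crossedHoms 4 T →+ torsionSubgroup T 3, Function.Surjective φ ∧
      ∀ b, φ b = 0 ↔ IsPrincipal b.1 := by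
  have hab : (1 : Fin 4) ≠ 2 := by decide
  have hac : (1 : Fin 4) ≠ 3 := by decide
  have hbc : (2 : Fin 4) ≠ 3 := by decide
  have hxy := tri_mul_swapSwap hab hac (by decide : (0 : Fin 4) ≠ 1) (by decide : (0 : Fin 4) ≠ 2)
    (by decide : (0 : Fin 4) ≠ 3)
  let φ : crossedHoms 4 T →+ torsionSubgroup T 3 := AddMonoidHom.codRestrict
    ((commDefect T (tri 0) (swapSwap 3 4 3 5 (by decide) (by decide))).comp
      ((twoCocycles _ T).subtype.comp (obstruction 4 T))) _
      fun b => three_nsmul_commDefect (obstruction 4 T b) (swapSwap_pow_three (succ_succ_ne hab)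
        (succ_succ_ne hac) (succ_succ_ne hbc)) hxy
  refine ⟨φ, fun t => ?_, fun b => ?_⟩
  · obtain ⟨b, hb⟩ := exists_crossedSix
    obtain ⟨f, hf⟩ := exists_hom_of_torsion t.2
    refine ⟨mapCrossed f b, Subtype.ext ?_⟩
    rw [← hf, ← hb]
    exact (map_sub f _ _).symm
  · refine (Subtype.ext_iff (a2 := (0 : torsionSubgroup T 3))).trans ⟨fun h => ?_, fun h =>
      commDefect_coboundary (isCoboundary_obstruction h) hxy⟩
    exact isPrincipal_of_six_le hT le_rfl b (i := 0) (a := 1) (k := 2) (by decide) (by decide)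
      (by decide) (.inr ⟨1, 2, 3, hab, hac, hbc, by decide, by decide, by decide, h⟩)

/-- The two commuting three-cycles move six letters. A seventh letter is fixed by both and forces
the commutator defect to vanish. -/
lemma isPrincipal_of_seven_le (hT : ∀ t : T, ∃ u, 3 • u = t) (hm : 5 ≤ m) (b : crossedHoms m T) :
    IsPrincipal b.1 := by
  -- The residue only makes the indexing total; the indices in use are below `5 ≤ m`.
  let ι : ℕ → Fin m := fun k => ⟨k % m, Nat.mod_lt _ (by omega)⟩
  have hι : ∀ {k l : ℕ}, k < 5 → l < 5 → k ≠ l → ι k ≠ ι l := fun {k l} hk hl h e => by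
    have := congrArg Fin.val e
    change k % m = l % m at this
    rw [Nat.mod_eq_of_lt (by omega), Nat.mod_eq_of_lt (by omega)] at this
    exact h this
  have h12 : ι 1 ≠ ι 2 := hι (by decide) (by decide) (by decide)
  have h13 : ι 1 ≠ ι 3 := hι (by decide) (by decide) (by decide)
  have h01 : ι 0 ≠ ι 1 := hι (by decide) (by decide) (by decide)
  have h02 : ι 0 ≠ ι 2 := hι (by decide) (by decide) (by decide)
  have h03 : ι 0 ≠ ι 3 := hι (by decide) (by decide) (by decide)
  have h4 : ∀ {k}, k < 4 → (ι 4).succ.succ ≠ (ι k).succ.succ := fun {k} hk =>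
    succ_succ_ne (hι (by decide) (by omega) (by omega))
  refine isPrincipal_of_six_le hT (by omega) b h01 h02 h12 (.inr ⟨ι 1, ι 2, ι 3, h12, h13,
    hι (by decide) (by decide) (by decide), h01, h02, h03, commDefect_obstruction b
      (k := (ι 4).succ.succ) (succ_succ_apply_tri (hι (by decide) (by decide) (by decide))) ?_
      (tri_mul_swapSwap h12 h13 h01 h02 h03)⟩)
  rw [swapSwap_apply, Equiv.swap_apply_of_ne_of_ne (h4 (by decide)) (h4 (by decide)),
    Equiv.swap_apply_of_ne_of_ne (h4 (by decide)) (h4 (by decide))]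

variable {Λ : Type} [AddCommGroup Λ] [Module.Free ℤ Λ]

lemma exists_three_nsmul_hom (t : Λ →+ QZ) : ∃ u : Λ →+ QZ, 3 • u = t :=
  exists_nsmul_eq_hom three_ne_zero t

variable [Module.Finite ℤ Λ]

lemma subsingleton_groupCohomology_two {m : ℕ}
    (h : ∀ b : crossedHoms m (Λ →+ QZ), IsPrincipal b.1) :
    Subsingleton (groupCohomology
      (Rep.of (homRep (alternatingGroup (Fin (m + 2))) (kerSum Λ (m + 2)) ℤ)) 2) := by
  obtain ⟨e⟩ := nonempty_groupCohomology_two_homRep Λ m (0 : _ →+ PUnit) (fun x => ⟨0, rfl⟩)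
    (fun f => ⟨fun _ => h f, fun _ => rfl⟩)
  exact e.toEquiv.subsingleton

lemma nonempty_groupCohomology_two {r k m : ℕ} [NeZero k] (b : Module.Basis (Fin r) ℤ Λ)
    (h : ∃ φ : crossedHoms m (Λ →+ QZ) →+ torsionSubgroup (Λ →+ QZ) k, Function.Surjective φ ∧
      ∀ b, φ b = 0 ↔ IsPrincipal b.1) : Nonempty (groupCohomology
      (Rep.of (homRep (alternatingGroup (Fin (m + 2))) (kerSum Λ (m + 2)) ℤ)) 2 ≃+
        (Fin r → ZMod k)) := by
  obtain ⟨φ, hφ, hker⟩ := h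
  obtain ⟨e⟩ := nonempty_groupCohomology_two_homRep Λ m φ hφ hker
  obtain ⟨e'⟩ := nonempty_torsionSubgroup_hom_equiv b k
  exact ⟨e.trans e'⟩

end Rows

/-! ### The first cohomology of a group of alternating forms -/

section AlternatingForms

variable {L N P : Type} [AddCommGroup L] [AddCommGroup N] [AddCommGroup P]

/-- Alternating forms are functorial in the group of values. -/
def altMap (f : N →+ P) : altForms L N →+ altForms L P where
  toFun B := ⟨(AddMonoidHom.compHom f).comp B.1, fun x => by
    change f (B.1 x x) = 0
    rw [B.2, map_zero]⟩
  map_zero' := altForms.ext' fun _ _ => map_zero f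
  map_add' _ _ := altForms.ext' fun _ _ => map_add f _ _

lemma altMap_apply (f : N →+ P) (B : altForms L N) (x y : L) :
    (altMap f B).1 x y = f (B.1 x y) := rfl

/-- The alternating form attached to a bilinear form. -/
def antisymmetrization (t : L →+ L →+ N) : altForms L N :=
  ⟨t - t.flip, fun _ => sub_self _⟩

lemma antisymmetrization_apply (t : L →+ L →+ N) (x y : L) :
    (antisymmetrization t).1 x y = t x y - t y x := rfl

lemma exists_bilinear_lift [Module.Free ℤ L] {f : N →+ P} (hf : Function.Surjective f)
    (t : L →+ L →+ P) : ∃ t' : L →+ L →+ N, ∀ x y, f (t' x y) = t x y := by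
  obtain ⟨t', ht⟩ := exists_hom_lift (L := L) (g := AddMonoidHom.compHom (M := L) f)
    (exists_hom_lift hf) t
  exact ⟨t', fun x y => DFunLike.congr_fun (DFunLike.congr_fun ht x) y⟩

/-- Lifting an alternating form directly as a bilinear form could lose the alternating property.
Lifting a bilinear form of which it is the antisymmetrization, and antisymmetrizing the lift,
preserves it. -/
lemma altMap_surjective [Module.Free ℤ L] {f : N →+ P} (hf : Function.Surjective f) :
    Function.Surjective (altMap (L := L) f) := fun B => by
  obtain ⟨t, ht⟩ := exists_antisymmetrization B.2
  obtain ⟨t', ht'⟩ := exists_bilinear_lift hf t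
  refine ⟨antisymmetrization t', altForms.ext' fun x y => ?_⟩
  rw [altMap_apply, antisymmetrization_apply, map_sub, ht', ht', ht]

/-- The projection of the rational numbers to `ℚ ⧸ ℤ`. -/
abbrev toQZ : ℚ →+ QZ := QuotientAddGroup.mk' (AddSubgroup.zmultiples (1 : ℚ))

lemma toQZ_surjective : Function.Surjective toQZ := QuotientAddGroup.mk'_surjective _

/-- Forms with values in `ℤ`, `ℚ` and `ℚ/ℤ` make up a short exact sequence with uniquely divisible
middle term, so `H^1` is the cokernel of reduction on invariant forms. -/
theorem nonempty_groupCohomology_one_altRep {G : Type} [Group G] [Finite G]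
    [DistribMulAction G L] [Module.Free ℤ L] {Q : Type} [AddCommGroup Q]
    (ψ : (altRep G L QZ).invariants →+ Q) (hψ : Function.Surjective ψ)
    (hker : ∀ z, ψ z = 0 ↔ ∃ y, (∀ a, altRep G L ℚ a y = y) ∧ altMap toQZ y = z) :
    Nonempty (groupCohomology (Rep.of (altRep G L ℤ)) 1 ≃+ Q) := by
  have hG : (Nat.card G : ℚ) ≠ 0 := Nat.cast_ne_zero.2 Nat.card_pos.ne'
  refine nonempty_groupCohomology_one_equiv_of_invariants (f := altMap (Int.castAddHom ℚ))
    (g := altMap toQZ) (u := altMap (AddMonoidHom.mulLeft (Nat.card G : ℚ)⁻¹))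
    (ρN := altRep G L ℚ)
    (fun x y h => altForms.ext' fun a b => Int.cast_injective (α := ℚ) (by
      have := congrArg (fun B : altForms L ℚ => B.1 a b) h
      exact this))
    (altMap_surjective toQZ_surjective)
    (fun y => ?_) (fun _ _ => rfl) (fun _ _ => rfl) (fun x => altForms.ext' fun a b => ?_)
    (fun x => altForms.ext' fun a b => ?_) ψ hψ hker
  · constructor
    · intro h
      have h1 : ∀ a b, ∃ z : ℤ, (z : ℚ) = y.1 a b := fun a b => by
        obtain ⟨z, hz⟩ := (AddCircle.coe_eq_zero_iff (1 : ℚ)).1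
          (congrArg (fun B : altForms L QZ => B.1 a b) h)
        exact ⟨z, by rw [← hz, zsmul_eq_mul, mul_one]⟩
      choose z hz using h1
      refine ⟨⟨AddMonoidHom.mk' (fun a => AddMonoidHom.mk' (z a) fun b c => ?_) fun a b =>
        AddMonoidHom.ext fun c => ?_, fun a => ?_⟩, altForms.ext' hz⟩
      · exact Int.cast_injective (α := ℚ) (by rw [Int.cast_add, hz, hz, hz, map_add])
      · refine Int.cast_injective (α := ℚ) ?_
        change (z (a + b) c : ℚ) = (z a c + z b c : ℤ)
        rw [Int.cast_add, hz, hz, hz, map_add]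
        rfl
      · exact Int.cast_injective (α := ℚ) ((hz a a).trans (y.2 a))
    · rintro ⟨x, rfl⟩
      refine altForms.ext' fun a b => (AddCircle.coe_eq_zero_iff (1 : ℚ)).2 ⟨x.1 a b, ?_⟩
      rw [zsmul_eq_mul, mul_one]
      rfl
  · change Nat.card G • ((Nat.card G : ℚ)⁻¹ * x.1 a b) = x.1 a b
    rw [nsmul_eq_mul, mul_inv_cancel_left₀ hG]
  · change (Nat.card G : ℚ)⁻¹ * (Nat.card G • x.1 a b) = x.1 a b
    rw [nsmul_eq_mul, inv_mul_cancel_left₀ hG]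

end AlternatingForms

/-! ### Invariant alternating forms on the kernel of the summation map -/

section Invariants

variable {Λ T : Type} [AddCommGroup Λ] [AddCommGroup T] {n m : ℕ}

/-- The coordinates of an element of the kernel of the summation map. -/
def coord (i : Fin n) : kerSum Λ n →+ Λ where
  toFun a := a.1 i
  map_zero' := rfl
  map_add' _ _ := rfl

/-- The bilinear form `s (a_i) (b_j)`. -/
def coordForm (s : Λ →+ Λ →+ T) (i j : Fin n) : kerSum Λ n →+ kerSum Λ n →+ T :=
  (s.compl₂ (coord j)).comp (coord i)

lemma coordForm_apply (s : Λ →+ Λ →+ T) (i j : Fin n) (a b : kerSum Λ n) :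
    coordForm s i j a b = s (a.1 i) (b.1 j) := rfl

/-- The bilinear form on `Λ` attached to two pairs of indices. -/
def pairingForm (B : altForms (kerSum Λ n) T) (i j k l : Fin n) : Λ →+ Λ →+ T :=
  (B.1.compl₂ (pairing k l)).comp (pairing i j)

lemma pairingForm_apply (B : altForms (kerSum Λ n) T) (i j k l : Fin n) (x y : Λ) :
    pairingForm B i j k l x y = B.1 (pairing i j x) (pairing k l y) := rfl

/-- The invariance of an alternating form under the alternating group. -/
abbrev IsInvariant (B : altForms (kerSum Λ n) T) : Prop :=
  ∀ g, altRep (alternatingGroup (Fin n)) (kerSum Λ n) T g B = B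

lemma IsInvariant.pairingForm_smul {B : altForms (kerSum Λ n) T} (hB : IsInvariant B)
    (g : alternatingGroup (Fin n)) (i j k l : Fin n) :
    pairingForm B (g.1 i) (g.1 j) (g.1 k) (g.1 l) = pairingForm B i j k l := by
  ext x y
  have := congrArg (fun C : altForms (kerSum Λ n) T => C.1 (pairing i j x) (pairing k l y)) (hB g⁻¹)
  rw [altRep_apply, inv_inv, smul_pairing, smul_pairing] at this
  exact this

lemma pairingForm_antisymm (B : altForms (kerSum Λ n) T) (i j k l : Fin n) (x y : Λ) :
    pairingForm B i j k l x y = -pairingForm B k l i j y x :=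
  altForms.antisymm B.2 _ _

lemma pairingForm_add_left (B : altForms (kerSum Λ n) T) (i j j' k l : Fin n) (x y : Λ) :
    pairingForm B i j k l x y + pairingForm B j j' k l x y = pairingForm B i j' k l x y := by
  rw [pairingForm_apply, pairingForm_apply, pairingForm_apply, ← pairing_add i j j', map_add]
  rfl

lemma pairingForm_add_right (B : altForms (kerSum Λ n) T) (i j k l l' : Fin n) (x y : Λ) :
    pairingForm B i j k l x y + pairingForm B i j l l' x y = pairingForm B i j k l' x y := by
  rw [pairingForm_apply, pairingForm_apply, pairingForm_apply, ← pairing_add k l l', map_add]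

lemma pairingForm_self_left (B : altForms (kerSum Λ n) T) (i k l : Fin n) (x y : Λ) :
    pairingForm B i i k l x y = 0 := by
  rw [pairingForm_apply, pairing_self, map_zero]
  rfl

lemma pairingForm_self_right (B : altForms (kerSum Λ n) T) (i j k : Fin n) (x y : Λ) :
    pairingForm B i j k k x y = 0 := by
  rw [pairingForm_apply, pairing_self, map_zero]

lemma pairingForm_neg_left (B : altForms (kerSum Λ n) T) (i j k l : Fin n) (x y : Λ) :
    pairingForm B i j k l x y = -pairingForm B j i k l x y := by
  rw [← add_eq_zero_iff_eq_neg, pairingForm_add_left, pairingForm_self_left]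

lemma pairingForm_neg_right (B : altForms (kerSum Λ n) T) (i j k l : Fin n) (x y : Λ) :
    pairingForm B i j k l x y = -pairingForm B i j l k x y := by
  rw [← add_eq_zero_iff_eq_neg, pairingForm_add_right, pairingForm_self_right]

/-- Forms on the kernel of the summation map are determined by their values on pairs. -/
lemma altForms_ext_pairingForm {B C : altForms (kerSum Λ n) T} (j : Fin n)
    (h : ∀ i k, i ≠ j → k ≠ j → pairingForm B i j k j = pairingForm C i j k j) : B = C := by
  refine altForms.ext' fun a b => ?_
  rw [← sum_pairing j a, ← sum_pairing j b]
  simp only [map_sum, AddMonoidHom.finsetSum_apply]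
  refine Finset.sum_congr rfl fun k _ => Finset.sum_congr rfl fun i _ => ?_
  by_cases hi : i = j
  · rw [hi, pairing_self, map_zero, map_zero]
  by_cases hk : k = j
  · rw [hk, pairing_self, map_zero, map_zero]
  exact DFunLike.congr_fun (DFunLike.congr_fun (h i k hi hk) _) _

lemma isInvariant_of_tri {B : altForms (kerSum Λ (m + 2)) T} (h : ∀ (i : Fin m) a b,
    B.1 ((tri i)⁻¹ • a) ((tri i)⁻¹ • b) = B.1 a b) : IsInvariant B := by
  let S : Subgroup (alternatingGroup (Fin (m + 2))) :=
    { carrier := {g | altRep (alternatingGroup (Fin (m + 2))) (kerSum Λ (m + 2)) T g B = B}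
      one_mem' := by
        change altRep _ _ T 1 B = B
        rw [map_one]; rfl
      mul_mem' {a b} ha hb := by
        change altRep _ _ T (a * b) B = B
        rw [map_mul]
        change altRep _ _ T a (altRep _ _ T b B) = B
        rw [hb, ha]
      inv_mem' {a} ha := by
        change altRep _ _ T a⁻¹ B = B
        conv_lhs => rw [← ha]
        change (altRep (alternatingGroup (Fin (m + 2))) (kerSum Λ (m + 2)) T a⁻¹ *
          altRep (alternatingGroup (Fin (m + 2))) (kerSum Λ (m + 2)) T a) B = B
        rw [← map_mul, inv_mul_cancel, map_one]; rfl }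
  have hS : S = ⊤ := by
    rw [eq_top_iff, ← closure_range_tri m, Subgroup.closure_le]
    rintro _ ⟨i, rfl⟩
    exact altForms.ext' (h i)
  exact fun g => (hS.ge (Subgroup.mem_top g) : g ∈ S)

lemma inv_smul_apply (g : alternatingGroup (Fin n)) (a : kerSum Λ n) (i : Fin n) :
    (g⁻¹ • a).1 i = a.1 (g.1 i) := by
  change a.1 ((g.1⁻¹)⁻¹ i) = _
  rw [inv_inv]

end Invariants

/-! ### Classification of invariant alternating forms -/

section Basis

variable {Λ T : Type} [AddCommGroup Λ] [AddCommGroup T] {r : ℕ} (b : Module.Basis (Fin r) ℤ Λ)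

include b

lemma hom_ext_basis {f g : Λ →+ T} (h : ∀ i, f (b i) = g (b i)) : f = g := by
  have : f.toIntLinearMap = g.toIntLinearMap := b.ext h
  exact AddMonoidHom.ext fun x => LinearMap.congr_fun this x

lemma exists_hom_basis (v : Fin r → T) : ∃ f : Λ →+ T, ∀ i, f (b i) = v i :=
  ⟨(b.constr ℤ v).toAddMonoidHom, fun i => b.constr_basis ℤ v i⟩

lemma exists_bilinear_basis (M : Fin r → Fin r → T) :
    ∃ s : Λ →+ Λ →+ T, ∀ i j, s (b i) (b j) = M i j := by
  choose f hf using fun i => exists_hom_basis b (M i)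
  obtain ⟨s, hs⟩ := exists_hom_basis b f
  exact ⟨s, fun i j => by rw [hs, hf]⟩

lemma antisymm_of_basis {s : Λ →+ Λ →+ T} (h : ∀ i j, s (b i) (b j) = -s (b j) (b i)) (x y : Λ) :
    s x y = -s y x := by
  have : s = -s.flip := hom_ext_basis b fun i => hom_ext_basis b (h i)
  exact DFunLike.congr_fun (DFunLike.congr_fun this x) y

/-- The quadratic form of an antisymmetric bilinear form is additive. -/
def diagonal {Λ T : Type} [AddCommGroup Λ] [AddCommGroup T] {s : Λ →+ Λ →+ T}
    (h : ∀ x y, s x y = -s y x) : Λ →+ T :=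
  AddMonoidHom.mk' (fun x => s x x) fun x y => by
    rw [map_add (s (x + y)), map_add s, AddMonoidHom.add_apply, AddMonoidHom.add_apply, h y x]
    abel

lemma alternating_of_basis {s : Λ →+ Λ →+ T} (h : ∀ i j, s (b i) (b j) = -s (b j) (b i))
    (h0 : ∀ i, s (b i) (b i) = 0) (x : Λ) : s x x = 0 :=
  DFunLike.congr_fun (hom_ext_basis b h0 : diagonal (antisymm_of_basis b h) = 0) x

end Basis

/-! ### Invariant alternating forms in degrees three and four. -/

section Classification

variable {Λ T : Type} [AddCommGroup Λ] [AddCommGroup T] {m n : ℕ}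

lemma altMap_pairingForm {P : Type} [AddCommGroup P] (f : T →+ P) (B : altForms (kerSum Λ n) T)
    (i j k l : Fin n) (x y : Λ) :
    pairingForm (altMap f B) i j k l x y = f (pairingForm B i j k l x y) := rfl

/-- An invariant form in degree three. -/
def formThree (s : Λ →+ Λ →+ T) : altForms (kerSum Λ 3) T :=
  antisymmetrization (coordForm s 0 1 + coordForm s 0 0 + coordForm s 1 1)

lemma formThree_apply (s : Λ →+ Λ →+ T) (a b : kerSum Λ 3) : (formThree s).1 a b =
    s (a.1 0) (b.1 1) + s (a.1 0) (b.1 0) + s (a.1 1) (b.1 1) -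
      (s (b.1 0) (a.1 1) + s (b.1 0) (a.1 0) + s (b.1 1) (a.1 1)) := rfl

lemma isInvariant_formThree (s : Λ →+ Λ →+ T) : IsInvariant (formThree s) := by
  refine isInvariant_of_tri (m := 1) fun i a b => ?_
  have hs : ∀ a : kerSum Λ 3, a.1 2 = -a.1 0 - a.1 1 := fun a => by
    have : ∑ i, a.1 i = 0 := a.2
    rw [Fin.sum_univ_three] at this
    rw [← sub_eq_zero, ← this]
    abel
  rw [Subsingleton.elim i 0, formThree_apply, formThree_apply]
  simp only [inv_smul_apply, show (tri (0 : Fin 1)).1 0 = 1 from rfl,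
    show (tri (0 : Fin 1)).1 1 = 2 by decide, hs, map_sub, map_neg, AddMonoidHom.sub_apply,
    AddMonoidHom.neg_apply]
  abel

lemma pairing_coord (i j k : Fin n) (x : Λ) :
    (pairing i j x).1 k = (if k = i then x else 0) - if k = j then x else 0 := by
  rw [pairing_apply, Pi.sub_apply, Pi.single_apply, Pi.single_apply]

/-- Cyclic invariance expresses the values on two equal pairs as the antisymmetrization of the value
on the pairs `(0, 2)` and `(1, 2)`, and leaves the latter unconstrained. -/
theorem IsInvariant.eq_formThree {B : altForms (kerSum Λ 3) T} (hB : IsInvariant B) :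
    B = formThree (pairingForm B 0 2 1 2) := by
  have h1 : pairingForm B 1 0 1 0 = pairingForm B 0 2 0 2 :=
    hB.pairingForm_smul (tri (0 : Fin 1)) 0 2 0 2
  have h2 : pairingForm B 2 1 2 1 = pairingForm B 1 0 1 0 :=
    hB.pairingForm_smul (tri (0 : Fin 1)) 1 0 1 0
  have h3 : pairingForm B 2 0 0 1 = pairingForm B 1 2 2 0 :=
    hB.pairingForm_smul (tri (0 : Fin 1)) 1 2 2 0
  have hd : ∀ x y, pairingForm B 0 2 0 2 x y =
      pairingForm B 0 2 1 2 x y - pairingForm B 0 2 1 2 y x := fun x y => by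
    rw [← pairingForm_add_right B 0 2 0 1 2, pairingForm_neg_left B 0 2 0 1, h3,
      pairingForm_neg_right B 1 2 2 0, neg_neg, pairingForm_antisymm B 1 2 0 2]
    abel
  have hd1 : ∀ x y, pairingForm B 1 2 1 2 x y = pairingForm B 0 2 0 2 x y := fun x y => by
    rw [← h1, ← h2, pairingForm_neg_left, pairingForm_neg_right, neg_neg]
  refine altForms_ext_pairingForm 2 fun i k hi hk => AddMonoidHom.ext fun x =>
    AddMonoidHom.ext fun y => ?_
  rw [pairingForm_apply (formThree _), formThree_apply]
  simp only [pairing_coord]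
  fin_cases i <;> fin_cases k <;> simp at hi hk ⊢
  · rw [hd]
  · rw [pairingForm_antisymm]
  · rw [hd1, hd]

/-- An invariant form in degree four. -/
def formFour (s : Λ →+ Λ →+ T) : altForms (kerSum Λ 4) T :=
  antisymmetrization (coordForm s 0 1 + coordForm s 1 2 + coordForm s 2 0 +
    (coordForm s 0 0 + coordForm s 1 1 + coordForm s 2 2))

lemma formFour_apply (s : Λ →+ Λ →+ T) (a b : kerSum Λ 4) : (formFour s).1 a b =
    s (a.1 0) (b.1 1) + s (a.1 1) (b.1 2) + s (a.1 2) (b.1 0) +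
      (s (a.1 0) (b.1 0) + s (a.1 1) (b.1 1) + s (a.1 2) (b.1 2)) -
    (s (b.1 0) (a.1 1) + s (b.1 1) (a.1 2) + s (b.1 2) (a.1 0) +
      (s (b.1 0) (a.1 0) + s (b.1 1) (a.1 1) + s (b.1 2) (a.1 2))) := rfl

/-- Invariance under `(0 1 2)` holds for every `s`. Under `(0 1 3)` the form changes by a difference
of doubled symmetrizations of `s`, which is where the hypothesis enters. -/
lemma isInvariant_formFour {s : Λ →+ Λ →+ T} (h : ∀ x y, 2 • (s x y + s y x) = 0) :
    IsInvariant (formFour s) := by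
  refine isInvariant_of_tri (m := 2) fun i a b => ?_
  have hs : ∀ a : kerSum Λ 4, a.1 3 = -a.1 0 - a.1 1 - a.1 2 := fun a => by
    have : ∑ i, a.1 i = 0 := a.2
    rw [Fin.sum_univ_four] at this
    rw [← sub_eq_zero, ← this]
    abel
  rw [formFour_apply, formFour_apply]
  revert i
  rw [Fin.forall_fin_two]
  constructor
  · simp only [inv_smul_apply, show (tri (0 : Fin 2)).1 0 = 1 from rfl,
      show (tri (0 : Fin 2)).1 1 = 2 by decide, show (tri (0 : Fin 2)).1 2 = 0 by decide]
    abel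
  · simp only [inv_smul_apply, show (tri (1 : Fin 2)).1 0 = 1 from rfl,
      show (tri (1 : Fin 2)).1 1 = 3 by decide, show (tri (1 : Fin 2)).1 2 = 2 by decide, hs,
      map_sub, map_neg, AddMonoidHom.sub_apply, AddMonoidHom.neg_apply]
    rw [← sub_eq_zero]
    refine Eq.trans (b := 2 • (s (a.1 2) (b.1 1) + s (b.1 1) (a.1 2)) -
      2 • (s (a.1 1) (b.1 2) + s (b.1 2) (a.1 1))) ?_ (by rw [h, h, sub_zero])
    abel

/-- The symmetrization is the value of `B` on the disjoint pairs `(0, 3)` and `(1, 2)`. A double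
transposition exchanges the two pairs, so antisymmetry of `B` makes this value its own negative. -/
theorem IsInvariant.two_nsmul_eq_zero {B : altForms (kerSum Λ 4) T} (hB : IsInvariant B) (x y : Λ) :
    2 • (pairingForm B 0 3 1 3 x y + pairingForm B 0 3 1 3 y x) = 0 := by
  have h1 : pairingForm B 1 3 2 3 = pairingForm B 0 3 1 3 :=
    hB.pairingForm_smul (tri (0 : Fin 2)) 0 3 1 3
  have h2 : pairingForm B 2 3 0 3 = pairingForm B 1 3 2 3 :=
    hB.pairingForm_smul (tri (0 : Fin 2)) 1 3 2 3
  have he : ∀ x y, pairingForm B 0 3 1 2 x y =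
      pairingForm B 0 3 1 3 x y + pairingForm B 0 3 1 3 y x := fun x y => by
    rw [← pairingForm_add_right B 0 3 1 3 2, pairingForm_neg_right B 0 3 3 2,
      pairingForm_antisymm B 0 3 2 3, neg_neg, h2, h1]
  have h3 : pairingForm B 1 2 0 3 = pairingForm B 0 3 1 2 :=
    hB.pairingForm_smul (swapSwap 0 1 2 3 (by decide) (by decide)) 0 3 1 2
  have h4 := DFunLike.congr_fun (DFunLike.congr_fun h3 x) y
  rw [pairingForm_antisymm, he, he] at h4
  rw [two_nsmul]
  nth_rewrite 1 [← h4]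
  rw [add_comm (pairingForm B 0 3 1 3 y x), neg_add_cancel]

theorem IsInvariant.eq_formFour {B : altForms (kerSum Λ 4) T} (hB : IsInvariant B) :
    B = formFour (pairingForm B 0 3 1 3) := by
  have h1 : pairingForm B 1 3 2 3 = pairingForm B 0 3 1 3 :=
    hB.pairingForm_smul (tri (0 : Fin 2)) 0 3 1 3
  have h2 : pairingForm B 2 3 0 3 = pairingForm B 1 3 2 3 :=
    hB.pairingForm_smul (tri (0 : Fin 2)) 1 3 2 3
  have h3 : pairingForm B 1 3 1 3 = pairingForm B 0 3 0 3 :=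
    hB.pairingForm_smul (tri (0 : Fin 2)) 0 3 0 3
  have h4 : pairingForm B 2 3 2 3 = pairingForm B 1 3 1 3 :=
    hB.pairingForm_smul (tri (0 : Fin 2)) 1 3 1 3
  have h5 : pairingForm B 3 0 1 0 = pairingForm B 1 3 0 3 :=
    hB.pairingForm_smul (tri (1 : Fin 2)) 1 3 0 3
  have hd : ∀ x y, pairingForm B 0 3 0 3 x y =
      pairingForm B 0 3 1 3 x y - pairingForm B 0 3 1 3 y x := fun x y => by
    rw [← pairingForm_add_right B 0 3 0 1 3, pairingForm_neg_left B 0 3 0 1,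
      pairingForm_neg_right B 3 0 0 1, neg_neg, h5, pairingForm_antisymm B 1 3 0 3]
    abel
  refine altForms_ext_pairingForm 3 fun i k hi hk => AddMonoidHom.ext fun x =>
    AddMonoidHom.ext fun y => ?_
  rw [pairingForm_apply (formFour _), formFour_apply]
  simp only [pairing_coord]
  fin_cases i <;> fin_cases k <;> simp at hi hk ⊢
  · rw [hd]
  · rw [pairingForm_antisymm, h2, h1]
  · rw [pairingForm_antisymm]
  · rw [h3, hd]
  · rw [h1]
  · rw [h2, h1]
  · rw [pairingForm_antisymm, h1]
  · rw [h4, h3, hd]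

end Classification

/-! ### Invariant alternating forms in degree at least five -/

section Large

variable {Λ T : Type} [AddCommGroup Λ] [AddCommGroup T] {m n : ℕ}

/-- The alternating group on `m + 2` letters is `m`-transitive. -/
lemma exists_triple (hm : 3 ≤ m) {i j k : Fin (m + 2)} {i' j' k' : Fin (m + 2)} (hij : i ≠ j)
    (hik : i ≠ k) (hjk : j ≠ k) (hij' : i' ≠ j') (hik' : i' ≠ k') (hjk' : j' ≠ k') :
    ∃ g : alternatingGroup (Fin (m + 2)), g.1 i = i' ∧ g.1 j = j' ∧ g.1 k = k' := by
  have h1 : MulAction.IsMultiplyPretransitive (alternatingGroup (Fin (m + 2))) (Fin (m + 2)) m := by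
    have := alternatingGroup.isMultiplyPretransitive (Fin (m + 2))
    rwa [Nat.card_eq_fintype_card, Fintype.card_fin] at this
  have h3 : MulAction.IsMultiplyPretransitive (alternatingGroup (Fin (m + 2))) (Fin (m + 2)) 3 :=
    MulAction.isMultiplyPretransitive_of_le (n := m) hm (by simp)
  have hinj : ∀ {i j k : Fin (m + 2)}, i ≠ j → i ≠ k → j ≠ k →
      Function.Injective ![i, j, k] := fun {i j k} h1 h2 h3 a b h => by
    fin_cases a <;> fin_cases b <;> simp_all
  obtain ⟨g, hg⟩ := h3.exists_smul_eq ⟨_, hinj hij hik hjk⟩ ⟨_, hinj hij' hik' hjk'⟩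
  exact ⟨g, DFunLike.congr_fun hg 0, DFunLike.congr_fun hg 1, DFunLike.congr_fun hg 2⟩

lemma IsInvariant.pairingForm_eq (hm : 3 ≤ m) {B : altForms (kerSum Λ (m + 2)) T}
    (hB : IsInvariant B) {i j k i' j' k' : Fin (m + 2)} (hij : i ≠ j)
    (hik : i ≠ k) (hjk : j ≠ k) (hij' : i' ≠ j') (hik' : i' ≠ k') (hjk' : j' ≠ k') :
    pairingForm B i' j' k' j' = pairingForm B i j k j := by
  obtain ⟨g, rfl, rfl, rfl⟩ := exists_triple hm hij hik hjk hij' hik' hjk'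
  exact hB.pairingForm_smul g i j k j

/-- The form `∑ i, s (a_i) (b_i)`, for an antisymmetric form `s`. -/
def formSum (n : ℕ) (s : Λ →+ Λ →+ T) (hs : ∀ x y, s x y = -s y x) : altForms (kerSum Λ n) T :=
  ⟨∑ i, coordForm s i i, fun a => by
    have ha : ∑ i, a.1 i = 0 := a.2
    simp only [AddMonoidHom.finsetSum_apply, coordForm_apply]
    -- For antisymmetric `s` the map `x ↦ s x x` is additive, so it can be evaluated on the sum of
    -- the entries, which is zero.
    change ∑ i, diagonal hs (a.1 i) = 0
    rw [← map_sum, ha, map_zero]⟩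

lemma formSum_apply {s : Λ →+ Λ →+ T} (hs : ∀ x y, s x y = -s y x) (a b : kerSum Λ n) :
    (formSum n s hs).1 a b = ∑ i, s (a.1 i) (b.1 i) := by
  change (∑ i, coordForm s i i) a b = _
  simp only [AddMonoidHom.finsetSum_apply, coordForm_apply]

lemma isInvariant_formSum {s : Λ →+ Λ →+ T} (hs : ∀ x y, s x y = -s y x) :
    IsInvariant (formSum n s hs) := fun g => altForms.ext' fun a b => by
  rw [altRep_apply, formSum_apply, formSum_apply]
  simp only [inv_smul_apply]
  exact Equiv.sum_comp g.1 fun i => s (a.1 i) (b.1 i)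

lemma formSum_pairingForm {s : Λ →+ Λ →+ T} (hs : ∀ x y, s x y = -s y x) {i j k : Fin n}
    (hij : i ≠ j) (hkj : k ≠ j) (x y : Λ) :
    pairingForm (formSum n s hs) i j k j x y = (if i = k then s x y else 0) + s x y := by
  rw [pairingForm_apply, formSum_apply]
  have h : ∀ i (w : Fin n → Λ), ∑ l, s ((Pi.single i x : Fin n → Λ) l) (w l) = s x (w i) :=
    fun i w => by
      rw [Finset.sum_eq_single i, Pi.single_eq_same]
      · intro l _ hl
        rw [Pi.single_eq_of_ne hl, map_zero]; rfl
      · exact fun h => absurd (Finset.mem_univ i) h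
  have h2 : ∀ l, s ((pairing i j x).1 l) ((pairing k j y).1 l) =
      s ((Pi.single i x : Fin n → Λ) l) ((pairing k j y).1 l) -
        s ((Pi.single j x : Fin n → Λ) l) ((pairing k j y).1 l) := fun l => by
    rw [pairing_apply i j, Pi.sub_apply, map_sub]; rfl
  simp only [h2, Finset.sum_sub_distrib, h]
  rw [pairing_coord, pairing_coord, if_neg hij, if_neg hkj.symm, if_pos rfl, sub_zero, zero_sub,
    map_neg, sub_neg_eq_add]
  congr 1
  split_ifs <;> simp

/-- Triple transitivity exchanges `i` and `k` while fixing `j`. -/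
lemma IsInvariant.antisymm (hm : 3 ≤ m) {B : altForms (kerSum Λ (m + 2)) T}
    (hB : IsInvariant B) {i j k : Fin (m + 2)} (hij : i ≠ j) (hik : i ≠ k) (hjk : j ≠ k) (x y : Λ) :
    pairingForm B i j k j x y = -pairingForm B i j k j y x := by
  rw [pairingForm_antisymm, hB.pairingForm_eq hm hij hik hjk hjk.symm hik.symm hij.symm]

/-- Triple transitivity leaves one form `s` for all triples of distinct letters. On two equal pairs,
inserting a third letter `l` gives the value `2 s`. -/
theorem IsInvariant.eq_formSum (hm : 3 ≤ m) {B : altForms (kerSum Λ (m + 2)) T}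
    (hB : IsInvariant B) {i₀ j₀ k₀ : Fin (m + 2)} (hij : i₀ ≠ j₀) (hik : i₀ ≠ k₀) (hjk : j₀ ≠ k₀) :
    B = formSum (m + 2) (pairingForm B i₀ j₀ k₀ j₀) (hB.antisymm hm hij hik hjk) := by
  refine altForms_ext_pairingForm j₀ fun i k hi hk => AddMonoidHom.ext fun x =>
    AddMonoidHom.ext fun y => ?_
  rw [formSum_pairingForm _ hi hk]
  by_cases h : i = k
  · subst h
    obtain ⟨l, hl, hl'⟩ : ∃ l, i ≠ l ∧ j₀ ≠ l := by
      by_cases h : i = i₀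
      · exact ⟨k₀, h ▸ hik, hjk⟩
      · exact ⟨i₀, h, hij.symm⟩
    rw [if_pos rfl, ← pairingForm_add_right B i j₀ i l j₀, pairingForm_neg_left B i j₀ i l,
      pairingForm_neg_right B j₀ i i l, neg_neg,
      hB.pairingForm_eq hm hij hik hjk hi.symm hl' hl,
      hB.pairingForm_eq hm hij hik hjk hi hl hl']
  · rw [if_neg h, zero_add, hB.pairingForm_eq hm hij hik hjk hi h hk.symm]

end Large

/-! ### The first cohomology with coefficients in alternating forms -/

section FirstCohomology

variable {Λ : Type} [AddCommGroup Λ] {r : ℕ} (b : Module.Basis (Fin r) ℤ Λ)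

lemma two_nsmul_eq_zero_of_antisymm {T : Type} [AddCommGroup T] {s : Λ →+ Λ →+ T}
    (hs : ∀ x y, s x y = -s y x) (x y : Λ) : 2 • (s x y + s y x) = 0 := by
  rw [hs x y, neg_add_cancel, smul_zero]

/-- Alternating forms lift to rational alternating forms. -/
lemma exists_alternating_lift [Module.Free ℤ Λ] {s : Λ →+ Λ →+ QZ} (hs : ∀ x, s x x = 0) :
    ∃ s' : Λ →+ Λ →+ ℚ, (∀ x y, s' x y = -s' y x) ∧ ∀ x y, toQZ (s' x y) = s x y := by
  obtain ⟨s', hs'⟩ := altMap_surjective toQZ_surjective (⟨s, hs⟩ : altForms Λ QZ)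
  exact ⟨s'.1, altForms.antisymm s'.2, fun x y =>
    congrArg (fun B : altForms Λ QZ => B.1 x y) hs'⟩

/-- Every bilinear form lifts from `ℚ/ℤ` to `ℚ`, and `formThree` is invariant without any condition
on it. -/
theorem subsingleton_groupCohomology_one [Module.Free ℤ Λ] [Module.Finite ℤ Λ] :
    Subsingleton (groupCohomology
      (Rep.of (altRep (alternatingGroup (Fin 3)) (kerSum Λ 3) ℤ)) 1) := by
  have hker : ∀ B : (altRep (alternatingGroup (Fin 3)) (kerSum Λ 3) QZ).invariants,
      ∃ y, (∀ a, altRep (alternatingGroup (Fin 3)) (kerSum Λ 3) ℚ a y = y) ∧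
        altMap toQZ y = B := fun B => by
    have hB : IsInvariant B.1 := B.2
    obtain ⟨s, hs⟩ := exists_bilinear_lift toQZ_surjective (pairingForm B.1 0 2 1 2)
    refine ⟨formThree s, isInvariant_formThree s, ?_⟩
    rw [hB.eq_formThree]
    refine altForms.ext' fun a b => ?_
    rw [altMap_apply, formThree_apply, formThree_apply]
    simp only [map_add, map_sub, hs]
  obtain ⟨e⟩ := nonempty_groupCohomology_one_altRep (0 : _ →+ PUnit) (fun x => ⟨0, rfl⟩)
    fun B => ⟨fun _ => hker B, fun _ => rfl⟩
  exact e.toEquiv.subsingleton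

/-- The values of an invariant form on two pairs. -/
def pairingValue (n : ℕ) (i j k l : Fin n) (x y : Λ) :
    (altRep (alternatingGroup (Fin n)) (kerSum Λ n) QZ).invariants →+ QZ :=
  AddMonoidHom.mk' (fun B => B.1.1 (pairing i j x) (pairing k l y)) fun _ _ => rfl

/-- An invariant form as an element of the invariants. -/
def toInvariants {T : Type} [AddCommGroup T] {n : ℕ} {B : altForms (kerSum Λ n) T}
    (hB : IsInvariant B) : (altRep (alternatingGroup (Fin n)) (kerSum Λ n) T).invariants := ⟨B, hB⟩

lemma coe_toInvariants {T : Type} [AddCommGroup T] {n : ℕ} {B : altForms (kerSum Λ n) T}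
    (hB : IsInvariant B) : (toInvariants hB).1 = B := rfl

theorem nonempty_groupCohomology_one_kerSum [Module.Free ℤ Λ] [Module.Finite ℤ Λ] {n : ℕ} {Q : Type}
    [AddCommGroup Q] (ψ : (altRep (alternatingGroup (Fin n)) (kerSum Λ n) QZ).invariants →+ Q)
    (hψ : Function.Surjective ψ) (hker : ∀ (B : altForms (kerSum Λ n) QZ) (hB : IsInvariant B),
      ψ (toInvariants hB) = 0 ↔ ∃ y : altForms (kerSum Λ n) ℚ, IsInvariant y ∧ altMap toQZ y = B) :
    Nonempty (groupCohomology
      (Rep.of (altRep (alternatingGroup (Fin n)) (kerSum Λ n) ℤ)) 1 ≃+ Q) :=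
  nonempty_groupCohomology_one_altRep ψ hψ fun z => hker z.1 z.2

include b

lemma exists_antisymm_basis {T : Type} [AddCommGroup T] (d : Fin r → T) (hd : ∀ l, 2 • d l = 0) :
    ∃ s : Λ →+ Λ →+ T, (∀ x y, s x y = -s y x) ∧ ∀ l, s (b l) (b l) = d l := by
  obtain ⟨s, hs⟩ := exists_bilinear_basis b fun l l' => if l = l' then d l else 0
  refine ⟨s, antisymm_of_basis b fun l l' => ?_, fun l => by rw [hs, if_pos rfl]⟩
  rw [hs, hs]
  by_cases h : l = l'
  · rw [h, if_pos rfl, eq_neg_iff_add_eq_zero, ← two_nsmul, hd]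
  · rw [if_neg h, if_neg (Ne.symm h), neg_zero]

lemma exists_bilinear_basis_lt {T : Type} [AddCommGroup T] (d : Fin r → T) (hd : ∀ l, 4 • d l = 0)
    (e : Fin r → Fin r → T) (he : ∀ l l', 2 • e l l' = 0) :
    ∃ s : Λ →+ Λ →+ T, (∀ x y, 2 • (s x y + s y x) = 0) ∧ (∀ l, s (b l) (b l) = d l) ∧
      ∀ l l', l < l' → s (b l) (b l') + s (b l') (b l) = e l l' := by
  obtain ⟨s, hs⟩ := exists_bilinear_basis b fun l l' =>
    if l < l' then e l l' else if l = l' then d l else 0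
  have h1 : ∀ l, s (b l) (b l) = d l := fun l => by
    rw [hs, if_neg (lt_irrefl l), if_pos rfl]
  have h2 : ∀ l l', l < l' → s (b l) (b l') + s (b l') (b l) = e l l' := fun l l' h => by
    rw [hs, hs, if_pos h, if_neg h.not_gt, if_neg h.ne', add_zero]
  have h3 : ∀ l l', 2 • (s (b l) (b l') + s (b l') (b l)) = 0 := fun l l' => by
    rcases lt_trichotomy l l' with h | h | h
    · rw [h2 l l' h, he]
    · rw [← h, h1, ← two_nsmul, ← mul_nsmul]
      exact hd l
    · rw [add_comm, h2 l' l h, he]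
  refine ⟨s, fun x y => ?_, h1, h2⟩
  have : 2 • (s + s.flip) = 0 := hom_ext_basis b fun l => hom_ext_basis b (h3 l)
  exact DFunLike.congr_fun (DFunLike.congr_fun this x) y

/-- Invariant forms correspond to antisymmetric `s` on `Λ`. Rational ones are alternating, and
alternating `ℚ/ℤ`-valued ones lift, so the cokernel is given by the diagonal values `s (b l) (b l)`,
which are arbitrary elements killed by two. -/
theorem nonempty_groupCohomology_one_of_five_le {m : ℕ} (hm : 3 ≤ m) :
    Nonempty (groupCohomology (Rep.of (altRep (alternatingGroup (Fin (m + 2)))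
      (kerSum Λ (m + 2)) ℤ)) 1 ≃+ (Fin r → ZMod 2)) := by
  have := Module.Free.of_basis b
  have := Module.Finite.of_basis b
  obtain ⟨i, j, k, hij, hik, hjk⟩ : ∃ i j k : Fin (m + 2), i ≠ j ∧ i ≠ k ∧ j ≠ k :=
    ⟨0, 1, (⟨0, by omega⟩ : Fin m).succ.succ, zero_ne_one_fin, (succ_succ_ne_zero _).symm,
      (succ_succ_ne_one _).symm⟩
  obtain ⟨ψ, hv⟩ : ∃ ψ : (altRep (alternatingGroup (Fin (m + 2)))
      (kerSum Λ (m + 2)) QZ).invariants →+ (Fin r → torsionSubgroup QZ 2),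
      ∀ B l, (ψ B l).1 = pairingForm B.1 i j k j (b l) (b l) :=
    ⟨AddMonoidHom.pi fun l => (pairingValue (m + 2) i j k j (b l) (b l)).codRestrict _ fun B => by
      have hB : IsInvariant B.1 := B.2
      have := hB.antisymm hm hij hik hjk (b l) (b l)
      rw [eq_neg_iff_add_eq_zero, ← two_nsmul] at this
      exact this, fun _ _ => rfl⟩
  have hψ : Function.Surjective ψ := fun d => by
    have h2 : ∀ l, 2 • (d l).1 = 0 := fun l => (d l).2
    have hex := exists_antisymm_basis b (fun l => (d l).1) h2
    obtain ⟨s, hs, hd⟩ := hex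
    refine ⟨toInvariants (isInvariant_formSum hs), funext fun l => Subtype.ext ?_⟩
    rw [hv, coe_toInvariants, formSum_pairingForm _ hij hjk.symm, if_neg hik, zero_add, hd]
  obtain ⟨e⟩ := nonempty_torsionSubgroup_equiv 2
  suffices h : _ from
    let ⟨e'⟩ := nonempty_groupCohomology_one_kerSum ψ hψ h
    ⟨e'.trans (AddEquiv.piCongrRight fun _ => e)⟩
  intro B hB
  constructor
  · intro h
    obtain ⟨s, hs, hs'⟩ := exists_alternating_lift (alternating_of_basis b
      (fun l l' => hB.antisymm hm hij hik hjk (b l) (b l'))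
      (fun l => (hv (toInvariants hB) l).symm.trans (congrArg Subtype.val (congrFun h l))))
    refine ⟨formSum (m + 2) s hs, isInvariant_formSum hs, altForms.ext' fun x y => ?_⟩
    rw [hB.eq_formSum hm hij hik hjk, altMap_apply, formSum_apply, formSum_apply, map_sum]
    exact Finset.sum_congr rfl fun l _ => hs' _ _
  · rintro ⟨y, hy, h⟩
    refine funext fun l => Subtype.ext ?_
    rw [hv, coe_toInvariants]
    have hy' : IsInvariant y := hy
    rw [← h, altMap_pairingForm, self_eq_neg.1 (hy'.antisymm hm hij hik hjk (b l) (b l)), map_zero]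
    rfl

/-- Here only the double of `s x y + s y x` vanishes, so the diagonal values are killed by four and
the symmetrized off-diagonal ones by two. An upper triangular `s` realizes arbitrary such values,
and their vanishing means that `s` is alternating. A rational `s` is antisymmetric, so the values of
its reduction vanish. -/
theorem nonempty_groupCohomology_one_four : Nonempty (groupCohomology
    (Rep.of (altRep (alternatingGroup (Fin 4)) (kerSum Λ 4) ℤ)) 1 ≃+
      (Fin r → ZMod 4) × ({p : Fin r × Fin r // p.1 < p.2} → ZMod 2)) := by
  have := Module.Free.of_basis b
  have := Module.Finite.of_basis b
  obtain ⟨ψ, hv, hv'⟩ : ∃ ψ : (altRep (alternatingGroup (Fin 4)) (kerSum Λ 4) QZ).invariants →+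
      (Fin r → torsionSubgroup QZ 4) × ({p : Fin r × Fin r // p.1 < p.2} → torsionSubgroup QZ 2),
      (∀ B l, ((ψ B).1 l).1 = pairingForm B.1 0 3 1 3 (b l) (b l)) ∧
      ∀ B p, ((ψ B).2 p).1 = pairingForm B.1 0 3 1 3 (b p.1.1) (b p.1.2) +
        pairingForm B.1 0 3 1 3 (b p.1.2) (b p.1.1) :=
    ⟨(AddMonoidHom.pi fun l => (pairingValue 4 0 3 1 3 (b l) (b l)).codRestrict _ fun B => by
      have hB : IsInvariant B.1 := B.2
      have := hB.two_nsmul_eq_zero (b l) (b l)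
      rw [← two_nsmul, ← mul_nsmul] at this
      exact this).prod
    (AddMonoidHom.pi fun p => (pairingValue 4 0 3 1 3 (b p.1.1) (b p.1.2) +
        pairingValue 4 0 3 1 3 (b p.1.2) (b p.1.1)).codRestrict _ fun B => by
      have hB : IsInvariant B.1 := B.2
      exact hB.two_nsmul_eq_zero _ _), fun _ _ => rfl, fun _ _ => rfl⟩
  have hψ : Function.Surjective ψ := fun d => by
    obtain ⟨s, h4, h1, h2⟩ := exists_bilinear_basis_lt b (fun l => (d.1 l).1) (fun l => (d.1 l).2)
      (fun l l' => if h : l < l' then (d.2 ⟨(l, l'), h⟩).1 else 0) fun l l' => by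
        by_cases h : l < l'
        · rw [dif_pos h]
          exact (d.2 ⟨(l, l'), h⟩).2
        · rw [dif_neg h, smul_zero]
    have h5 : ∀ x y, pairingForm (formFour s) 0 3 1 3 x y = s x y := fun x y => by
      rw [pairingForm_apply, formFour_apply]
      simp [pairing_coord]
    refine ⟨toInvariants (isInvariant_formFour h4), Prod.ext (funext fun l => Subtype.ext ?_)
      (funext fun p => Subtype.ext ?_)⟩
    · rw [hv, coe_toInvariants, h5, h1]
    · rw [hv', coe_toInvariants, h5, h5, h2 _ _ p.2, dif_pos p.2]
  obtain ⟨e⟩ := nonempty_torsionSubgroup_equiv 2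
  obtain ⟨e4⟩ := nonempty_torsionSubgroup_equiv 4
  suffices h : _ from
    let ⟨e'⟩ := nonempty_groupCohomology_one_kerSum ψ hψ h
    ⟨e'.trans ((AddEquiv.piCongrRight fun _ => e4).prodCongr (AddEquiv.piCongrRight fun _ => e))⟩
  intro B hB
  constructor
  · intro h
    have h1 : ∀ l, pairingForm B 0 3 1 3 (b l) (b l) = 0 := fun l =>
      (hv (toInvariants hB) l).symm.trans (congrArg Subtype.val (congrFun (congrArg Prod.fst h) l))
    have h2 : ∀ l l', l < l' → pairingForm B 0 3 1 3 (b l) (b l') +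
        pairingForm B 0 3 1 3 (b l') (b l) = 0 := fun l l' hl =>
      (hv' (toInvariants hB) ⟨(l, l'), hl⟩).symm.trans
        (congrArg Subtype.val (congrFun (congrArg Prod.snd h) ⟨(l, l'), hl⟩))
    obtain ⟨s, hs, hs'⟩ := exists_alternating_lift (alternating_of_basis b (fun l l' => by
      rw [eq_neg_iff_add_eq_zero]
      rcases lt_trichotomy l l' with h | h | h
      · exact h2 l l' h
      · rw [h, h1, add_zero]
      · rw [add_comm]; exact h2 l' l h) h1)
    refine ⟨formFour s, isInvariant_formFour (two_nsmul_eq_zero_of_antisymm hs),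
      altForms.ext' fun x y => ?_⟩
    rw [hB.eq_formFour, altMap_apply, formFour_apply, formFour_apply]
    simp only [map_add, map_sub, hs']
  · rintro ⟨y, hy, h⟩
    have hy' : IsInvariant y := hy
    have h0 : ∀ u v, pairingForm y 0 3 1 3 u v + pairingForm y 0 3 1 3 v u = 0 := fun u v =>
      (smul_eq_zero.1 (hy'.two_nsmul_eq_zero u v)).resolve_left two_ne_zero
    have h1 : ∀ u v, pairingForm B 0 3 1 3 u v = toQZ (pairingForm y 0 3 1 3 u v) := fun u v => by
      rw [← h, altMap_pairingForm]
    refine Prod.ext (funext fun l => Subtype.ext ?_) (funext fun p => Subtype.ext ?_)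
    · rw [hv, coe_toInvariants, h1, add_self_eq_zero.1 (h0 (b l) (b l)), map_zero]
      rfl
    · rw [hv', coe_toInvariants, h1, h1, ← map_add, h0, map_zero]
      rfl

end FirstCohomology

/-! ### Transfer along isomorphisms and a basis of the lattice -/

lemma nsmul_eq_zero_of_addEquiv {A B : Type} [AddCommGroup A] [AddCommGroup B] {k : ℕ}
    (h : Nonempty (A ≃+ B)) (hB : ∀ y : B, k • y = 0) (x : A) : k • x = 0 := by
  obtain ⟨e⟩ := h
  rw [← e.map_eq_zero_iff, map_nsmul, hB]

lemma nsmul_zmod_eq_zero {k m : ℕ} (h : m ∣ k) (y : ZMod m) : k • y = 0 := by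
  rw [nsmul_eq_mul, (ZMod.natCast_eq_zero_iff k m).2 h, zero_mul]

lemma nsmul_pi_zmod_eq_zero {ι : Type} {k m : ℕ} (h : m ∣ k) (y : ι → ZMod m) : k • y = 0 :=
  funext fun i => nsmul_zmod_eq_zero h (y i)

lemma nsmul_eq_zero_of_subsingleton {A : Type} [AddCommGroup A] {k : ℕ} (h : Subsingleton A)
    (x : A) : k • x = 0 :=
  Subsingleton.elim _ _

lemma subsingleton_of_addEquiv {A B : Type} [AddCommGroup A] [AddCommGroup B]
    (h : Nonempty (A ≃+ B)) (hB : Subsingleton B) : Subsingleton A :=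
  h.some.toEquiv.subsingleton

lemma nonempty_addEquiv_trans {A B C : Type} [AddCommGroup A] [AddCommGroup B] [AddCommGroup C]
    (h : Nonempty (A ≃+ B)) (h' : Nonempty (B ≃+ C)) : Nonempty (A ≃+ C) :=
  ⟨h.some.trans h'.some⟩

lemma nonempty_pairs_addEquiv : Nonempty (({p : Fin 4 × Fin 4 // p.1 < p.2} → ZMod 2) ≃+
    (Fin 6 → ZMod 2)) :=
  ⟨(LinearEquiv.funCongrLeft ℤ (ZMod 2)
    (Fintype.equivFinOfCardEq (by decide :
      Fintype.card {p : Fin 4 × Fin 4 // p.1 < p.2} = 6)).symm).toAddEquiv⟩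

lemma nonempty_basis_fin_four {V : Type} [NormedAddCommGroup V] [NormedSpace ℂ V]
    (hV : Module.finrank ℂ V = 2) (Λ : Submodule ℤ V) [DiscreteTopology Λ] [IsZLattice ℝ Λ] :
    Nonempty (Module.Basis (Fin 4) ℤ Λ) := by
  have : FiniteDimensional ℂ V := Module.finite_of_finrank_pos (by omega)
  have : FiniteDimensional ℝ V := FiniteDimensional.complexToReal V
  have := ZLattice.module_free ℝ Λ
  have := ZLattice.module_finite ℝ Λ
  refine ⟨Module.finBasisOfFinrankEq ℤ Λ ?_⟩
  rw [ZLattice.rank ℝ Λ, finrank_real_of_complex, hV]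

end KummerCohomology

end

theorem proposition4p1 {V : Type} [NormedAddCommGroup V] [NormedSpace ℂ V]
    (hV : Module.finrank ℂ V = 2)
    (Λ : Submodule ℤ V) [DiscreteTopology Λ] [IsZLattice ℝ Λ]
    (hΛ : KummerCohomology.IsPolarizable Λ) (n : ℕ) (hn : 3 ≤ n) :
    let E : ℕ → ℕ → ModuleCat.{0} ℤ := KummerCohomology.alternatingCohomology (V ⧸ Λ) n
    (n = 3 → Subsingleton (E 1 2) ∧ Subsingleton (E 2 1) ∧ Subsingleton (E 3 0)) ∧
    (n = 4 → Nonempty (E 1 2 ≃+ (Fin 4 → ZMod 4) × (Fin 6 → ZMod 2)) ∧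
      Nonempty (E 2 1 ≃+ (Fin 4 → ZMod 2)) ∧ Nonempty (E 3 0 ≃+ ZMod 2)) ∧
    (n = 5 → Nonempty (E 1 2 ≃+ (Fin 4 → ZMod 2)) ∧
      Nonempty (E 2 1 ≃+ (Fin 4 → ZMod 3)) ∧ Nonempty (E 3 0 ≃+ ZMod 2)) ∧
    (n = 6 → Nonempty (E 1 2 ≃+ (Fin 4 → ZMod 2)) ∧
      Nonempty (E 2 1 ≃+ (Fin 4 → ZMod 3)) ∧ Nonempty (E 3 0 ≃+ ZMod 6)) ∧
    (n = 7 → Nonempty (E 1 2 ≃+ (Fin 4 → ZMod 2)) ∧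
      Subsingleton (E 2 1) ∧ Nonempty (E 3 0 ≃+ ZMod 6)) ∧
    (8 ≤ n → Nonempty (E 1 2 ≃+ (Fin 4 → ZMod 2)) ∧
      Subsingleton (E 2 1) ∧ Nonempty (E 3 0 ≃+ ZMod 2)) ∧
    (8 ≤ n → (∀ x : E 1 2, 2 • x = 0) ∧ (∀ x : E 2 1, 2 • x = 0) ∧ ∀ x : E 3 0, 2 • x = 0) ∧
    (n < 8 → (∀ x : E 1 2, 12 • x = 0) ∧ (∀ x : E 2 1, 12 • x = 0) ∧
      ∀ x : E 3 0, 12 • x = 0) := by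
  open KummerCohomology in
  intro E
  obtain ⟨b⟩ := nonempty_basis_fin_four hV Λ
  have := Module.Free.of_basis b
  have := Module.Finite.of_basis b
  have : NeZero n := ⟨by omega⟩
  have e₁ := nonempty_alternatingCohomology_two Λ n 1
  have e₂ := nonempty_alternatingCohomology_one Λ n 2
  have e₃ := nonempty_alternatingCohomology_zero Λ n 3
  have hT := exists_three_nsmul_hom (Λ := Λ)
  have h₃ : n = 3 → Subsingleton (E 1 2) ∧ Subsingleton (E 2 1) ∧ Subsingleton (E 3 0) := by
    rintro rfl
    exact ⟨subsingleton_of_addEquiv e₁ subsingleton_groupCohomology_one,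
      subsingleton_of_addEquiv e₂ (subsingleton_groupCohomology_two (isPrincipal_three hT)),
      subsingleton_of_addEquiv e₃ subsingleton_three⟩
  have h₄ : n = 4 → Nonempty (E 1 2 ≃+ (Fin 4 → ZMod 4) × (Fin 6 → ZMod 2)) ∧
      Nonempty (E 2 1 ≃+ (Fin 4 → ZMod 2)) ∧ Nonempty (E 3 0 ≃+ ZMod 2) := by
    rintro rfl
    exact ⟨nonempty_addEquiv_trans (nonempty_addEquiv_trans e₁
        (nonempty_groupCohomology_one_four b))
        ⟨(AddEquiv.refl _).prodCongr nonempty_pairs_addEquiv.some⟩,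
      nonempty_addEquiv_trans e₂ (nonempty_groupCohomology_two b (exists_twoFour hT)),
      nonempty_addEquiv_trans e₃ nonempty_equiv_four⟩
  have h₁ : 5 ≤ n → Nonempty (E 1 2 ≃+ (Fin 4 → ZMod 2)) := fun h => by
    obtain ⟨m, rfl⟩ : ∃ m, n = m + 2 := ⟨n - 2, by omega⟩
    exact nonempty_addEquiv_trans e₁ (nonempty_groupCohomology_one_of_five_le b (by omega))
  have h₂ : 7 ≤ n → Subsingleton (E 2 1) := fun h => by
    obtain ⟨m, rfl⟩ : ∃ m, n = m + 2 := ⟨n - 2, by omega⟩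
    exact subsingleton_of_addEquiv e₂
      (subsingleton_groupCohomology_two (isPrincipal_of_seven_le hT (by omega)))
  have h₅ : n = 5 → Nonempty (E 2 1 ≃+ (Fin 4 → ZMod 3)) ∧ Nonempty (E 3 0 ≃+ ZMod 2) := by
    rintro rfl
    exact ⟨nonempty_addEquiv_trans e₂ (nonempty_groupCohomology_two b (exists_twoFive hT)),
      nonempty_addEquiv_trans e₃ nonempty_equiv_five⟩
  have h₆ : n = 6 → Nonempty (E 2 1 ≃+ (Fin 4 → ZMod 3)) ∧ Nonempty (E 3 0 ≃+ ZMod 6) := by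
    rintro rfl
    exact ⟨nonempty_addEquiv_trans e₂ (nonempty_groupCohomology_two b (exists_twoSix hT)),
      -- Six letters use the first four of the five generators of the triple cover.
      nonempty_addEquiv_trans e₃ (nonempty_equiv_zmod_six (m := 4) Fin.castSucc
        (Fin.castSucc_injective 4) (i := 0) (a := 1) (b := 2) (c := 3) rfl rfl rfl rfl)⟩
  have h₇ : n = 7 → Nonempty (E 3 0 ≃+ ZMod 6) := by
    rintro rfl
    exact nonempty_addEquiv_trans e₃ (nonempty_equiv_zmod_six (m := 5) id
        Function.injective_id (i := 0) (a := 1) (b := 2) (c := 3) rfl rfl rfl rfl)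
  have h₈ : 8 ≤ n → Nonempty (E 3 0 ≃+ ZMod 2) := fun h => by
    obtain ⟨m, rfl⟩ : ∃ m, n = m + 2 := ⟨n - 2, by omega⟩
    exact nonempty_addEquiv_trans e₃ (nonempty_equiv_of_eight_le (by omega))
  refine ⟨h₃, h₄, fun h => ⟨h₁ (by omega), h₅ h⟩, fun h => ⟨h₁ (by omega), h₆ h⟩,
    fun h => ⟨h₁ (by omega), h₂ (by omega), h₇ h⟩, fun h => ⟨h₁ (by omega), h₂ (by omega), h₈ h⟩,
    fun h => ⟨nsmul_eq_zero_of_addEquiv (h₁ (by omega)) (nsmul_pi_zmod_eq_zero (by decide)),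
      nsmul_eq_zero_of_subsingleton (h₂ (by omega)),
      nsmul_eq_zero_of_addEquiv (h₈ h) (nsmul_zmod_eq_zero (by decide))⟩, fun h => ?_⟩
  obtain h | h | h | h | h : n = 3 ∨ n = 4 ∨ n = 5 ∨ n = 6 ∨ n = 7 := by omega
  · exact ⟨nsmul_eq_zero_of_subsingleton (h₃ h).1, nsmul_eq_zero_of_subsingleton (h₃ h).2.1,
      nsmul_eq_zero_of_subsingleton (h₃ h).2.2⟩
  · exact ⟨nsmul_eq_zero_of_addEquiv (h₄ h).1 fun y => Prod.ext
        (nsmul_pi_zmod_eq_zero (by decide) y.1) (nsmul_pi_zmod_eq_zero (by decide) y.2),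
      nsmul_eq_zero_of_addEquiv (h₄ h).2.1 (nsmul_pi_zmod_eq_zero (by decide)),
      nsmul_eq_zero_of_addEquiv (h₄ h).2.2 (nsmul_zmod_eq_zero (by decide))⟩
  · exact ⟨nsmul_eq_zero_of_addEquiv (h₁ (by omega)) (nsmul_pi_zmod_eq_zero (by decide)),
      nsmul_eq_zero_of_addEquiv (h₅ h).1 (nsmul_pi_zmod_eq_zero (by decide)),
      nsmul_eq_zero_of_addEquiv (h₅ h).2 (nsmul_zmod_eq_zero (by decide))⟩
  · exact ⟨nsmul_eq_zero_of_addEquiv (h₁ (by omega)) (nsmul_pi_zmod_eq_zero (by decide)),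
      nsmul_eq_zero_of_addEquiv (h₆ h).1 (nsmul_pi_zmod_eq_zero (by decide)),
      nsmul_eq_zero_of_addEquiv (h₆ h).2 (nsmul_zmod_eq_zero (by decide))⟩
  · exact ⟨nsmul_eq_zero_of_addEquiv (h₁ (by omega)) (nsmul_pi_zmod_eq_zero (by decide)),
      nsmul_eq_zero_of_subsingleton (h₂ (by omega)),
      nsmul_eq_zero_of_addEquiv (h₇ h) (nsmul_zmod_eq_zero (by decide))⟩
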